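/- Let $A$ be a finite set. A constraint language $\mathcal B$ on $A$ is a (possibly infinite) set of finitary relations on $A$. **The problem.** $\mathrm{QCSP}(\mathcal B)$ has as instances the prenex sentences $\phi = Q_1v_1\cdots Q_nv_n\,\psi$, $Q_i\in\{\forall,\exists\}$, where $\psi$ is a conjunction of equalities $v_i=v_j$ and atoms $R(v_{i_1},\dots,v_{i_k})$ with $R\in\mathcal B$; the yes-instances are the sentences true in $A$. In the *DNF encoding* each relation $R$ occurring in $\phi$ is given by a disjunction of conjunctions of literals of the forms $x_i=a$, $x_i\neq a$ ($a\in A$), $x_i=x_j$, $x_i\ne x_j$ that defines $R$, where, if $|A|\ge 3$, the number of literals of the last form in each disjunct is at most a fixed number $r$ ($r\ge 0$ arbitrary, fixed for the problem). Membership in co-NP refers to the inputs that are instances: there are a polynomial $p$ and a polynomial-time Turing machine $V$ such that, for every instance $\phi$, $\phi$ is false if and only if $V$ accepts $(\phi,w)$ for some binary word $w$ of length at most $p(|\phi|)$. **Existential triviality.** For $c\in A$, a relation $S\subseteq A^k$ is *existentially trivial with canon $c$* if replacing any one coordinate of any tuple of $S$ by $c$ gives a tuple of $S$. A relation is *almost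 existentially trivial with canon $c$* if it is defined by a conjunction of equalities $v=a$ ($a\in A$), equalities $v=v'$, and existentially trivial relations with canon $c$. **The relations $\tau_k$.** For $\alpha,\beta\subsetneq A$ with $\alpha\cup\beta=A$ let $\rho'=\alpha^3\cup\beta^3$ and, for $k\ge1$, $\tau_k(x_1,y_1,z_1,\dots,x_k,y_k,z_k)=\rho'(x_1,y_1,z_1)\vee\dots\vee\rho'(x_k,y_k,z_k)$. Let $\mathbb A_{\alpha,\beta}=\mathrm{Pol}(A;\{\tau_k:k\ge 1\},\{a\}_{a\in A})$ be the clone of all operations on $A$ preserving all $\tau_k$ and all constants, and let $\mathrm{Inv}(\mathbb A_{\alpha,\beta})$ be the set of relations on $A$ invariant under all these operations. **Theorem.** 1. If there is $c\in A$ such that every relation of $\mathcal B$ is almost existentially trivial with canon $c$, then $\mathrm{QCSP}(\mathcal B)$ is in co-NP under the DNF encoding. 2. If $\alpha,\beta\subsetneq A$, $\alpha\cup\beta=A$ and $\alpha\cap\beta\neq\emptyset$, then $\mathrm{QCSP}(\mathrm{Inv}(\mathbb A_{\alpha,\beta}))$ is in co-NP under the DNF encoding. Moreover $\mathbb A_{\alpha,\beta}$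 is idempotent and has the exponentially generated powers property: for some $b>1$, the least size of a generating set of $\mathbb A_{\alpha,\beta}^m$ is $\Omega(b^m)$. So these are among the cases covered by the theorem that $\mathrm{QCSP}(\mathrm{Inv}(\mathbb A))$ is co-NP-hard for every idempotent algebra $\mathbb A$ on a finite domain with exponentially generated powers, and in that sense its co-NP-hardness is optimal for some cases. -/

import Mathlib

namespace QCSP

/-! ### Constraint languages, operations, and the operators `Pol` and `Inv` -/

/-- A (possibly infinite) set of relations on the domain `A`: `𝓑 k` is the set of its `k`-ary
relations. -/
abbrev ConstraintLang (A : Type) : Type := (k : ℕ) → Set (Set (Fin k → A))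

/-- A set of finitary operations on `A`: `F m` is the set of its `m`-ary operations. -/
abbrev OpSet (A : Type) : Type := (m : ℕ) → Set ((Fin m → A) → A)

/-- The `m`-ary operation `f` preserves the `k`-ary relation `R`: applying `f` coordinatewise to
`m` tuples of `R` gives a tuple of `R`. -/
def Preserves {A : Type} {m k : ℕ} (f : (Fin m → A) → A) (R : Set (Fin k → A)) : Prop :=
  ∀ M : Fin m → Fin k → A, (∀ j, M j ∈ R) → (fun i => f (fun j => M j i)) ∈ R

/-- The polymorphisms of `𝓑` (of arity at least one). -/
def Pol {A : Type} (𝓑 : ConstraintLang A) : OpSet A :=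
  fun m => {f | 0 < m ∧ ∀ k, ∀ R ∈ 𝓑 k, Preserves f R}

/-- The relations invariant under all operations of `F`. -/
def Inv {A : Type} (F : OpSet A) : ConstraintLang A :=
  fun _ => {R | ∀ m, ∀ f ∈ F m, Preserves f R}

/-- All operations of `F` are idempotent. -/
def Idempotent {A : Type} (F : OpSet A) : Prop :=
  ∀ m, ∀ f ∈ F m, ∀ a : A, f (fun _ => a) = a

/-! ### Exponentially generated powers -/

/-- `Λ ⊆ A ^ m` generates `A ^ m` with respect to the clone `F`: every tuple is obtained by
applying an operation of `F` coordinatewise to tuples of `Λ`. -/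
def Generates {A : Type} (F : OpSet A) {m : ℕ} (Λ : Set (Fin m → A)) : Prop :=
  ∀ t : Fin m → A, ∃ k, ∃ f ∈ F k, ∃ M : Fin k → Fin m → A,
    (∀ j, M j ∈ Λ) ∧ (fun i => f (fun j => M j i)) = t

/-- The least cardinality of a generating set of `A ^ m` with respect to the clone `F`. -/
noncomputable def genNumber {A : Type} (F : OpSet A) (m : ℕ) : ℕ :=
  sInf {n | ∃ Λ : Finset (Fin m → A), Λ.card = n ∧ Generates F (Λ : Set (Fin m → A))}

/-- The exponentially generated powers property of the clone `F`: `genNumber F m` is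
`Ω (b ^ m)` for some `b > 1`. -/
def EGP {A : Type} (F : OpSet A) : Prop :=
  ∃ b : ℝ, 1 < b ∧
    (fun m : ℕ => b ^ m) =O[Filter.atTop] (fun m : ℕ => (genNumber F m : ℝ))

/-! ### The relations `τ_k` -/

/-- `ρ' = (α × α × α) ∪ (β × β × β)`. -/
def rho' {A : Type} (α β : Set A) (x y z : A) : Prop :=
  (x ∈ α ∧ y ∈ α ∧ z ∈ α) ∨ (x ∈ β ∧ y ∈ β ∧ z ∈ β)

/-- `τ_k (x_1, y_1, z_1, …, x_k, y_k, z_k) = ρ' (x_1, y_1, z_1) ∨ … ∨ ρ' (x_k, y_k, z_k)`. -/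
def tau {A : Type} (α β : Set A) (k : ℕ) : Set (Fin (3 * k) → A) :=
  {t | ∃ i : Fin k, rho' α β (t ⟨3 * i, by omega⟩) (t ⟨3 * i + 1, by omega⟩)
    (t ⟨3 * i + 2, by omega⟩)}

/-- The structure `(A; {τ_k : k ≥ 1}, constants)`, a constant `a` being the unary relation
`{a}`. -/
inductive IsTauConst {A : Type} (α β : Set A) : (k : ℕ) → Set (Fin k → A) → Prop
  | tau (k : ℕ) (hk : 1 ≤ k) : IsTauConst α β (3 * k) (tau α β k)
  | const (a : A) : IsTauConst α β 1 {t | t 0 = a}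

/-- The constraint language of the structure `(A; {τ_k : k ≥ 1}, constants)`. -/
def tauConst {A : Type} (α β : Set A) : ConstraintLang A :=
  fun k => {R | IsTauConst α β k R}

/-! ### Existential triviality -/

/-- `R` is existentially trivial with canon `c`: replacing any one coordinate of a tuple of `R`
by `c` gives a tuple of `R`. -/
def ExTrivial {A : Type} (c : A) {k : ℕ} (R : Set (Fin k → A)) : Prop :=
  ∀ t ∈ R, ∀ i, Function.update t i c ∈ R

/-- `R` is a conjunction of equalities `v = a` (the pairs in `P`), equalities `v = v'` (the pairs
in `Q`) and an existentially trivial relation `S` with canon `c`. A conjunction of existentially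
trivial relations with canon `c`, applied to arbitrary tuples of the `k` variables, is again
existentially trivial with canon `c` as a relation on the `k` variables, so one `S` suffices. -/
def AlmostExTrivial {A : Type} (c : A) {k : ℕ} (R : Set (Fin k → A)) : Prop :=
  ∃ (P : Set (Fin k × A)) (Q : Set (Fin k × Fin k)) (S : Set (Fin k → A)), ExTrivial c S ∧
    ∀ t, t ∈ R ↔ (∀ p ∈ P, t p.1 = p.2) ∧ (∀ q ∈ Q, t q.1 = t q.2) ∧ t ∈ S

/-- `𝓑` consists of almost existentially trivial relations, with a common canon. -/
def IsAlmostExTrivialLang {A : Type} (𝓑 : ConstraintLang A) : Prop :=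
  ∃ c : A, ∀ k, ∀ R ∈ 𝓑 k, AlmostExTrivial c R

/-! ### Relations in disjunctive normal form -/

/-- Literals over equality and constants in the variables `x_0, …, x_{k-1}`. -/
inductive Literal (A : Type) (k : ℕ) : Type
  | eqVar (i j : Fin k) : Literal A k
  | neVar (i j : Fin k) : Literal A k
  | eqConst (i : Fin k) (a : A) : Literal A k
  | neConst (i : Fin k) (a : A) : Literal A k

/-- The literal holds under the assignment `t`. -/
def Literal.Holds {A : Type} {k : ℕ} (t : Fin k → A) : Literal A k → Prop
  | .eqVar i j => t i = t j
  | .neVar i j => t i ≠ t j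
  | .eqConst i a => t i = a
  | .neConst i a => t i ≠ a

/-- The literal is a disequality between two variables. -/
def Literal.isNeVar {A : Type} {k : ℕ} : Literal A k → Bool
  | .neVar _ _ => true
  | _ => false

/-- A disjunction of conjunctions of literals. -/
abbrev DNF (A : Type) (k : ℕ) : Type := List (List (Literal A k))

/-- The `k`-ary relation defined by a DNF. -/
def DNF.rel {A : Type} {k : ℕ} (D : DNF A k) : Set (Fin k → A) :=
  {t | ∃ C ∈ D, ∀ l ∈ C, l.Holds t}

/-- If `A` has at least three elements, then every disjunct contains at most `r` disequalities
between variables. -/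
def DNF.BoundedNe {A : Type} {k : ℕ} (r : ℕ) (D : DNF A k) : Prop :=
  3 ≤ Nat.card A → ∀ C ∈ D, C.countP Literal.isNeVar ≤ r

/-! ### Positive Horn sentences -/

/-- Atoms in the variables `v_0, …, v_{n-1}`: an equality, or a relation given by a DNF and
applied to a tuple of variables. -/
inductive Atom (A : Type) (n : ℕ) : Type
  | eq (i j : Fin n) : Atom A n
  | rel (k : ℕ) (args : Fin k → Fin n) (D : DNF A k) : Atom A n

/-- The atom holds under the assignment `v`. -/
def Atom.Holds {A : Type} {n : ℕ} (v : Fin n → A) : Atom A n → Prop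
  | .eq i j => v i = v j
  | .rel _ args D => (fun i => v (args i)) ∈ D.rel

/-- A prenex sentence `Q_0 v_0 … Q_{n-1} v_{n-1} (conjunction of atoms)`; `univ i` says that the
quantifier of `v_i` is universal. -/
structure Sentence (A : Type) : Type where
  n : ℕ
  univ : Fin n → Bool
  atoms : List (Atom A n)

/-- Truth of `Q_0 v_0 … Q_{n-1} v_{n-1} P (v_0, …, v_{n-1})`; the quantifiers range over `A`. -/
def QuantTrue {A : Type} : (n : ℕ) → (Fin n → Bool) → ((Fin n → A) → Prop) → Prop
  | 0, _, P => P Fin.elim0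
  | n + 1, q, P =>
    if q 0 = true then
      ∀ a : A, QuantTrue n (fun i => q i.succ) (fun v => P (Fin.cons a v : Fin (n + 1) → A))
    else
      ∃ a : A, QuantTrue n (fun i => q i.succ) (fun v => P (Fin.cons a v : Fin (n + 1) → A))

/-- The sentence is true. -/
def Sentence.IsTrue {A : Type} (φ : Sentence A) : Prop :=
  QuantTrue φ.n φ.univ (fun v => ∀ a ∈ φ.atoms, a.Holds v)

/-- `φ` is an instance of QCSP(`𝓑`) in the DNF encoding with parameter `r`: every DNF in it has
at most `r` variable disequalities per disjunct (if `A` has at least three elements) and defines a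
relation of `𝓑`. -/
def IsInstance {A : Type} (𝓑 : ConstraintLang A) (r : ℕ) (φ : Sentence A) : Prop :=
  ∀ (k : ℕ) (args : Fin k → Fin φ.n) (D : DNF A k),
    Atom.rel k args D ∈ φ.atoms → D.BoundedNe r ∧ D.rel ∈ 𝓑 k

/-! ### Sentences as words over a finite alphabet -/

/-- The input alphabet (finite when `A` is). -/
inductive Sym (A : Type) : Type
  | forallQ | existsQ | eqAtom | relAtom | disjunct
  | eqVar | neVar | eqConst | neConst
  | tick | endIndex | body
  | const (a : A)

/-- Indices are written in unary. The index of a variable is smaller than the number of quantifiers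
of the sentence, and the index of a coordinate of a relation is smaller than the number of listed
arguments, so this differs only polynomially in length from binary notation. -/
def encIndex {A : Type} (i : ℕ) : List (Sym A) := List.replicate i .tick ++ [.endIndex]

/-- The word of a literal. -/
def Literal.enc {A : Type} {k : ℕ} : Literal A k → List (Sym A)
  | .eqVar i j => .eqVar :: (encIndex i ++ encIndex j)
  | .neVar i j => .neVar :: (encIndex i ++ encIndex j)
  | .eqConst i a => .eqConst :: (encIndex i ++ [.const a])
  | .neConst i a => .neConst :: (encIndex i ++ [.const a])

/-- The word of a DNF. -/
def DNF.enc {A : Type} {k : ℕ} (D : DNF A k) : List (Sym A) :=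
  D.flatMap (fun C => .disjunct :: C.flatMap Literal.enc)

/-- The word of an atom. -/
def Atom.enc {A : Type} {n : ℕ} : Atom A n → List (Sym A)
  | .eq i j => .eqAtom :: (encIndex i ++ encIndex j)
  | .rel _ args D =>
    .relAtom :: ((List.ofFn args).flatMap (fun i => encIndex i.val) ++ .body :: D.enc)

/-- The word of a sentence. -/
def Sentence.enc {A : Type} (φ : Sentence A) : List (Sym A) :=
  (List.ofFn φ.univ).map (fun b => if b = true then Sym.forallQ else Sym.existsQ)
    ++ φ.atoms.flatMap Atom.enc

/-! ### NP and co-NP, with Mathlib's polynomial-time Turing machines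

Decision problems come with a set of admissible inputs (here: the sentences over the constraint
language); a problem is given by its yes-instances and its no-instances among these. -/

/-- The problem with the given yes- and no-instances is in NP: a polynomial-time verifier accepts
every yes-instance with some certificate of polynomial length, and no no-instance with any such
certificate. The verifier runs in polynomial time on all pairs of words. -/
def InNP {Γ : Type} (yes no : Set (List Γ)) : Prop :=
  ∃ (p : Polynomial ℕ) (V : List Γ × List Bool → Bool),
    Nonempty (Turing.TM2ComputableInPolyTime
      (fun x : List Γ × List Bool => x.1.map Sum.inl ++ x.2.map Sum.inr)
      Computability.encodeBool V) ∧
    (∀ x ∈ yes, ∃ w : List Bool, w.length ≤ p.eval x.length ∧ V (x, w) = true) ∧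
    (∀ x ∈ no, ¬ ∃ w : List Bool, w.length ≤ p.eval x.length ∧ V (x, w) = true)

/-- A problem is in co-NP when its complement is in NP. -/
def InCoNP {Γ : Type} (yes no : Set (List Γ)) : Prop := InNP no yes

/-- QCSP(`𝓑`) in the DNF encoding with parameter `r` is in co-NP. -/
def QCSPInCoNP {A : Type} (𝓑 : ConstraintLang A) (r : ℕ) : Prop :=
  InCoNP {x | ∃ φ : Sentence A, IsInstance 𝓑 r φ ∧ φ.IsTrue ∧ φ.enc = x}
    {x | ∃ φ : Sentence A, IsInstance 𝓑 r φ ∧ ¬ φ.IsTrue ∧ φ.enc = x}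

end QCSP

/-! Part 1. For fixed values `u` of the universal variables, facts "`y` cannot have the value `a`"
are derived by local rules: from the values of universal variables, from equality atoms, and from a
relational atom by a case distinction over its disjuncts. Inside one disjunct, constraint
propagation runs after the values of `m` chosen variables have been guessed. As `m` is fixed, there
are only polynomially many facts for each `u`.

A sentence is false iff there are `u` and `u'` and a position `y` such that `u` and `u'` agree on
the universal variables up to `y` and every value of `y` is excluded by a derivation for `u` or by
one for `u'`. Such a pair refutes the sentence, because a winning strategy gives `y` the same value
under both assignments (`Sys.Refutes.not_isTrue`). Conversely, if there is no such pair, let `y`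
take its only remaining value if at most one value remains under every `u`, and the canon `c`
otherwise. The sets of remaining values for agreeing `u` and `u'` meet, so the value depends on
earlier universal variables only. Equalities and constants implied by an atom are seen by the
derivation rules; the existentially trivial part holds because the chosen tuple arises from a tuple
of the relation by replacing entries by `c` (`Sys.Represents.isTrue`). This needs the rules to be
complete for a single atom (`Sys.exists_litsHold_of_not_inn`): over two values a guess at one
variable decides its whole connected component, and over more values it suffices to guess one side
of each of the boundedly many disequalities.

To obtain a Turing machine, the two assignments and derivations are written as a word after the
sentence. Correctness of the certificate is a first-order property of this word with a comparison of
counts (`Definable.refutes`). Every such property is decided in polynomial time by a program made of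
scans and loops, which is compiled to a machine (`inNP_of_definable`).

Part 2. Let `c ∈ α ∩ β`. An operation that fixes constants and otherwise returns either its `j₀`-th
argument or `c` preserves every `τ_k`. These operations show that an invariant relation is
determined by its implied equalities and by the closure of its tuples under replacing entries by `c`
(`almostExTrivial_of_mem_inv`). For exponential growth, `τ_k` forces a generating set of the `m`-th
power to contain, for every partition of the coordinates into two nonempty blocks, a tuple for which
membership in `α` separates the blocks (`exists_separating`). -/

namespace QCSP

/-! ### While programs on a word, and their compilation to Turing machines -/

/-- Programs acting on a word over `M` and a control state in `S`. `scan δ` passes once over the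
word with the transducer `δ`. -/
inductive Cmd (S M : Type) : Type
  | scan (δ : S → M → S × M) : Cmd S M
  | upd (f : S → S) : Cmd S M
  | seq (p q : Cmd S M) : Cmd S M
  | ite (t : S → Bool) (p q : Cmd S M) : Cmd S M
  | loop (t : S → Bool) (p : Cmd S M) : Cmd S M

/-- The run of a length-preserving transducer. -/
def mealy {S M : Type} (δ : S → M → S × M) : S → List M → S × List M
  | s, [] => (s, [])
  | s, a :: l => ((mealy δ (δ s a).1 l).1, (δ s a).2 :: (mealy δ (δ s a).1 l).2)

theorem length_mealy {S M : Type} (δ : S → M → S × M) (l : List M) :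
    ∀ s, (mealy δ s l).2.length = l.length := by
  induction l with
  | nil => intro s; rfl
  | cons a l ih => intro s; simp [mealy, ih]

/-- `p.Exec s z n s' z'`: the program `p` leads from state `s` and word `z` to `s'` and `z'`, in
`n` steps of the compiled machine. -/
inductive Cmd.Exec {S M : Type} : Cmd S M → S → List M → ℕ → S → List M → Prop
  | scan (δ s z) : Exec (.scan δ) s z (2 * z.length + 2) (mealy δ s z).1 (mealy δ s z).2
  | upd (f s z) : Exec (.upd f) s z 1 (f s) z
  | seq {p q s z n s' z' n' s'' z''} : Exec p s z n s' z' → Exec q s' z' n' s'' z'' →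
      Exec (.seq p q) s z (n + n') s'' z''
  | iteTrue {t p q s z n s' z'} : t s = true → Exec p s z n s' z' →
      Exec (.ite t p q) s z (n + 1) s' z'
  | iteFalse {t p q s z n s' z'} : t s = false → Exec q s z n s' z' →
      Exec (.ite t p q) s z (n + 1) s' z'
  | loopFalse {t p s z} : t s = false → Exec (.loop t p) s z 1 s z
  | loopTrue {t p s z n s' z' n' s'' z''} : t s = true → Exec p s z n s' z' →
      Exec (.loop t p) s' z' n' s'' z'' → Exec (.loop t p) s z (1 + n + n') s'' z''

theorem Cmd.Exec.length_eq {S M : Type} {p : Cmd S M} {s z n s' z'} (h : p.Exec s z n s' z') :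
    z'.length = z.length := by
  induction h with
  | scan δ s z => exact length_mealy δ z s
  | upd => rfl
  | seq _ _ h1 h2 => rw [h2, h1]
  | iteTrue _ _ h => exact h
  | iteFalse _ _ h => exact h
  | loopFalse => rfl
  | loopTrue _ _ _ h1 h2 => rw [h2, h1]

/-- The labels of the compiled program. -/
def Cmd.Lab {S M : Type} : Cmd S M → Type
  | .scan _ => Bool
  | .upd _ => Unit
  | .seq p q => p.Lab ⊕ q.Lab
  | .ite _ p q => Option (p.Lab ⊕ q.Lab)
  | .loop _ p => Option p.Lab

theorem Cmd.finite_lab {S M : Type} (p : Cmd S M) : Finite p.Lab := by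
  induction p with
  | scan => exact inferInstanceAs (Finite Bool)
  | upd => exact inferInstanceAs (Finite Unit)
  | seq p q hp hq => exact inferInstanceAs (Finite (p.Lab ⊕ q.Lab))
  | ite t p q hp hq => exact inferInstanceAs (Finite (Option (p.Lab ⊕ q.Lab)))
  | loop t p hp => exact inferInstanceAs (Finite (Option p.Lab))

/-- The first label of the compiled program. -/
def Cmd.entry {S M : Type} : (p : Cmd S M) → p.Lab
  | .scan _ => false
  | .upd _ => ()
  | .seq p _ => .inl p.entry
  | .ite _ _ _ => none
  | .loop _ _ => none

/-- The stacks of the machine: input, current word, auxiliary word, output. -/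
inductive Stk : Type
  | inp | word | tmp | out
  deriving DecidableEq

instance : Fintype Stk := ⟨{.inp, .word, .tmp, .out}, fun k => by cases k <;> simp⟩

/-- The stack alphabets. -/
abbrev StkAlph (In M : Type) : Stk → Type
  | .inp => In
  | .word => M
  | .tmp => M
  | .out => Bool

/-- The contents of the four stacks. -/
def stackVal {In M : Type} (i : List In) (w t : List M) (o : List Bool) :
    ∀ k, List (StkAlph In M k)
  | .inp => i
  | .word => w
  | .tmp => t
  | .out => o

/-- The internal states of the machine: a control state and buffers for letters. -/
abbrev MState (S In M : Type) : Type := S × Option M × Option In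

/-! ### Compilation of programs to a Turing machine with four stacks. -/

section compile

variable {S In M : Type}

open Turing.TM2

/-- Reachability in exactly `n` steps. -/
def StepsTo {Λ : Type} (m : Λ → Stmt (StkAlph In M) Λ (MState S In M)) :
    ℕ → Cfg (StkAlph In M) Λ (MState S In M) → Cfg (StkAlph In M) Λ (MState S In M) → Prop
  | 0, c, c' => c = c'
  | n + 1, c, c' => ∃ d, step m c = some d ∧ StepsTo m n d c'

theorem StepsTo.trans {Λ : Type} {m : Λ → Stmt (StkAlph In M) Λ (MState S In M)} {n n' : ℕ}
    {c c' c'' : Cfg (StkAlph In M) Λ (MState S In M)} (h : StepsTo m n c c')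
    (h' : StepsTo m n' c' c'') : StepsTo m (n + n') c c'' := by
  induction n generalizing c with
  | zero => cases h; simpa using h'
  | succ n ih =>
    obtain ⟨d, hd, h⟩ := h
    rw [Nat.succ_add]
    exact ⟨d, hd, ih h⟩

theorem StepsTo.one {Λ : Type} {m : Λ → Stmt (StkAlph In M) Λ (MState S In M)} {l : Λ} {v S'}
    {c' : Cfg (StkAlph In M) Λ (MState S In M)} (h : stepAux (m l) v S' = c') :
    StepsTo m 1 ⟨some l, v, S'⟩ c' := ⟨_, rfl, h⟩

theorem StepsTo.iterate {Λ : Type} {m : Λ → Stmt (StkAlph In M) Λ (MState S In M)} {n : ℕ}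
    {c c' : Cfg (StkAlph In M) Λ (MState S In M)} (h : StepsTo m n c c') :
    (flip bind (step m))^[n] (some c) = some c' := by
  induction n generalizing c with
  | zero => cases h; rfl
  | succ n ih =>
    obtain ⟨d, hd, h⟩ := h
    rw [Function.iterate_succ_apply, ← ih h]
    congr 1

/-- The statements of the compiled program, for an embedding `emb` of the labels and a label `ex` to
which control passes at the end. -/
def Cmd.code [Inhabited M] {Λ : Type} : (p : Cmd S M) → (p.Lab → Λ) → Λ → p.Lab →
    Stmt (StkAlph In M) Λ (MState S In M)
  | .scan δ, emb, ex => fun l =>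
    bif l then
      .pop .tmp (fun v a => (v.1, a, none)) <|
      .branch (fun v => v.2.1.isSome)
        (.push .word (fun v => v.2.1.getD default) <| .load (fun v => (v.1, none, none)) <|
          .goto fun _ => emb true)
        (.goto fun _ => ex)
    else
      .pop .word (fun v a => (v.1, a, none)) <|
      .branch (fun v => v.2.1.isSome)
        (.push .tmp (fun v => (δ v.1 (v.2.1.getD default)).2) <|
          .load (fun v => ((δ v.1 (v.2.1.getD default)).1, none, none)) <|
          .goto fun _ => emb false)
        (.goto fun _ => emb true)
  | .upd f, _, ex => fun _ => .load (fun v => (f v.1, none, none)) <| .goto fun _ => ex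
  | .seq p q, emb, ex => fun l => match l with
    | .inl l => p.code (emb ∘ .inl) (emb (.inr q.entry)) l
    | .inr l => q.code (emb ∘ .inr) ex l
  | .ite t p q, emb, ex => fun l => match l with
    | none => .branch (fun v => t v.1) (.goto fun _ => emb (some (.inl p.entry)))
        (.goto fun _ => emb (some (.inr q.entry)))
    | some (.inl l) => p.code (fun l => emb (some (.inl l))) ex l
    | some (.inr l) => q.code (fun l => emb (some (.inr l))) ex l
  | .loop t p, emb, ex => fun l => match l with
    | none => .branch (fun v => t v.1) (.goto fun _ => emb (some p.entry)) (.goto fun _ => ex)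
    | some l => p.code (fun l => emb (some l)) (emb none) l

theorem cfg_ext {Λ : Type} {c c' : Cfg (StkAlph In M) Λ (MState S In M)} (hl : c.l = c'.l)
    (hv : c.var = c'.var) (hs : ∀ k, c.stk k = c'.stk k) : c = c' := by
  obtain ⟨l, v, s⟩ := c
  obtain ⟨l', v', s'⟩ := c'
  obtain rfl : s = s' := funext hs
  simp_all

/-- Moving a word from one stack to another reverses it, so this return pass undoes the reversal of
the forward pass. It serves both the second half of `scan` and the restoration of the input order.
The extra step is the one that finds the stack empty. -/
theorem stepsTo_backward [Inhabited M] {Λ : Type}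
    {m : Λ → Stmt (StkAlph In M) Λ (MState S In M)} {l ex : Λ}
    (hl : m l = .pop .tmp (fun v a => (v.1, a, none)) (.branch (fun v => v.2.1.isSome)
        (.push .word (fun v => v.2.1.getD default) <| .load (fun v => (v.1, none, none)) <|
          .goto fun _ => l)
        (.goto fun _ => ex))) (s : S) (t w : List M) :
    StepsTo m (t.length + 1) ⟨some l, (s, none, none), stackVal [] w t []⟩
      ⟨some ex, (s, none, none), stackVal [] (t.reverse ++ w) [] []⟩ := by
  induction t generalizing w with
  | nil => apply StepsTo.one; rw [hl]; exact cfg_ext rfl rfl fun k => by cases k <;> rfl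
  | cons a t ih =>
    have h : stepAux (m l) (s, none, none) (stackVal [] w (a :: t) []) =
        ⟨some l, (s, none, none), stackVal [] (a :: w) t []⟩ := by
      rw [hl]; exact cfg_ext rfl rfl fun k => by cases k <;> rfl
    have := (StepsTo.one h).trans (ih (a :: w))
    rw [add_comm] at this
    simpa using this

theorem stepsTo_forward [Inhabited M] {Λ : Type}
    {m : Λ → Stmt (StkAlph In M) Λ (MState S In M)} {l ex : Λ} {δ : S → M → S × M}
    (hl : m l = .pop .word (fun v a => (v.1, a, none)) (.branch (fun v => v.2.1.isSome)
        (.push .tmp (fun v => (δ v.1 (v.2.1.getD default)).2) <|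
          .load (fun v => ((δ v.1 (v.2.1.getD default)).1, none, none)) <|
          .goto fun _ => l)
        (.goto fun _ => ex))) (s : S) (t w : List M) :
    StepsTo m (w.length + 1) ⟨some l, (s, none, none), stackVal [] w t []⟩
      ⟨some ex, ((mealy δ s w).1, none, none),
        stackVal [] [] ((mealy δ s w).2.reverse ++ t) []⟩ := by
  induction w generalizing s t with
  | nil => apply StepsTo.one; rw [hl]; exact cfg_ext rfl rfl fun k => by cases k <;> rfl
  | cons a w ih =>
    have h : stepAux (m l) (s, none, none) (stackVal [] (a :: w) t []) =
        ⟨some l, ((δ s a).1, none, none), stackVal [] w ((δ s a).2 :: t) []⟩ := by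
      rw [hl]; exact cfg_ext rfl rfl fun k => by cases k <;> rfl
    have := (StepsTo.one h).trans (ih (δ s a).1 ((δ s a).2 :: t))
    rw [add_comm] at this
    simpa [mealy] using this

/-- The machine is only required to contain the code of `p` along `emb`; this lets the induction
pass to subprograms, whose exit label is the place where the surrounding program continues. Between
commands only the word stack is in use and the buffers are empty. -/
theorem Cmd.Exec.stepsTo [Inhabited M] {Λ : Type}
    {m : Λ → Stmt (StkAlph In M) Λ (MState S In M)} {p : Cmd S M} {s z n s' z'}
    (h : p.Exec s z n s' z') : ∀ (emb : p.Lab → Λ) (ex : Λ), (∀ l, m (emb l) = p.code emb ex l) →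
    StepsTo m n ⟨some (emb p.entry), (s, none, none), stackVal [] z [] []⟩
      ⟨some ex, (s', none, none), stackVal [] z' [] []⟩ := by
  induction h with
  | scan δ s z =>
    intro emb ex hm
    have h1 := stepsTo_forward (hm false) s [] z
    have h2 := stepsTo_backward (hm true) (mealy δ s z).1 ((mealy δ s z).2.reverse ++ []) []
    have := h1.trans h2
    simp only [List.append_nil, List.reverse_reverse, List.length_reverse, length_mealy] at this
    rw [two_mul, show z.length + z.length + 2 = z.length + 1 + (z.length + 1) by omega]
    exact this
  | upd f s z =>
    intro emb ex hm
    apply StepsTo.one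
    have := hm ()
    simp only [Cmd.entry]
    rw [this]
    rfl
  | seq h1 h2 ih1 ih2 =>
    intro emb ex hm
    exact (ih1 (emb ∘ .inl) _ fun l => hm (.inl l)).trans
      (ih2 (emb ∘ .inr) ex fun l => hm (.inr l))
  | iteTrue ht h ih =>
    intro emb ex hm
    rw [add_comm]
    refine StepsTo.trans (StepsTo.one ?_) (ih (fun l => emb (some (.inl l))) ex
      fun l => hm (some (.inl l)))
    simp only [Cmd.entry]
    rw [hm none]
    simp [Cmd.code, ht]
  | iteFalse ht h ih =>
    intro emb ex hm
    rw [add_comm]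
    refine StepsTo.trans (StepsTo.one ?_) (ih (fun l => emb (some (.inr l))) ex
      fun l => hm (some (.inr l)))
    simp only [Cmd.entry]
    rw [hm none]
    simp [Cmd.code, ht]
  | loopFalse ht =>
    intro emb ex hm
    apply StepsTo.one
    simp only [Cmd.entry]
    rw [hm none]
    simp [Cmd.code, ht]
  | loopTrue ht h1 h2 ih1 ih2 =>
    intro emb ex hm
    rw [add_assoc]
    refine StepsTo.trans (StepsTo.one ?_) ((ih1 (fun l => emb (some l)) (emb none)
      fun l => hm (some l)).trans (ih2 emb ex hm))
    simp only [Cmd.entry]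
    rw [hm none]
    simp [Cmd.code, ht]

/-- The run of a transducer that may erase letters. -/
def transduce (δ : S → In → S × Option M) : S → List In → S × List M
  | s, [] => (s, [])
  | s, a :: l => ((transduce δ (δ s a).1 l).1,
      (δ s a).2.toList ++ (transduce δ (δ s a).1 l).2)

theorem length_transduce_le (δ : S → In → S × Option M) (l : List In) :
    ∀ s, (transduce δ s l).2.length ≤ l.length := by
  induction l with
  | nil => intro s; simp [transduce]
  | cons a l ih =>
    intro s
    have := ih (δ s a).1
    have h : (δ s a).2.toList.length ≤ 1 := by cases (δ s a).2 <;> simp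
    simp only [transduce, List.length_append, List.length_cons]
    omega

/-- The labels of the machine running a program: reading the input, restoring its order, the
program, and emptying the stacks. -/
inductive MLab (Λ : Type) : Type
  | read | back | clean
  | run (l : Λ)

theorem finite_mLab (Λ : Type) [Finite Λ] : Finite (MLab Λ) :=
  Finite.of_injective (β := Option (Option (Option Λ)))
    (fun | .read => none | .back => some none | .clean => some (some none)
         | .run l => some (some (some l)))
    (by rintro (_ | _ | _ | l) (_ | _ | _ | l') <;> simp)

/-- The machine that feeds its input through the transducer `δ`, runs the program `p`, and outputs
the bit `acc` of the final control state. -/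
def machineCode [Inhabited M] [Inhabited In] (p : Cmd S M) (δ : S → In → S × Option M) (s₀ : S)
    (acc : S → Bool) : MLab p.Lab → Stmt (StkAlph In M) (MLab p.Lab) (MState S In M)
  | .read =>
    .pop .inp (fun v a => (v.1, none, a)) <|
    .branch (fun v => v.2.2.isSome)
      (.branch (fun v => (δ v.1 (v.2.2.getD default)).2.isSome)
        (.push .tmp (fun v => (δ v.1 (v.2.2.getD default)).2.getD default) <|
          .load (fun v => ((δ v.1 (v.2.2.getD default)).1, none, none)) <|
          .goto fun _ => .read)
        (.load (fun v => ((δ v.1 (v.2.2.getD default)).1, none, none)) <|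
          .goto fun _ => .read))
      (.goto fun _ => .back)
  | .back => .pop .tmp (fun v a => (v.1, a, none)) <| .branch (fun v => v.2.1.isSome)
      (.push .word (fun v => v.2.1.getD default) <| .load (fun v => (v.1, none, none)) <|
        .goto fun _ => .back)
      (.goto fun _ => .run p.entry)
  | .run l => p.code .run .clean l
  | .clean => .pop .word (fun v a => (v.1, a, none)) <| .branch (fun v => v.2.1.isSome)
      (.load (fun v => (v.1, none, none)) <| .goto fun _ => .clean)
      (.push .out (fun v => acc v.1) <| .load (fun _ => (s₀, none, none)) .halt)

theorem stepsTo_read [Inhabited M] [Inhabited In] (p : Cmd S M) (δ : S → In → S × Option M)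
    (s₀ : S) (acc : S → Bool) (i : List In) (s : S) (t : List M) :
    StepsTo (machineCode p δ s₀ acc) (i.length + 1)
      ⟨some .read, (s, none, none), stackVal i [] t []⟩
      ⟨some .back, ((transduce δ s i).1, none, none),
        stackVal [] [] ((transduce δ s i).2.reverse ++ t) []⟩ := by
  induction i generalizing s t with
  | nil =>
    apply StepsTo.one
    exact cfg_ext rfl rfl fun k => by cases k <;> rfl
  | cons a i ih =>
    have h : stepAux (machineCode p δ s₀ acc .read) (s, none, none) (stackVal (a :: i) [] t []) =
        ⟨some .read, ((δ s a).1, none, none),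
          stackVal i [] ((δ s a).2.toList.reverse ++ t) []⟩ := by
      change (bif (δ s a).2.isSome then _ else _) = _
      rcases h : (δ s a).2 with _ | b
      · exact cfg_ext rfl rfl fun k => by cases k <;> rfl
      · refine cfg_ext rfl rfl fun k => ?_
        cases k
        case tmp =>
          change (δ s a).2.getD default :: t = _
          rw [h]; rfl
        all_goals rfl
    have := (StepsTo.one h).trans (ih (δ s a).1 ((δ s a).2.toList.reverse ++ t))
    rw [add_comm] at this
    simpa [transduce] using this

theorem stepsTo_clean [Inhabited M] [Inhabited In] (p : Cmd S M) (δ : S → In → S × Option M)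
    (s₀ : S) (acc : S → Bool) (w : List M) (s : S) :
    StepsTo (machineCode p δ s₀ acc) (w.length + 1)
      ⟨some .clean, (s, none, none), stackVal [] w [] []⟩
      ⟨none, (s₀, none, none), stackVal [] [] [] [acc s]⟩ := by
  induction w with
  | nil =>
    apply StepsTo.one
    exact cfg_ext rfl rfl fun k => by cases k <;> rfl
  | cons a w ih =>
    have h : stepAux (machineCode p δ s₀ acc .clean) (s, none, none) (stackVal [] (a :: w) [] []) =
        ⟨some .clean, (s, none, none), stackVal [] w [] []⟩ :=
      cfg_ext rfl rfl fun k => by cases k <;> rfl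
    have := (StepsTo.one h).trans ih
    rw [add_comm] at this
    exact this

/-- The bundled machine. -/
@[reducible] def machine [Inhabited M] [Inhabited In] [Fintype S] [Fintype M] [Fintype In]
    (p : Cmd S M) [Fintype (MLab p.Lab)] (δ : S → In → S × Option M) (s₀ : S) (acc : S → Bool) :
    Turing.FinTM2 where
  K := Stk
  k₀ := .inp
  k₁ := .out
  Γ := StkAlph In M
  Λ := MLab p.Lab
  main := .read
  σ := MState S In M
  initialState := (s₀, none, none)
  Γk₀Fin := inferInstanceAs (Fintype In)
  m := machineCode p δ s₀ acc

/-- Besides the program, the machine reads the input, restores its order and empties the word stack.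
Programs preserve the length of the word and the transducer never lengthens it, so each of these
phases takes at most one step more than the input length; hence `3 * X + 3`. -/
theorem polyTime_of_exec [Inhabited M] [Inhabited In] [Finite S] [Finite M] [Finite In]
    {α : Type} (enc : α → List In) (f : α → Bool)
    (p : Cmd S M) (δ : S → In → S × Option M) (s₀ : S) (acc : S → Bool) (T : Polynomial ℕ)
    (h : ∀ x, ∃ n ≤ T.eval (enc x).length, ∃ s' z',
      p.Exec (transduce δ s₀ (enc x)).1 (transduce δ s₀ (enc x)).2 n s' z' ∧ acc s' = f x) :
    Nonempty (Turing.TM2ComputableInPolyTime enc Computability.encodeBool f) := by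
  classical
  have := Fintype.ofFinite S
  have := Fintype.ofFinite M
  have := Fintype.ofFinite In
  have := p.finite_lab
  have := finite_mLab p.Lab
  have := Fintype.ofFinite (MLab p.Lab)
  refine ⟨{
    tm := machine p δ s₀ acc
    inputAlphabet := Equiv.refl _
    outputAlphabet := Equiv.refl _
    time := T + 3 * Polynomial.X + 3
    outputsFun := fun x => ?_ }⟩
  have key : ∃ n ≤ (T + 3 * Polynomial.X + 3 : Polynomial ℕ).eval (enc x).length,
      StepsTo (machineCode p δ s₀ acc) n ⟨some .read, (s₀, none, none), stackVal (enc x) [] [] []⟩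
      ⟨none, (s₀, none, none), stackVal [] [] [] [f x]⟩ := by
    obtain ⟨n, hn, s', z', he, ha⟩ := h x
    have h1 := stepsTo_read p δ s₀ acc (enc x) s₀ []
    have h2 := stepsTo_backward (m := machineCode p δ s₀ acc) (l := .back) (ex := .run p.entry) rfl
      (transduce δ s₀ (enc x)).1 ((transduce δ s₀ (enc x)).2.reverse ++ []) []
    have h3 := he.stepsTo (m := machineCode p δ s₀ acc) .run .clean fun l => rfl
    have h4 := stepsTo_clean p δ s₀ acc z' s'
    simp only [List.append_nil, List.reverse_reverse, List.length_reverse] at h1 h2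
    rw [ha] at h4
    refine ⟨_, ?_, ((h1.trans h2).trans h3).trans h4⟩
    have := length_transduce_le δ (enc x) s₀
    have := he.length_eq
    simp only [Polynomial.eval_add, Polynomial.eval_mul, Polynomial.eval_X,
      Polynomial.eval_ofNat]
    omega
  choose n hn hs using key
  refine ⟨⟨n, ?_⟩, hn⟩
  have e1 : Turing.initList (tm := machine p δ s₀ acc)
      (List.map (Equiv.refl _).invFun (enc x)) =
      ⟨some .read, (s₀, none, none), stackVal (enc x) [] [] []⟩ := by
    simp only [Turing.initList]
    congr 1
    funext k
    cases k
    · exact List.map_id _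
    all_goals rfl
  have e2 : Turing.haltList (tm := machine p δ s₀ acc)
      (List.map (Equiv.refl _).invFun (Computability.encodeBool (f x))) =
      ⟨none, (s₀, none, none), stackVal [] [] [] [f x]⟩ := by
    simp only [Turing.haltList]
    congr 1
    funext k
    cases k <;> rfl
  rw [e1, Option.map_some, e2]
  exact hs.iterate

end compile


/-! ### First-order formulas with counting over words, and their evaluation -/

/-- Formulas over the positions of a word with letters in `L`, in the free variables
`0, …, k - 1`. A binder binds the variable `k`; `eqCount φ ψ` says that `φ` and `ψ` hold for the
same number of positions. -/
inductive Form (L : Type) : ℕ → Type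
  | sym {k : ℕ} (t : L → Bool) (i : Fin k) : Form L k
  | lt {k : ℕ} (i j : Fin k) : Form L k
  | nand {k : ℕ} (φ ψ : Form L k) : Form L k
  | eqCount {k : ℕ} (φ ψ : Form L (k + 1)) : Form L k

/-- Extension of an assignment by a value for the next variable. -/
abbrev extend {k : ℕ} (e : Fin k → ℕ) (x : ℕ) : Fin (k + 1) → ℕ :=
  Fin.snoc (α := fun _ => ℕ) e x

open Classical in
/-- Truth of a formula in the word `z`. -/
def Form.Sat {L : Type} (z : List L) : {k : ℕ} → Form L k → (Fin k → ℕ) → Prop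
  | _, .sym t i, e => ∃ a, z[e i]? = some a ∧ t a = true
  | _, .lt i j, e => e i < e j
  | _, .nand φ ψ, e => ¬ (φ.Sat z e ∧ ψ.Sat z e)
  | _, .eqCount φ ψ, e =>
    Nat.count (fun x => φ.Sat z (extend e x)) z.length =
      Nat.count (fun x => ψ.Sat z (extend e x)) z.length

/-- The largest number of nested variables. -/
def Form.depth {L : Type} : {k : ℕ} → Form L k → ℕ
  | k, .sym _ _ => k
  | k, .lt _ _ => k
  | _, .nand φ ψ => max φ.depth ψ.depth
  | _, .eqCount φ ψ => max φ.depth ψ.depth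

theorem Form.le_depth {L : Type} {k : ℕ} (φ : Form L k) : k ≤ φ.depth := by
  induction φ with
  | sym => exact le_rfl
  | lt => exact le_rfl
  | nand φ ψ h1 h2 => exact h1.trans (le_max_left _ _)
  | eqCount φ ψ h1 h2 => exact (Nat.le_succ _).trans (h1.trans (le_max_left _ _))

/-! ### Registers with values in positions, stored as marks on the letters. -/

section eval

variable {L ι C : Type}

/-- The word `z`, the letter at position `p` carrying the mark `i` if the register `i` has the
value `k + p`. -/
def marked (r : ι → ℕ) : ℕ → List L → List (L × (ι → Bool))
  | _, [] => []
  | k, a :: z => (a, fun i => decide (r i = k)) :: marked r (k + 1) z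

theorem length_marked (r : ι → ℕ) (z : List L) : ∀ k, (marked r k z).length = z.length := by
  induction z with
  | nil => intro k; rfl
  | cons a z ih => intro k; simp [marked, ih]

/-- Control states: an accumulator, an auxiliary bit, and an unused component. -/
abbrev Ctl (C : Type) : Type := Bool × Bool × C

/-- Programs on marked words. -/
abbrev MCmd (L ι C : Type) : Type := Cmd (Ctl C) (L × (ι → Bool))

/-- The program `p` leads from accumulator `b` and registers `r` to `b'` and `r'` in at most `n`
steps. -/
def Runs (z : List L) (p : MCmd L ι C) (n : ℕ) (b : Bool) (r : ι → ℕ) (b' : Bool) (r' : ι → ℕ) :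
    Prop :=
  ∀ x c, ∃ x' c', ∃ n' ≤ n, p.Exec (b, x, c) (marked r 0 z) n' (b', x', c') (marked r' 0 z)

theorem Runs.mono {z : List L} {p : MCmd L ι C} {n n' b r b' r'} (h : Runs z p n b r b' r')
    (hn : n ≤ n') : Runs z p n' b r b' r' := by
  intro x c
  obtain ⟨x', c', m, hm, h⟩ := h x c
  exact ⟨x', c', m, hm.trans hn, h⟩

theorem Runs.seq {z : List L} {p q : MCmd L ι C} {n n' b r b' r' b'' r''}
    (h : Runs z p n b r b' r') (h' : Runs z q n' b' r' b'' r'') :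
    Runs z (.seq p q) (n + n') b r b'' r'' := by
  intro x c
  obtain ⟨x', c', m, hm, h⟩ := h x c
  obtain ⟨x'', c'', m', hm', h'⟩ := h' x' c'
  exact ⟨x'', c'', m + m', by omega, .seq h h'⟩

theorem Runs.ite {z : List L} {p q : MCmd L ι C} {n b r b' r'}
    (h1 : b = true → Runs z p n b r b' r') (h2 : b = false → Runs z q n b r b' r') :
    Runs z (.ite (fun s => s.1) p q) (n + 1) b r b' r' := by
  intro x c
  cases b
  · obtain ⟨x', c', m, hm, h⟩ := h2 rfl x c
    exact ⟨x', c', m + 1, by omega, .iteFalse rfl h⟩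
  · obtain ⟨x', c', m, hm, h⟩ := h1 rfl x c
    exact ⟨x', c', m + 1, by omega, .iteTrue rfl h⟩

/-- Apply a function to the accumulator. -/
def updAcc (f : Bool → Bool) : MCmd L ι C := .upd fun s => (f s.1, s.2)

theorem Runs.updAcc (z : List L) (f : Bool → Bool) (b : Bool) (r : ι → ℕ) :
    Runs z (updAcc f : MCmd L ι C) 1 b r (f b) r :=
  fun x c => ⟨x, c, 1, le_rfl, .upd _ _ _⟩

/-- Set the auxiliary bit and scan. -/
def scanFrom (x : Bool) (δ : Bool → Bool → L → (ι → Bool) → (Bool × Bool) × (ι → Bool)) :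
    MCmd L ι C :=
  .seq (.upd fun s => (s.1, x, s.2.2)) <| .scan fun s a =>
    (((δ s.1 s.2.1 a.1 a.2).1.1, (δ s.1 s.2.1 a.1 a.2).1.2, s.2.2), (a.1, (δ s.1 s.2.1 a.1 a.2).2))

/-- The number of steps of `scanFrom`. -/
def scanCost (n : ℕ) : ℕ := 2 * n + 3

theorem runs_scanFrom {z : List L} {x : Bool}
    {δ : Bool → Bool → L → (ι → Bool) → (Bool × Bool) × (ι → Bool)} {b r b' r'}
    (h : ∀ c : C, ∃ x', mealy (fun s a =>
      (((δ s.1 s.2.1 a.1 a.2).1.1, (δ s.1 s.2.1 a.1 a.2).1.2, s.2.2),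
        (a.1, (δ s.1 s.2.1 a.1 a.2).2))) (b, x, c) (marked r 0 z) = ((b', x', c), marked r' 0 z)) :
    Runs z (scanFrom x δ : MCmd L ι C) (scanCost z.length) b r b' r' := by
  intro y c
  obtain ⟨x', h⟩ := h c
  have := Cmd.Exec.scan (S := Ctl C) (fun s (a : L × (ι → Bool)) =>
    (((δ s.1 s.2.1 a.1 a.2).1.1, (δ s.1 s.2.1 a.1 a.2).1.2, s.2.2),
      (a.1, (δ s.1 s.2.1 a.1 a.2).2))) (b, x, c) (marked r 0 z)
  rw [h] at this
  refine ⟨x', c, _, ?_, .seq (.upd _ _ _) this⟩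
  rw [length_marked, scanCost]; omega

/-- Set a register to zero. -/
def zeroReg [DecidableEq ι] (i : ι) : MCmd L ι C :=
  scanFrom true fun b x _ m => ((b, false), Function.update m i x)

/-- The auxiliary bit is true at the first letter only, so exactly that letter receives the mark. On
the empty word no register is visible. -/
theorem Runs.zeroReg [DecidableEq ι] (z : List L) (i : ι) (b : Bool) (r : ι → ℕ) :
    Runs z (zeroReg i : MCmd L ι C) (scanCost z.length) b r b (Function.update r i 0) := by
  refine runs_scanFrom fun c => ?_
  have key : ∀ (z : List L) (k : ℕ), mealy (fun (s : Ctl C) (a : L × (ι → Bool)) =>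
      ((s.1, false, s.2.2), (a.1, Function.update a.2 i s.2.1))) (b, false, c)
      (marked r (k + 1) z) = ((b, false, c), marked (Function.update r i 0) (k + 1) z) := by
    intro z
    induction z with
    | nil => intro k; rfl
    | cons a z ih =>
      intro k
      simp only [marked, mealy, ih]
      refine congrArg₂ Prod.mk rfl (congrArg₂ List.cons (congrArg₂ Prod.mk rfl ?_) rfl)
      funext j
      by_cases hj : j = i
      · subst hj; simp
      · simp [hj]
  cases z with
  | nil => exact ⟨true, rfl⟩
  | cons a z =>
    refine ⟨false, ?_⟩
    simp only [marked, mealy, key]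
    refine congrArg₂ Prod.mk rfl (congrArg₂ List.cons (congrArg₂ Prod.mk rfl ?_) rfl)
    funext j
    by_cases hj : j = i
    · subst hj; simp
    · simp [hj]

/-- Increase a register by one. -/
def incReg [DecidableEq ι] (i : ι) : MCmd L ι C :=
  scanFrom false fun b x _ m => ((b, m i), Function.update m i x)

/-- The auxiliary bit carries the old mark of the preceding letter, so the mark moves one place to
the right. At the end it falls off the word, as it should: values from the length on have no mark.
-/
theorem Runs.incReg [DecidableEq ι] (z : List L) (i : ι) (b : Bool) (r : ι → ℕ) :
    Runs z (incReg i : MCmd L ι C) (scanCost z.length) b r b (Function.update r i (r i + 1)) := by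
  refine runs_scanFrom fun c => ?_
  have key : ∀ (z : List L) (k : ℕ) (x : Bool), x = decide (r i + 1 = k) →
      ∃ x', mealy (fun (s : Ctl C) (a : L × (ι → Bool)) =>
      ((s.1, a.2 i, s.2.2), (a.1, Function.update a.2 i s.2.1))) (b, x, c)
      (marked r k z) = ((b, x', c), marked (Function.update r i (r i + 1)) k z) := by
    intro z
    induction z with
    | nil => intro k x _; exact ⟨x, rfl⟩
    | cons a z ih =>
      intro k x hx
      obtain ⟨x', h⟩ := ih (k + 1) (decide (r i = k)) (by simp)
      refine ⟨x', ?_⟩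
      simp only [marked, mealy, h]
      refine congrArg₂ Prod.mk rfl (congrArg₂ List.cons (congrArg₂ Prod.mk rfl ?_) rfl)
      funext j
      by_cases hj : j = i
      · subst hj; simp [hx]
      · simp [hj]
  exact key z 0 false (by simp)

/-- Is there a letter with the property `t`? -/
def testAny (t : L → (ι → Bool) → Bool) : MCmd L ι C :=
  .seq (updAcc fun _ => false) (scanFrom false fun b x a m => ((b || t a m, x), m))

theorem Runs.testAny (z : List L) (t : L → (ι → Bool) → Bool) (b : Bool) (r : ι → ℕ) (b' : Bool)
    (h : b' = true ↔ ∃ p a, z[p]? = some a ∧ t a (fun i => decide (r i = p)) = true) :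
    Runs z (testAny t : MCmd L ι C) (1 + scanCost z.length) b r b' r := by
  refine Runs.seq (Runs.updAcc z _ b r) (runs_scanFrom fun c => ⟨false, ?_⟩)
  have key : ∀ (z : List L) (k : ℕ) (b b' : Bool),
      (b' = true ↔ b = true ∨ ∃ p a, z[p]? = some a ∧ t a (fun i => decide (r i = k + p)) = true) →
      mealy (fun (s : Ctl C) (a : L × (ι → Bool)) =>
      ((s.1 || t a.1 a.2, s.2.1, s.2.2), (a.1, a.2))) (b, false, c)
      (marked r k z) = ((b', false, c), marked r k z) := by
    intro z
    induction z with
    | nil =>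
      intro k b b' h
      have : b' = b := by rw [Bool.eq_iff_iff, h]; simp
      rw [this]; rfl
    | cons a z ih =>
      intro k b b' h
      simp only [marked, mealy]
      rw [ih (k + 1) _ b']
      rw [h, Bool.or_eq_true, or_assoc]
      refine or_congr Iff.rfl ⟨?_, ?_⟩
      · rintro ⟨_ | p, a', hp, ha⟩
        · simp only [List.getElem?_cons_zero, Option.some.injEq] at hp
          subst hp; exact .inl ha
        · refine .inr ⟨p, a', by simpa using hp, ?_⟩
          rw [show k + 1 + p = k + (p + 1) by omega]; exact ha
      · rintro (ha | ⟨p, a', hp, ha⟩)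
        · exact ⟨0, a, rfl, ha⟩
        · refine ⟨p + 1, a', by simpa using hp, ?_⟩
          rw [show k + (p + 1) = k + 1 + p by omega]; exact ha
  exact key z 0 false b' (by simpa using h)

/-- Is the register `i` smaller than the register `j`? -/
def testLt (i j : ι) : MCmd L ι C :=
  .seq (updAcc fun _ => false) (scanFrom false fun b x _ m => ((b || (x && m j), x || m i), m))

/-- The auxiliary bit remembers whether the mark of `i` has been passed. Only `r j` has to be a
position: if `r i` has no mark, it exceeds `r j`, and the answer is rightly negative. -/
theorem Runs.testLt (z : List L) (i j : ι) (b : Bool) (r : ι → ℕ) (b' : Bool)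
    (hj : r j < z.length) (h : b' = true ↔ r i < r j) :
    Runs z (testLt i j : MCmd L ι C) (1 + scanCost z.length) b r b' r := by
  refine Runs.seq (Runs.updAcc z _ b r) (runs_scanFrom fun c => ?_)
  have key : ∀ (z : List L) (k : ℕ) (b x b' : Bool), (x = true ↔ r i < k) →
      (b' = true ↔ b = true ∨ (r i < r j ∧ k ≤ r j ∧ r j < k + z.length)) →
      ∃ x', mealy (fun (s : Ctl C) (a : L × (ι → Bool)) =>
      ((s.1 || (s.2.1 && a.2 j), s.2.1 || a.2 i, s.2.2), (a.1, a.2))) (b, x, c)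
      (marked r k z) = ((b', x', c), marked r k z) := by
    intro z
    induction z with
    | nil =>
      intro k b x b' _ h
      have : b' = b := by
        rw [Bool.eq_iff_iff, h]
        simp only [List.length_nil, or_iff_left_iff_imp]
        omega
      rw [this]; exact ⟨x, rfl⟩
    | cons a z ih =>
      intro k b x b' hx h
      simp only [marked, mealy]
      obtain ⟨x', h'⟩ := ih (k + 1) (b || (x && decide (r j = k))) (x || decide (r i = k)) b'
        (by simp [hx]; omega) (by rw [h]; simp [hx]; grind)
      exact ⟨x', by rw [h']⟩
  exact key z 0 false false b' (by simp) (by simp [h, hj])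

/-- Execute `p` for all values of the register `i` that are positions of the word. -/
def forReg [DecidableEq ι] (i : ι) (p : MCmd L ι C) : MCmd L ι C :=
  .seq (zeroReg i) <| .seq (testAny fun _ m => m i) <|
    .loop (fun s => s.1) (.seq p (.seq (incReg i) (testAny fun _ m => m i)))

/-- The loop stops when the mark of `i` has left the word. The invariant `inv x` describes the
registers when the body is about to be run for the value `x`; the body may change other registers,
and it is the invariant after the increment that has to be restored. -/
theorem Runs.forReg [DecidableEq ι] {z : List L} {i : ι} {p : MCmd L ι C} {n : ℕ} {b : Bool} {r : ι → ℕ}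
    (inv : ℕ → (ι → ℕ) → Prop) (hi : ∀ x r, inv x r → r i = x)
    (h0 : inv 0 (Function.update r i 0))
    (h : ∀ x < z.length, ∀ r b, inv x r → ∃ b' r', Runs z p n b r b' r' ∧
      inv (x + 1) (Function.update r' i (r' i + 1))) :
    ∃ b' r', Runs z (forReg i p) ((z.length + 2) * (n + 3 * scanCost z.length)) b r b' r' ∧
      inv z.length r' := by
  have test : ∀ b r, Runs z (QCSP.testAny (fun _ m => m i) : MCmd L ι C) (1 + scanCost z.length) b r
      (decide (r i < z.length)) r := by
    intro b r
    refine Runs.testAny z _ b r _ ?_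
    simp only [decide_eq_true_eq]
    constructor
    · intro h; exact ⟨r i, z[r i], by simp [h], rfl⟩
    · rintro ⟨p, a, hp, rfl⟩
      exact (List.getElem?_eq_some_iff.1 hp).1
  have hc : 3 ≤ scanCost z.length := by unfold scanCost; omega
  have loop : ∀ m x r, x + m = z.length → inv x r → ∃ b' r',
      Runs z (.loop (fun s => s.1) (.seq p (.seq (QCSP.incReg i) (QCSP.testAny fun _ m => m i))))
        (1 + m * (n + 3 * scanCost z.length)) (decide (r i < z.length)) r b' r' ∧
      inv z.length r' := by
    intro m
    induction m with
    | zero =>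
      intro x r hx hr
      obtain rfl : x = z.length := by omega
      refine ⟨decide (r i < z.length), r, ?_, hr⟩
      rw [hi _ _ hr]
      intro y c
      exact ⟨y, c, 1, by omega, .loopFalse (by simp)⟩
    | succ m ih =>
      intro x r hx hr
      obtain ⟨b', r', h1, h2⟩ := h x (by omega) r (decide (r i < z.length)) hr
      obtain ⟨b'', r'', h3, h4⟩ := ih (x + 1) _ (by omega) h2
      refine ⟨b'', r'', ?_, h4⟩
      have hlt : decide (r i < z.length) = true := by rw [hi _ _ hr]; simp; omega
      intro y c
      obtain ⟨y1, c1, n1, hn1, e1⟩ := (h1.seq ((Runs.incReg z i b' r').seq (test _ _))) y c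
      obtain ⟨y2, c2, n2, hn2, e2⟩ := h3 y1 c1
      refine ⟨y2, c2, _, ?_, .loopTrue hlt e1 e2⟩
      have : (m + 1) * (n + 3 * scanCost z.length) =
        m * (n + 3 * scanCost z.length) + (n + 3 * scanCost z.length) := by ring
      omega
  obtain ⟨b', r', h1, h2⟩ := loop z.length 0 _ (by omega) h0
  refine ⟨b', r', ?_, h2⟩
  refine ((Runs.zeroReg z i b r).seq ((test _ _).seq h1)).mono ?_
  have : (z.length + 2) * (n + 3 * scanCost z.length) =
    z.length * (n + 3 * scanCost z.length) + 2 * (n + 3 * scanCost z.length) := by ring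
  omega

end eval

/-! ### Compilation of formulas -/

section compile

variable {L C : Type}

/-- The registers: for each variable its value and two counters. -/
abbrev Reg (D : ℕ) : Type := Fin (D + 1) × Fin 3

/-- The registers of the variable `k`. -/
def reg (D k : ℕ) (t : Fin 3) : Reg D := (Fin.ofNat (D + 1) k, t)

theorem reg_inj {D j k : ℕ} {s t : Fin 3} (hj : j ≤ D) (hk : k ≤ D) :
    reg D j s = reg D k t ↔ j = k ∧ s = t := by
  simp only [reg, Prod.mk.injEq, Fin.ext_iff, Fin.val_ofNat]
  rw [Nat.mod_eq_of_lt (by omega), Nat.mod_eq_of_lt (by omega)]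

/-- The program evaluating a formula. -/
def Form.comp (D : ℕ) : {k : ℕ} → Form L k → MCmd L (Reg D) C
  | _, .sym t i => testAny fun a m => t a && m (reg D i 0)
  | _, .lt i j => testLt (reg D i 0) (reg D j 0)
  | _, .nand φ ψ => .seq (φ.comp D) (.ite (fun s => s.1)
      (.seq (ψ.comp D) (updAcc fun b => !b)) (updAcc fun _ => true))
  | k, .eqCount φ ψ =>
    .seq (zeroReg (reg D k 1)) <| .seq (zeroReg (reg D k 2)) <|
    .seq (forReg (reg D k 0) <| .seq (φ.comp D) <|
      .ite (fun s => s.1) (incReg (reg D k 1)) (updAcc id)) <|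
    .seq (forReg (reg D k 0) <| .seq (ψ.comp D) <|
      .ite (fun s => s.1) (incReg (reg D k 2)) (updAcc id)) <|
    .seq (testAny fun _ m => m (reg D k 1) != m (reg D k 2)) (updAcc fun b => !b)

/-- A bound for the number of steps of the evaluation. -/
noncomputable def Form.cost : {k : ℕ} → Form L k → Polynomial ℕ
  | _, .sym _ _ => 2 * Polynomial.X + 4
  | _, .lt _ _ => 2 * Polynomial.X + 4
  | _, .nand φ ψ => φ.cost + ψ.cost + 3
  | _, .eqCount φ ψ => 6 * Polynomial.X + 15 +
      (Polynomial.X + 2) * (φ.cost + 8 * Polynomial.X + 16) +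
      (Polynomial.X + 2) * (ψ.cost + 8 * Polynomial.X + 16)

-- The loop invariant says that the counter `c` holds the count below the current value of the bound
-- variable. The subformula may overwrite only registers of deeper variables, so the outer values
-- and the other counter survive.
open Classical in
theorem runs_count {D k : ℕ} (z : List L) (e : Fin k → ℕ) (hk : k + 1 ≤ D) (φ : Form L (k + 1))
    (c : Fin 3) (hc : c ≠ 0)
    (ih : ∀ (e : Fin (k + 1) → ℕ) (r : Reg D → ℕ) (b : Bool), (∀ i : Fin (k + 1), r (reg D i 0) = e i) →
      (∀ i, e i < z.length) → ∃ r', Runs z (φ.comp D : MCmd L (Reg D) C)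
        (φ.cost.eval z.length) b r (decide (φ.Sat z e)) r' ∧
      ∀ i < k + 1, ∀ t, r' (reg D i t) = r (reg D i t))
    (r : Reg D → ℕ) (hr : ∀ i : Fin k, r (reg D i 0) = e i) (he : ∀ i, e i < z.length) (b : Bool)
    (hc0 : r (reg D k c) = 0) :
    ∃ b' r', Runs z (forReg (reg D k 0) (.seq (φ.comp D) <|
      .ite (fun s => s.1) (incReg (reg D k c)) (updAcc id)) : MCmd L (Reg D) C)
      (((Polynomial.X + 2) * (φ.cost + 8 * Polynomial.X + 16) : Polynomial ℕ).eval z.length)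
      b r b' r' ∧
      r' (reg D k c) = Nat.count (fun x => φ.Sat z (extend e x)) z.length ∧
      (∀ t, t ≠ 0 → t ≠ c → r' (reg D k t) = r (reg D k t)) ∧
      ∀ i < k, ∀ t, r' (reg D i t) = r (reg D i t) := by
  have hne : ∀ i < k, ∀ t s, reg D i t ≠ reg D k s := by
    intro i hi t s h
    rw [reg_inj (by omega) (by omega)] at h
    omega
  have hne' : ∀ t s, t ≠ s → reg D k t ≠ reg D k s := by
    intro t s hts h
    rw [reg_inj (by omega) (by omega)] at h
    exact hts h.2
  have key := Runs.forReg (C := C) (z := z) (i := reg D k 0)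
    (p := .seq (φ.comp D) <| .ite (fun s => s.1) (incReg (reg D k c)) (updAcc id))
    (n := φ.cost.eval z.length + scanCost z.length + 1) (b := b) (r := r)
    (fun x r' => r' (reg D k 0) = x ∧
      r' (reg D k c) = Nat.count (fun x => φ.Sat z (extend e x)) x ∧
      (∀ t, t ≠ 0 → t ≠ c → r' (reg D k t) = r (reg D k t)) ∧
      ∀ i < k, ∀ t, r' (reg D i t) = r (reg D i t)) (fun x r h => h.1)
  refine Exists.elim (key ?_ ?_) ?_
  rotate_left 2
  · rintro b' ⟨r', h1, h2⟩
    refine ⟨b', r', h1.mono ?_, h2.2.1, h2.2.2.1, h2.2.2.2⟩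
    simp only [Polynomial.eval_add, Polynomial.eval_mul, Polynomial.eval_X,
      Polynomial.eval_ofNat, scanCost]
    exact Nat.mul_le_mul_left _ (by omega)
  · refine ⟨by simp, ?_, fun t ht htc => ?_, fun i hi t => ?_⟩
    · rw [Function.update_of_ne (hne' _ _ hc), hc0]; simp
    · rw [Function.update_of_ne (hne' _ _ ht)]
    · rw [Function.update_of_ne (hne i hi _ _)]
  · rintro x hx r1 b1 ⟨hx1, hc1, ht1, hi1⟩
    obtain ⟨r2, h2, h3⟩ := ih (extend e x) r1 b1 (by
      intro i
      refine Fin.lastCases ?_ (fun i => ?_) i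
      · simpa [extend] using hx1
      · simpa [extend, hr] using hi1 i i.2 0) (by
      intro i
      refine Fin.lastCases ?_ (fun i => ?_) i
      · simpa [extend] using hx
      · simpa [extend] using he i)
    have hcost : 1 ≤ scanCost z.length := by unfold scanCost; omega
    by_cases hφ : φ.Sat z (extend e x)
    · refine ⟨_, _, h2.seq (Runs.ite (n := scanCost z.length)
        (fun _ => Runs.incReg z _ _ _) (fun h => by simp [hφ] at h)), ?_⟩
      refine ⟨?_, ?_, fun t ht htc => ?_, fun i hi t => ?_⟩
      · simp [Function.update_of_ne (hne' _ _ hc.symm), h3 k (by omega), hx1]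
      · rw [Function.update_of_ne (hne' _ _ hc), Function.update_self, h3 k (by omega), hc1,
          Nat.count_succ]
        simp [hφ]
      · rw [Function.update_of_ne (hne' _ _ ht), Function.update_of_ne (hne' _ _ htc),
          h3 k (by omega), ht1 t ht htc]
      · rw [Function.update_of_ne (hne i hi _ _), Function.update_of_ne (hne i hi _ _),
          h3 i (by omega), hi1 i hi]
    · refine ⟨_, _, h2.seq (Runs.ite (n := scanCost z.length) (fun h => by simp [hφ] at h)
        (fun _ => (Runs.updAcc z id _ _).mono hcost)), ?_⟩
      refine ⟨?_, ?_, fun t ht htc => ?_, fun i hi t => ?_⟩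
      · simp [h3 k (by omega), hx1]
      · rw [Function.update_of_ne (hne' _ _ hc), h3 k (by omega), hc1, Nat.count_succ]
        simp [hφ]
      · rw [Function.update_of_ne (hne' _ _ ht), h3 k (by omega), ht1 t ht htc]
      · rw [Function.update_of_ne (hne i hi _ _), h3 i (by omega), hi1 i hi]

-- Induction on the formula. Registers of the free variables are preserved, which is what allows two
-- subformulas to be evaluated in sequence; `D` bounds the nesting so that distinct variables have
-- distinct registers.
open Classical in
theorem Form.runs_comp {D : ℕ} (z : List L) {k : ℕ} (φ : Form L k) (hD : φ.depth ≤ D)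
    (e : Fin k → ℕ) (r : Reg D → ℕ) (b : Bool) (hr : ∀ i : Fin k, r (reg D i 0) = e i)
    (he : ∀ i, e i < z.length) :
    ∃ r', Runs z (φ.comp D : MCmd L (Reg D) C) (φ.cost.eval z.length) b r (decide (φ.Sat z e)) r' ∧
      ∀ i < k, ∀ t, r' (reg D i t) = r (reg D i t) := by
  induction φ generalizing r b with
  | sym t i =>
    refine ⟨r, (Runs.testAny z _ b r _ ?_).mono ?_, fun _ _ _ => rfl⟩
    · rw [decide_eq_true_eq]
      simp only [Form.Sat, Bool.and_eq_true, decide_eq_true_eq, hr]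
      constructor
      · rintro ⟨a, h1, h2⟩; exact ⟨_, a, h1, h2, rfl⟩
      · rintro ⟨p, a, h1, h2, rfl⟩; exact ⟨a, h1, h2⟩
    · simp only [Form.cost, Polynomial.eval_add, Polynomial.eval_mul, Polynomial.eval_X,
        Polynomial.eval_ofNat, scanCost]
      omega
  | lt i j =>
    refine ⟨r, (Runs.testLt z _ _ b r _ (by rw [hr]; exact he j) ?_).mono ?_, fun _ _ _ => rfl⟩
    · rw [decide_eq_true_eq]
      simp only [Form.Sat, hr]
    · simp only [Form.cost, Polynomial.eval_add, Polynomial.eval_mul, Polynomial.eval_X,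
        Polynomial.eval_ofNat, scanCost]
      omega
  | nand φ ψ ih1 ih2 =>
    obtain ⟨r1, h1, h1'⟩ := ih1 ((le_max_left _ _).trans hD) e r b hr he
    obtain ⟨r2, h2, h2'⟩ := ih2 ((le_max_right _ _).trans hD) e r1 (decide (φ.Sat z e))
      (fun i => by rw [h1' i i.2, hr]) he
    have hn : (Form.nand φ ψ).cost.eval z.length =
        φ.cost.eval z.length + (ψ.cost.eval z.length + 2 + 1) := by
      simp only [Form.cost, Polynomial.eval_add, Polynomial.eval_ofNat]; ring
    by_cases hφ : φ.Sat z e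
    · refine ⟨r2, ?_, fun i hi t => by rw [h2' i hi, h1' i hi]⟩
      rw [hn]
      refine h1.seq (Runs.ite (fun _ => ?_) (fun h => by simp [hφ] at h))
      have h := (h2.seq (Runs.updAcc z (fun b => !b) _ _)).mono
        (n' := ψ.cost.eval z.length + 2) (by omega)
      convert h using 1
      simp [Form.Sat, hφ]
    · refine ⟨r1, ?_, h1'⟩
      rw [hn]
      refine h1.seq (Runs.ite (fun h => by simp [hφ] at h) (fun _ => ?_))
      convert (Runs.updAcc z (fun _ => true) _ r1).mono (n' := ψ.cost.eval z.length + 2) (by omega)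
      simp [Form.Sat, hφ]
  | @eqCount k φ ψ ih1 ih2 =>
    have hk : k + 1 ≤ D := φ.le_depth.trans ((le_max_left _ _).trans hD)
    have hne : ∀ i < k, ∀ t s, reg D i t ≠ reg D k s := by
      intro i hi t s h
      rw [reg_inj (by omega) (by omega)] at h
      omega
    have hne' : ∀ t s, t ≠ s → reg D k t ≠ reg D k s := by
      intro t s hts h
      rw [reg_inj (by omega) (by omega)] at h
      exact hts h.2
    set r1 := Function.update (Function.update r (reg D k 1) 0) (reg D k 2) 0 with hr1
    have hr1i : ∀ i < k, ∀ t, r1 (reg D i t) = r (reg D i t) := by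
      intro i hi t
      rw [hr1, Function.update_of_ne (hne i hi _ _), Function.update_of_ne (hne i hi _ _)]
    obtain ⟨b2, r2, h2, hc2, ht2, hi2⟩ := runs_count (C := C) z e hk φ 1 (by decide)
      (fun e r b hr he => ih1 ((le_max_left _ _).trans hD) e r b hr he) r1
      (fun i => by rw [hr1i i i.2, hr]) he b
      (by rw [hr1, Function.update_of_ne (hne' _ _ (by decide)), Function.update_self])
    obtain ⟨b3, r3, h3, hc3, ht3, hi3⟩ := runs_count (C := C) z e hk ψ 2 (by decide)
      (fun e r b hr he => ih2 ((le_max_right _ _).trans hD) e r b hr he) r2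
      (fun i => by rw [hi2 i i.2, hr1i i i.2, hr]) he b2
      (by rw [ht2 2 (by decide) (by decide), hr1, Function.update_self])
    have hc : r3 (reg D k 1) = Nat.count (fun x => φ.Sat z (extend e x)) z.length := by
      rw [ht3 1 (by decide) (by decide), hc2]
    -- A count can equal the length of the word, and then its register has no mark. As both counts
    -- are at most the length, two different counts are still told apart by a mark of the smaller
    -- one.
    have hle1 := Nat.count_le (p := fun x => φ.Sat z (extend e x)) (n := z.length)
    have hle2 := Nat.count_le (p := fun x => ψ.Sat z (extend e x)) (n := z.length)
    refine ⟨r3, ?_, fun i hi t => by rw [hi3 i hi, hi2 i hi, hr1i i hi]⟩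
    have h4 := Runs.testAny (C := C) z (fun _ m => m (reg D k 1) != m (reg D k 2)) b3 r3
      (decide (r3 (reg D k 1) ≠ r3 (reg D k 2))) (by
        simp only [decide_eq_true_eq, bne_iff_ne, ne_eq, decide_eq_decide]
        constructor
        · intro h
          rcases Nat.lt_or_ge (r3 (reg D k 1)) z.length with h' | h'
          · exact ⟨r3 (reg D k 1), _, List.getElem?_eq_getElem h', by simpa using Ne.symm h⟩
          · refine ⟨r3 (reg D k 2), _, List.getElem?_eq_getElem (by omega), by simpa using h⟩
        · rintro ⟨p, a, -, h⟩ h'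
          exact h (by rw [h']))
    have := (Runs.zeroReg (C := C) z (reg D k 1) b r).seq ((Runs.zeroReg z (reg D k 2) b _).seq
      (h2.seq (h3.seq (h4.seq (Runs.updAcc z (fun b => !b) _ _)))))
    suffices hcost : scanCost z.length + (scanCost z.length + (Polynomial.eval z.length
        ((Polynomial.X + 2) * (φ.cost + 8 * Polynomial.X + 16)) + (Polynomial.eval z.length
        ((Polynomial.X + 2) * (ψ.cost + 8 * Polynomial.X + 16)) +
        (1 + scanCost z.length + 1)))) ≤ (Form.eqCount φ ψ).cost.eval z.length by
      have hd : decide ((Form.eqCount φ ψ).Sat z e) =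
          !decide (r3 (reg D k 1) ≠ r3 (reg D k 2)) := by
        rw [Bool.eq_iff_iff, decide_eq_true_iff]
        simp [Form.Sat, hc, hc3]
      rw [hd]
      exact this.mono hcost
    simp only [Form.cost, Polynomial.eval_add, Polynomial.eval_mul, Polynomial.eval_X,
        Polynomial.eval_ofNat, scanCost]
    omega

end compile


/-! ### Definable properties of words -/

/-- The number of `x < n` with the property `Q`. -/
noncomputable def posCount (n : ℕ) (Q : ℕ → Prop) : ℕ := by
  classical exact ((Finset.range n).filter Q).card

theorem posCount_congr {n : ℕ} {Q Q' : ℕ → Prop} (h : ∀ x < n, (Q x ↔ Q' x)) :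
    posCount n Q = posCount n Q' := by
  classical
  unfold posCount
  congr 1
  ext x
  simp only [Finset.mem_filter, Finset.mem_range]
  exact and_congr_right fun hx => h x hx

theorem posCount_false (n : ℕ) : posCount n (fun _ => False) = 0 := by simp [posCount]

theorem posCount_eq_zero {n : ℕ} {Q : ℕ → Prop} : posCount n Q = 0 ↔ ∀ x < n, ¬ Q x := by
  simp [posCount, Finset.filter_eq_empty_iff]

theorem posCount_lt {n v : ℕ} (hv : v ≤ n) : posCount n (fun x => x < v) = v := by
  have h : (Finset.range n).filter (fun x => x < v) = Finset.range v := by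
    ext x
    simp only [Finset.mem_filter, Finset.mem_range]
    omega
  calc posCount n (fun x => x < v) = ((Finset.range n).filter (fun x => x < v)).card := by
        unfold posCount; congr
    _ = v := by rw [h, Finset.card_range]

/-- The property is defined by a formula. -/
def Definable {L : Type} {k : ℕ} (P : List L → (Fin k → ℕ) → Prop) : Prop :=
  ∃ φ : Form L k, ∀ z e, (∀ i, e i < z.length) → (φ.Sat z e ↔ P z e)

/-- The function is a projection. -/
def IsVar {k : ℕ} (f : (Fin k → ℕ) → ℕ) : Prop := ∃ i, f = fun e => e i

namespace Definable

variable {L : Type} {k : ℕ} {P Q : List L → (Fin k → ℕ) → Prop}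

theorem congr (hP : Definable P) (h : ∀ z e, (∀ i, e i < z.length) → (P z e ↔ Q z e)) :
    Definable Q := by
  obtain ⟨φ, hφ⟩ := hP
  exact ⟨φ, fun z e he => (hφ z e he).trans (h z e he)⟩

theorem not (hP : Definable P) : Definable fun z e => ¬ P z e := by
  obtain ⟨φ, hφ⟩ := hP
  exact ⟨.nand φ φ, fun z e he => by simp [Form.Sat, hφ z e he]⟩

theorem and (hP : Definable P) (hQ : Definable Q) : Definable fun z e => P z e ∧ Q z e := by
  obtain ⟨φ, hφ⟩ := hP
  obtain ⟨ψ, hψ⟩ := hQ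
  exact ⟨.nand (.nand φ ψ) (.nand φ ψ), fun z e he => by simp [Form.Sat, hφ z e he, hψ z e he]⟩

theorem or (hP : Definable P) (hQ : Definable Q) : Definable fun z e => P z e ∨ Q z e :=
  (hP.not.and hQ.not).not.congr fun z e _ => by tauto

theorem imp (hP : Definable P) (hQ : Definable Q) : Definable fun z e => P z e → Q z e :=
  (hP.not.or hQ).congr fun z e _ => by tauto

theorem sym (t : L → Bool) {f : (Fin k → ℕ) → ℕ} (hf : IsVar f) :
    Definable fun (z : List L) e => ∃ a, z[f e]? = some a ∧ t a = true := by
  obtain ⟨i, rfl⟩ := hf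
  exact ⟨.sym t i, fun z e _ => Iff.rfl⟩

theorem lt {f g : (Fin k → ℕ) → ℕ} (hf : IsVar f) (hg : IsVar g) :
    Definable fun (_ : List L) e => f e < g e := by
  obtain ⟨i, rfl⟩ := hf
  obtain ⟨j, rfl⟩ := hg
  exact ⟨.lt i j, fun z e _ => Iff.rfl⟩

theorem le {f g : (Fin k → ℕ) → ℕ} (hf : IsVar f) (hg : IsVar g) :
    Definable fun (_ : List L) e => f e ≤ g e :=
  (lt hg hf).not.congr fun _ _ _ => by simp

theorem eq {f g : (Fin k → ℕ) → ℕ} (hf : IsVar f) (hg : IsVar g) :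
    Definable fun (_ : List L) e => f e = g e :=
  ((le hf hg).and (le hg hf)).congr fun _ _ _ => by omega

/-- The assignment to the bound variable ranges over positions only, so definability of `P` and `Q`
needs to be known just there. -/
theorem countEq {P Q : List L → (Fin k → ℕ) → ℕ → Prop}
    (hP : Definable fun z (e : Fin (k + 1) → ℕ) => P z (Fin.init e) (e (Fin.last k)))
    (hQ : Definable fun z (e : Fin (k + 1) → ℕ) => Q z (Fin.init e) (e (Fin.last k))) :
    Definable fun z e => posCount z.length (P z e) = posCount z.length (Q z e) := by
  classical
  obtain ⟨φ, hφ⟩ := hP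
  obtain ⟨ψ, hψ⟩ := hQ
  refine ⟨.eqCount φ ψ, fun z e he => ?_⟩
  have h : ∀ x < z.length, ∀ i, extend e x i < z.length := by
    intro x hx i
    refine Fin.lastCases ?_ (fun i => ?_) i
    · simpa [extend] using hx
    · simpa [extend] using he i
  simp only [Form.Sat, Nat.count_eq_card_filter_range]
  rw [← posCount_congr (Q := fun x => φ.Sat z (extend e x)) (Q' := P z e),
    ← posCount_congr (Q := fun x => ψ.Sat z (extend e x)) (Q' := Q z e)]
  · unfold posCount
    exact Iff.rfl
  · intro x hx; rw [hψ z _ (h x hx)]; simp [extend]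
  · intro x hx; rw [hφ z _ (h x hx)]; simp [extend]

theorem const (p : Prop) : Definable fun (_ : List L) (_ : Fin k → ℕ) => p := by
  by_cases hp : p
  · refine ⟨.eqCount (.sym (fun _ => true) (Fin.last k)) (.sym (fun _ => true) (Fin.last k)),
      fun z e _ => by simp [Form.Sat, hp]⟩
  · let φ : Form L k :=
      .eqCount (.sym (fun _ => true) (Fin.last k)) (.sym (fun _ => true) (Fin.last k))
    exact ⟨.nand φ φ, fun z e _ => by simp [Form.Sat, hp, φ]⟩

/-- A property holds at some position iff its count differs from that of the false property. All
quantifiers are obtained from count comparison in this way. -/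
theorem ex {P : List L → (Fin k → ℕ) → ℕ → Prop}
    (hP : Definable fun z (e : Fin (k + 1) → ℕ) => P z (Fin.init e) (e (Fin.last k))) :
    Definable fun z e => ∃ x, x < z.length ∧ P z e x :=
  (countEq (Q := fun _ _ _ => False) hP (const False)).not.congr fun z e _ => by
    rw [posCount_false, posCount_eq_zero]; simp

theorem all {P : List L → (Fin k → ℕ) → ℕ → Prop}
    (hP : Definable fun z (e : Fin (k + 1) → ℕ) => P z (Fin.init e) (e (Fin.last k))) :
    Definable fun z e => ∀ x, x < z.length → P z e x :=
  (ex (P := fun z e x => ¬ P z e x) hP.not).not.congr fun z e _ => by simp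

theorem exFin {T : Type} [Finite T] {P : T → List L → (Fin k → ℕ) → Prop}
    (hP : ∀ t, Definable (P t)) : Definable fun z e => ∃ t, P t z e := by
  classical
  have := Fintype.ofFinite T
  have key : ∀ s : Finset T, Definable fun z e => ∃ t ∈ s, P t z e := by
    intro s
    induction s using Finset.induction with
    | empty => exact (const False).congr fun _ _ _ => by simp
    | insert a s ha ih => exact ((hP a).or ih).congr fun _ _ _ => by simp
  exact (key Finset.univ).congr fun _ _ _ => by simp

theorem allFin {T : Type} [Finite T] {P : T → List L → (Fin k → ℕ) → Prop}
    (hP : ∀ t, Definable (P t)) : Definable fun z e => ∀ t, P t z e :=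
  (exFin fun t => (hP t).not).not.congr fun z e _ => by simp

/-- The vector is bound one entry at a time. For the induction, the hypothesis must allow
substitution: the parameters and entries found so far are arbitrary variables `f`, `w` of a larger
context. -/
theorem exVec {m : ℕ} {P : List L → (Fin k → ℕ) → (Fin m → ℕ) → Prop}
    (hP : ∀ (k' : ℕ) (f : (Fin k' → ℕ) → Fin k → ℕ) (w : (Fin k' → ℕ) → Fin m → ℕ),
      (∀ i, IsVar fun e => f e i) → (∀ j, IsVar fun e => w e j) →
      Definable fun z e => P z (f e) (w e)) :
    Definable fun z e => ∃ w : Fin m → ℕ, (∀ j, w j < z.length) ∧ P z e w := by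
  suffices H : ∀ (k' : ℕ) (f : (Fin k' → ℕ) → Fin k → ℕ), (∀ i, IsVar fun e => f e i) →
      Definable fun z e => ∃ w : Fin m → ℕ, (∀ j, w j < z.length) ∧ P z (f e) w from
    H k id fun i => ⟨i, rfl⟩
  induction m generalizing k with
  | zero =>
    intro k' f hf
    refine (hP k' f (fun _ => Fin.elim0) hf fun j => j.elim0).congr fun z e _ => ?_
    constructor
    · exact fun h => ⟨_, fun j => j.elim0, h⟩
    · rintro ⟨w, -, h⟩
      rwa [Subsingleton.elim w Fin.elim0] at h
  | succ m ih =>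
    intro k' f hf
    have hlift : ∀ {n : ℕ} {g : (Fin n → ℕ) → ℕ}, IsVar g →
        IsVar fun e : Fin (n + 1) → ℕ => g (Fin.init e) := by
      rintro n g ⟨i, rfl⟩
      exact ⟨i.castSucc, rfl⟩
    have := ih (k := k + 1)
      (P := fun z e w => P z (Fin.init e) (Fin.cons (α := fun _ => ℕ) (e (Fin.last k)) w))
      (fun k'' g w hg hw => hP k'' (fun e => Fin.init (g e))
        (fun e => Fin.cons (α := fun _ => ℕ) (g e (Fin.last k)) (w e)) (fun i => hg _)
        (fun j => by
          refine Fin.cases ?_ (fun j => ?_) j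
          · exact hg _
          · exact hw j))
      (k' + 1) (fun e => Fin.snoc (α := fun _ => ℕ) (f (Fin.init e)) (e (Fin.last k'))) (by
        intro i
        refine Fin.lastCases ?_ (fun i => ?_) i
        · simpa using ⟨Fin.last k', rfl⟩
        · simpa using hlift (hf i))
    simp only [Fin.init_snoc, Fin.snoc_last] at this
    refine (ex (P := fun z e y => ∃ w : Fin m → ℕ, (∀ j, w j < z.length) ∧
      P z (f e) (Fin.cons (α := fun _ => ℕ) y w)) this).congr fun z e _ => ?_
    constructor
    · rintro ⟨y, hy, w, hw, h⟩
      exact ⟨_, fun j => by refine Fin.cases ?_ (fun j => ?_) j; exacts [hy, hw j], h⟩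
    · rintro ⟨w, hw, h⟩
      refine ⟨w 0, hw 0, Fin.tail w, fun j => hw j.succ, ?_⟩
      rwa [show Fin.cons (α := fun _ => ℕ) (w 0) (Fin.tail w) = w from Fin.cons_self_tail w]

end Definable

/-! ### Membership in NP by definable verification -/

theorem polynomial_eval_mono (p : Polynomial ℕ) {m n : ℕ} (h : m ≤ n) : p.eval m ≤ p.eval n := by
  rw [Polynomial.eval_eq_sum, Polynomial.eval_eq_sum]
  exact Finset.sum_le_sum fun i _ => Nat.mul_le_mul_left _ (Nat.pow_le_pow_left h i)

/-! ### Binary certificates and the passage from definability to NP. -/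

section certificate

variable {Γ Δ : Type} {B : ℕ}

/-- Decoding of bit strings: the letter with number `i` is written as `i` ones and a zero. -/
def decodeBits (letter : ZMod B → Δ) : ZMod B → List Bool → List Δ
  | _, [] => []
  | c, true :: w => decodeBits letter (c + 1) w
  | c, false :: w => letter c :: decodeBits letter 0 w

/-- The bit string of a word. -/
def encodeBits (num : Δ → ZMod B) (d : List Δ) : List Bool :=
  d.flatMap fun a => List.replicate (num a).val true ++ [false]

theorem decodeBits_encodeBits [NeZero B] (e : Δ ≃ ZMod B) (d : List Δ) :
    decodeBits e.symm 0 (encodeBits e d) = d := by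
  have key : ∀ (n : ℕ) (c : ZMod B) (w : List Bool),
      decodeBits e.symm c (List.replicate n true ++ [false] ++ w) =
        e.symm (c + n) :: decodeBits e.symm 0 w := by
    intro n
    induction n with
    | zero => intro c w; simp [decodeBits]
    | succ n ih =>
      intro c w
      simp only [List.replicate_succ, List.cons_append, decodeBits]
      rw [ih]
      push_cast
      rw [add_assoc, add_comm (1 : ZMod B)]
  induction d with
  | nil => rfl
  | cons a d ih =>
    simp only [encodeBits, List.flatMap_cons] at ih ⊢
    rw [key, ih]
    simp

theorem length_encodeBits_le [NeZero B] (num : Δ → ZMod B) (d : List Δ) :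
    (encodeBits num d).length ≤ B * d.length := by
  induction d with
  | nil => simp [encodeBits]
  | cons a d ih =>
    simp only [encodeBits, List.flatMap_cons, List.length_append, List.length_replicate,
      List.length_cons, List.length_nil] at ih ⊢
    have := (num a).val_lt
    rw [Nat.mul_add]
    omega

/-- The transducer that decodes the certificate. -/
def decoder {ι : Type} (letter : ZMod B → Δ) :
    Ctl (ZMod B) → Γ ⊕ Bool → Ctl (ZMod B) × Option ((Γ ⊕ Δ) × (ι → Bool))
  | s, .inl a => (s, some (.inl a, fun _ => false))
  | s, .inr true => ((s.1, s.2.1, s.2.2 + 1), none)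
  | s, .inr false => ((s.1, s.2.1, 0), some (.inr (letter s.2.2), fun _ => false))

theorem transduce_decoder {ι : Type} (letter : ZMod B → Δ) (x : List Γ) (w : List Bool)
    (s : Ctl (ZMod B)) :
    (transduce (decoder (ι := ι) letter) s (x.map .inl ++ w.map .inr)).2 =
      (x.map (Sum.inl : Γ → Γ ⊕ Δ) ++ (decodeBits letter s.2.2 w).map Sum.inr).map
        fun a => (a, fun _ => false) := by
  induction x with
  | nil =>
    induction w generalizing s with
    | nil => rfl
    | cons b w ih =>
      cases b
      · simpa [transduce, decoder, decodeBits] using ih (s.1, s.2.1, 0)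
      · simpa [transduce, decoder, decodeBits] using ih (s.1, s.2.1, s.2.2 + 1)
  | cons a x ih => simpa [transduce, decoder] using ih

/-- A word without marks is one in which every register has a value beyond the last position. This
turns the output of the decoder into a legitimate starting configuration. -/
theorem marked_eq_map {L ι : Type} (n : ℕ) (z : List L) :
    ∀ k, k + z.length ≤ n → marked (fun _ : ι => n) k z = z.map fun a => (a, fun _ => false) := by
  induction z with
  | nil => intro k _; rfl
  | cons a z ih =>
    intro k hk
    simp only [List.length_cons] at hk
    simp only [marked, List.map_cons, ih (k + 1) (by omega)]
    have : n ≠ k := by omega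
    simp [this]

/-- The verifier decodes the bit string while reading it, counting ones in the third component of
the control state modulo the size of `Δ`, and then evaluates the formula. Every bit string decodes
to some word, so it is enough that no word over `Δ` certifies a no-instance. A letter costs at most
`Fintype.card Δ` bits. -/
theorem inNP_of_definable [Finite Γ] [Finite Δ] [Nonempty Δ] {P : List (Γ ⊕ Δ) → Prop}
    (hP : Definable (k := 0) fun z _ => P z) (q : Polynomial ℕ) {yes no : Set (List Γ)}
    (hyes : ∀ x ∈ yes, ∃ d : List Δ, d.length ≤ q.eval x.length ∧ P (x.map .inl ++ d.map .inr))
    (hno : ∀ x ∈ no, ∀ d : List Δ, ¬ P (x.map .inl ++ d.map .inr)) : InNP yes no := by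
  classical
  have := Fintype.ofFinite Δ
  have hB : NeZero (Fintype.card Δ) := ⟨Fintype.card_ne_zero⟩
  let e : Δ ≃ ZMod (Fintype.card Δ) :=
    (Fintype.equivFin Δ).trans (ZMod.finEquiv (Fintype.card Δ)).toEquiv
  obtain ⟨φ, hφ⟩ := hP
  refine ⟨Polynomial.C (Fintype.card Δ) * q, fun y => decide
    (P (y.1.map .inl ++ (decodeBits e.symm 0 y.2).map .inr)), ?_, ?_, ?_⟩
  · have : Inhabited Δ := Classical.inhabited_of_nonempty ‹_›
    have : Inhabited ((Γ ⊕ Δ) × (Reg φ.depth → Bool)) := ⟨(.inr default, fun _ => false)⟩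
    have : Inhabited (Γ ⊕ Bool) := ⟨.inr false⟩
    refine polyTime_of_exec (fun x : List Γ × List Bool => x.1.map Sum.inl ++ x.2.map Sum.inr) _
      (φ.comp φ.depth : MCmd (Γ ⊕ Δ) (Reg φ.depth) (ZMod (Fintype.card Δ)))
      (decoder e.symm) (false, false, 0) (fun s => s.1) φ.cost fun y => ?_
    set z : List (Γ ⊕ Δ) := y.1.map .inl ++ (decodeBits e.symm 0 y.2).map .inr with hz
    have ht := transduce_decoder (ι := Reg φ.depth) e.symm y.1 y.2 (false, false, 0)
    rw [← marked_eq_map (L := Γ ⊕ Δ) z.length _ 0 (by simp [hz])] at ht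
    have hlen := length_transduce_le (decoder (ι := Reg φ.depth) e.symm)
      (y.1.map Sum.inl ++ y.2.map Sum.inr) (false, false, 0)
    rw [ht, length_marked] at hlen
    obtain ⟨r', hr, -⟩ := φ.runs_comp (C := ZMod (Fintype.card Δ)) z le_rfl Fin.elim0
      (fun _ => z.length)
      (transduce (decoder (ι := Reg φ.depth) e.symm) (false, false, 0)
        (y.1.map Sum.inl ++ y.2.map Sum.inr)).1.1 (fun i => i.elim0) (fun i => i.elim0)
    obtain ⟨x', c', n, hn, he⟩ := hr _ _
    refine ⟨n, hn.trans (polynomial_eval_mono _ hlen), _, _, by rw [ht]; exact he, ?_⟩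
    simp only [decide_eq_decide]
    exact hφ z _ fun i => i.elim0
  · intro x hx
    obtain ⟨d, hd, h⟩ := hyes x hx
    refine ⟨encodeBits e d, ?_, ?_⟩
    · rw [Polynomial.eval_mul, Polynomial.eval_C]
      exact (length_encodeBits_le _ _).trans (Nat.mul_le_mul_left _ hd)
    · rw [decide_eq_true_eq, decodeBits_encodeBits]
      exact h
  · rintro x hx ⟨w, -, h⟩
    exact hno x hx _ (of_decide_eq_true h)

end certificate


/-! ### Strategies -/

/-- Skolemization in one function: `σ` maps the values of the universal variables to a full
assignment, of which coordinate `i` may depend only on universal coordinates up to `i`. The entries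
of `u` at existential variables are irrelevant, which avoids separate types for the two kinds of
variables. -/
theorem quantTrue_iff_exists_strategy {A : Type} [Nonempty A] {n : ℕ} (q : Fin n → Bool)
    (P : (Fin n → A) → Prop) :
    QuantTrue n q P ↔ ∃ σ : (Fin n → A) → Fin n → A, (∀ u i, q i = true → σ u i = u i) ∧
      (∀ u u' i, (∀ j ≤ i, q j = true → u j = u' j) → σ u i = σ u' i) ∧ ∀ u, P (σ u) := by
  induction n with
  | zero =>
    constructor
    · intro h
      exact ⟨id, fun _ i => i.elim0, fun _ _ i => i.elim0, fun u => by
        rwa [Subsingleton.elim (id u) Fin.elim0]⟩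
    · rintro ⟨σ, -, -, h⟩
      have := h Fin.elim0
      rwa [Subsingleton.elim (σ Fin.elim0) Fin.elim0] at this
  | succ n ih =>
    rw [QuantTrue]
    split_ifs with hq
    · constructor
      · intro h
        choose σ h1 h2 h3 using fun a => (ih _ _).1 (h a)
        refine ⟨fun u => Fin.cons (u 0) (σ (u 0) (Fin.tail u)), fun u i hi => ?_,
          fun u u' i hi => ?_, fun u => h3 _ _⟩
        · refine Fin.cases (fun _ => rfl) (fun i hi => ?_) i hi
          exact h1 (u 0) (Fin.tail u) i hi
        · have h0 : u 0 = u' 0 := hi 0 (Fin.zero_le i) hq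
          refine Fin.cases (fun _ => by simpa using h0) (fun i hi => ?_) i hi
          simp only [Fin.cons_succ, h0]
          exact h2 _ _ _ _ fun j hj hqj => hi j.succ (by simpa using hj) hqj
      · rintro ⟨σ, h1, h2, h3⟩ a
        rw [ih]
        refine ⟨fun u => Fin.tail (σ (Fin.cons a u)), fun u i hi => ?_, fun u u' i hi => ?_,
          fun u => ?_⟩
        · simp [Fin.tail, h1 _ i.succ hi]
        · refine h2 _ _ _ fun j => Fin.cases (fun _ _ => rfl) (fun j hj hqj => ?_) j
          simpa using hi j (by simpa using hj) hqj
        · have := h3 (Fin.cons a u)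
          rwa [← Fin.cons_self_tail (σ (Fin.cons a u)), h1 _ 0 hq] at this
    · constructor
      · rintro ⟨a, h⟩
        obtain ⟨σ, h1, h2, h3⟩ := (ih _ _).1 h
        refine ⟨fun u => Fin.cons a (σ (Fin.tail u)), fun u i => ?_, fun u u' i => ?_,
          fun u => h3 _⟩
        · refine Fin.cases (fun h => absurd h hq) (fun i hi => ?_) i
          exact h1 (Fin.tail u) i hi
        · refine Fin.cases (fun _ => rfl) (fun i hi => ?_) i
          simp only [Fin.cons_succ]
          exact h2 _ _ _ fun j hj hqj => hi j.succ (by simpa using hj) hqj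
      · rintro ⟨σ, h1, h2, h3⟩
        obtain ⟨d⟩ := ‹Nonempty A›
        -- No universal variable precedes an existential first variable, so its value is a constant
        -- that can be taken from any `u`.
        have hz : ∀ u, σ u 0 = σ (fun _ => d) 0 := fun u => h2 _ _ _ fun j hj hqj => by
          obtain rfl : j = 0 := Fin.le_zero_iff.1 hj
          exact absurd hqj hq
        refine ⟨σ (fun _ => d) 0, ?_⟩
        rw [ih]
        refine ⟨fun u => Fin.tail (σ (Fin.cons (σ (fun _ => d) 0) u)), fun u i hi => ?_,
          fun u u' i hi => ?_, fun u => ?_⟩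
        · simp [Fin.tail, h1 _ i.succ hi]
        · refine h2 _ _ _ fun j => Fin.cases (fun _ _ => rfl) (fun j hj hqj => ?_) j
          simpa using hi j (by simpa using hj) hqj
        · have := h3 (Fin.cons (σ (fun _ => d) 0) u)
          rwa [← Fin.cons_self_tail (σ (Fin.cons (σ (fun _ => d) 0) u)), hz] at this

/-! ### A proof system for falsity -/

/-- The structure of a sentence, on positions: variables, relational atoms, and disjuncts of the
relations are represented by natural numbers. -/
structure Sys (A : Type) where
  uni : ℕ → Prop
  eqA : ℕ → ℕ → Prop
  rel : ℕ → Prop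
  dj : ℕ → ℕ → Prop
  lEq : ℕ → ℕ → ℕ → Prop
  lNe : ℕ → ℕ → ℕ → Prop
  lEqC : ℕ → ℕ → A → Prop
  lNeC : ℕ → ℕ → A → Prop

namespace Sys

variable {A : Type} (S : Sys A)

/-- The literals of the disjunct `C` hold. -/
structure LitsHold (C : ℕ) (t : ℕ → A) : Prop where
  eq : ∀ y y', S.lEq C y y' → t y = t y'
  ne : ∀ y y', S.lNe C y y' → t y ≠ t y'
  eqC : ∀ y a, S.lEqC C y a → t y = a
  neC : ∀ y a, S.lNeC C y a → t y ≠ a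

/-- The relational atom `p` holds. -/
def Holds (p : ℕ) (t : ℕ → A) : Prop := ∃ C, S.dj p C ∧ S.LitsHold C t

/-- All atoms hold, and the universal variables have the values given by `u`. -/
structure Sol (u t : ℕ → A) : Prop where
  uni : ∀ y, S.uni y → t y = u y
  eq : ∀ y y', S.eqA y y' → t y = t y'
  holds : ∀ p, S.rel p → S.Holds p t

variable {m : ℕ}

/-- The justification of `y ≠ a` from known facts: `un b x` says that the universal variable `x`
has the value `b`, `out b x` that `x ≠ b`, and `inn β b C x w` that `x ≠ b` under the assumption of
the literals of `C` and of `w j = β j` for all `j`. -/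
def JustOut (M : ℕ) (un out : A → ℕ → Prop)
    (inn : (Fin m → A) → A → ℕ → ℕ → (Fin m → ℕ) → Prop) (a : A) (y : ℕ) : Prop :=
  (S.uni y ∧ ∃ b, b ≠ a ∧ un b y) ∨
  (∃ y', y' < M ∧ (S.eqA y y' ∨ S.eqA y' y) ∧ out a y') ∨
  (∃ p, p < M ∧ S.rel p ∧ ∀ C, C < M → S.dj p C → ∃ w : Fin m → ℕ, (∀ j, w j < M) ∧
    ∀ β, inn β a C y w)

/-- The justification of `y ≠ a` under the assumption of the literals of `C` and of `w j = β j` for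
all `j`. -/
def JustInn (M : ℕ) (out : A → ℕ → Prop)
    (inn : (Fin m → A) → A → ℕ → ℕ → (Fin m → ℕ) → Prop)
    (β : Fin m → A) (a : A) (C y : ℕ) (w : Fin m → ℕ) : Prop :=
  out a y ∨ (∃ j, w j = y ∧ β j ≠ a) ∨ (∃ b, b ≠ a ∧ S.lEqC C y b) ∨ S.lNeC C y a ∨
  (∃ y', y' < M ∧ (S.lEq C y y' ∨ S.lEq C y' y) ∧ inn β a C y' w) ∨
  (∃ y', y' < M ∧ (S.lNe C y y' ∨ S.lNe C y' y) ∧ ∀ a', a' ≠ a → inn β a' C y' w) ∨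
  (∃ y', y' < M ∧ ∀ a', inn β a' C y' w)

variable {S}

/-- In the relational case the solution itself selects a disjunct that holds, and its own values on
`w` select the branch `β` whose derivation applies. -/
theorem JustOut.sound {M : ℕ} {un out : A → ℕ → Prop}
    {inn : (Fin m → A) → A → ℕ → ℕ → (Fin m → ℕ) → Prop} {a : A} {y : ℕ}
    (h : S.JustOut M un out inn a y) {u t : ℕ → A} (ht : S.Sol u t)
    (hdj : ∀ p C, S.dj p C → C < M)
    (hun : ∀ b x, un b x → u x = b) (hout : ∀ b x, out b x → t x ≠ b)
    (hinn : ∀ β b C x w, inn β b C x w → S.LitsHold C t → (∀ j, t (w j) = β j) → t x ≠ b) :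
    t y ≠ a := by
  rcases h with ⟨hy, b, hb, h⟩ | ⟨y', -, h1, h2⟩ | ⟨p, -, hp, h⟩
  · rw [ht.uni y hy, hun _ _ h]; exact hb
  · have : t y = t y' := h1.elim (ht.eq _ _) fun h => (ht.eq _ _ h).symm
    rw [this]; exact hout _ _ h2
  · obtain ⟨C, hC, hl⟩ := ht.holds p hp
    obtain ⟨w, -, h⟩ := h C (hdj p C hC) hC
    exact hinn _ _ _ _ _ (h fun j => t (w j)) hl fun j => rfl

theorem JustInn.sound {M : ℕ} {out : A → ℕ → Prop}
    {inn : (Fin m → A) → A → ℕ → ℕ → (Fin m → ℕ) → Prop} {β : Fin m → A} {a : A} {C y : ℕ}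
    {w : Fin m → ℕ} (h : S.JustInn M out inn β a C y w) {t : ℕ → A}
    (hout : ∀ b x, out b x → t x ≠ b)
    (hinn : ∀ β b C x w, inn β b C x w → S.LitsHold C t → (∀ j, t (w j) = β j) → t x ≠ b)
    (hC : S.LitsHold C t) (hw : ∀ j, t (w j) = β j) : t y ≠ a := by
  rcases h with h | ⟨j, rfl, h⟩ | ⟨b, hb, h⟩ | h | ⟨y', -, h, h'⟩ | ⟨y', -, h, h'⟩ | ⟨y', -, h⟩
  · exact hout _ _ h
  · rw [hw]; exact h
  · rw [hC.eqC _ _ h]; exact hb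
  · exact hC.neC _ _ h
  · have : t y = t y' := h.elim (hC.eq _ _) fun h => (hC.eq _ _ h).symm
    rw [this]; exact hinn _ _ _ _ _ h' hC hw
  · have : t y ≠ t y' := h.elim (hC.ne _ _) fun h => (hC.ne _ _ h).symm
    rintro rfl
    exact hinn _ _ _ _ _ (h' (t y') this.symm) hC hw rfl
  · exact absurd rfl (hinn _ _ _ _ _ (h (t y')) hC hw)

/-- Used to pass from the length of the sentence to that of the whole word with the certificate. The
quantifier over disjuncts points in the wrong direction for monotonicity, but every disjunct already
lies below the smaller bound. -/
theorem JustOut.mono {M M' : ℕ} (hM : M ≤ M') {un un' out out' : A → ℕ → Prop}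
    {inn inn' : (Fin m → A) → A → ℕ → ℕ → (Fin m → ℕ) → Prop} {a : A} {y : ℕ}
    (hdj : ∀ p C, S.dj p C → C < M)
    (h : S.JustOut M un out inn a y) (hun : ∀ b x, un b x → un' b x)
    (hout : ∀ b x, out b x → out' b x)
    (hinn : ∀ β b C x w, inn β b C x w → inn' β b C x w) : S.JustOut M' un' out' inn' a y := by
  rcases h with ⟨hy, b, hb, h⟩ | ⟨y', h0, h1, h2⟩ | ⟨p, h0, hp, h⟩
  · exact .inl ⟨hy, b, hb, hun _ _ h⟩
  · exact .inr (.inl ⟨y', h0.trans_le hM, h1, hout _ _ h2⟩)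
  · refine .inr (.inr ⟨p, h0.trans_le hM, hp, fun C _ hC => ?_⟩)
    obtain ⟨w, hw, h⟩ := h C (hdj p C hC) hC
    exact ⟨w, fun j => (hw j).trans_le hM, fun β => hinn _ _ _ _ _ (h β)⟩

theorem JustInn.mono {M M' : ℕ} (hM : M ≤ M') {out out' : A → ℕ → Prop}
    {inn inn' : (Fin m → A) → A → ℕ → ℕ → (Fin m → ℕ) → Prop} {β : Fin m → A} {a : A} {C y : ℕ}
    {w : Fin m → ℕ} (h : S.JustInn M out inn β a C y w)
    (hout : ∀ b x, out b x → out' b x)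
    (hinn : ∀ β b C x w, inn β b C x w → inn' β b C x w) : S.JustInn M' out' inn' β a C y w := by
  rcases h with h | h | h | h | ⟨y', h0, h, h'⟩ | ⟨y', h0, h, h'⟩ | ⟨y', h0, h⟩
  · exact .inl (hout _ _ h)
  · exact .inr (.inl h)
  · exact .inr (.inr (.inl h))
  · exact .inr (.inr (.inr (.inl h)))
  · exact .inr (.inr (.inr (.inr (.inl ⟨y', h0.trans_le hM, h, hinn _ _ _ _ _ h'⟩))))
  · exact .inr (.inr (.inr (.inr (.inr (.inl ⟨y', h0.trans_le hM, h,
      fun a' ha' => hinn _ _ _ _ _ (h' a' ha')⟩)))))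
  · exact .inr (.inr (.inr (.inr (.inr (.inr ⟨y', h0.trans_le hM,
      fun a' => hinn _ _ _ _ _ (h a')⟩)))))

/-- The positions in the literals are smaller than `N`. -/
structure BoundedBy (S : Sys A) (N : ℕ) : Prop where
  dj : ∀ p C, S.dj p C → C < N
  lEq : ∀ C y y', S.lEq C y y' → y < N ∧ y' < N
  lNe : ∀ C y y', S.lNe C y y' → y < N ∧ y' < N
  lEqC : ∀ C y a, S.lEqC C y a → y < N
  lNeC : ∀ C y a, S.lNeC C y a → y < N

/-- The sets of facts are closed under justification. -/
structure Closed (S : Sys A) (N : ℕ) (un out : A → ℕ → Prop)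
    (inn : (Fin m → A) → A → ℕ → ℕ → (Fin m → ℕ) → Prop) : Prop where
  closed_out : ∀ a y, y < N → S.JustOut N un out inn a y → out a y
  closed_inn : ∀ β a C y w, C < N → y < N → (∀ j, w j < N) → S.JustInn N out inn β a C y w →
    inn β a C y w

/-- The disequalities between variables in the disjunct can be resolved by branching over `m`
variables. -/
def Branching (S : Sys A) (N m : ℕ) (C : ℕ) : Prop :=
  Nat.card A ≤ 2 ∨ ∃ w : Fin m → ℕ, (∀ j, w j < N) ∧ ∀ y y', S.lNe C y y' → ∃ j, w j = y

open Classical in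
/-- An element of the set, if possible the given one. -/
noncomputable def pick (a : A) (E : Set A) : A :=
  if h : a ∉ E ∧ E.Nonempty then h.2.choose else a

theorem pick_mem {a : A} {E : Set A} (h : E.Nonempty) : pick a E ∈ E := by
  unfold pick
  split_ifs with h'
  · exact h'.2.choose_spec
  · by_contra ha
    exact h' ⟨ha, h⟩

theorem pick_eq {a : A} {E : Set A} (h : a ∈ E) : pick a E = a := by
  unfold pick
  rw [dif_neg]
  exact fun h' => h'.1 h

/-- Completeness of propagation in one disjunct: if no choice of `m` branching variables excludes
`a` at `y`, there is an assignment satisfying the disjunct with `t y = a`. In a branch that does not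
exclude `a`, every position keeps a nonempty set of values; linked positions have equal sets for
`=`, and a position with one value left removes it from its `≠`-neighbours. A value is then picked
from each set by a rule depending only on the set, so that equal sets give equal values. -/
theorem exists_litsHold_of_not_inn [Finite A] {N : ℕ} {un out : A → ℕ → Prop}
    {inn : (Fin m → A) → A → ℕ → ℕ → (Fin m → ℕ) → Prop} (hS : S.BoundedBy N)
    (hcl : S.Closed N un out inn) (hm : 0 < m) {C y : ℕ} {a : A} (hC : C < N) (hy : y < N)
    (hbr : S.Branching N m C)
    (h : ∀ w : Fin m → ℕ, (∀ j, w j < N) → ∃ β, ¬ inn β a C y w) :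
    ∃ t : ℕ → A, (∀ x < N, ¬ out (t x) x) ∧ S.LitsHold C t ∧ t y = a := by
  -- the possible values in a context, and their properties
  let E : (Fin m → ℕ) → (Fin m → A) → ℕ → Set A := fun w β x => {b | ¬ inn β b C x w}
  have hne : ∀ w β, (∀ j, w j < N) → ¬ inn β a C y w → ∀ x < N, (E w β x).Nonempty := by
    intro w β hw hi x hx
    by_contra hx'
    rw [Set.not_nonempty_iff_eq_empty] at hx'
    refine hi (hcl.closed_inn _ _ _ _ _ hC hy hw (.inr (.inr (.inr (.inr (.inr (.inr ⟨x, hx, ?_⟩)))))))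
    intro b
    by_contra hb
    have : b ∈ E w β x := hb
    rw [hx'] at this
    exact this
  have hout : ∀ w β, (∀ j, w j < N) → ∀ x < N, ∀ b ∈ E w β x, ¬ out b x :=
    fun w β hw x hx b hb ho => hb (hcl.closed_inn _ _ _ _ _ hC hx hw (.inl ho))
  have hass : ∀ w β, (∀ j, w j < N) → ∀ j, ∀ b ∈ E w β (w j), b = β j := by
    intro w β hw j b hb
    by_contra hne
    exact hb (hcl.closed_inn _ _ _ _ _ hC (hw j) hw (.inr (.inl ⟨j, rfl, fun h => hne h.symm⟩)))
  have heqC : ∀ w β, (∀ j, w j < N) → ∀ x b, S.lEqC C x b → ∀ b' ∈ E w β x, b' = b := by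
    intro w β hw x b hx b' hb'
    by_contra hne
    exact hb' (hcl.closed_inn _ _ _ _ _ hC (hS.lEqC _ _ _ hx) hw
      (.inr (.inr (.inl ⟨b, fun h => hne h.symm, hx⟩))))
  have hneC : ∀ w β, (∀ j, w j < N) → ∀ x b, S.lNeC C x b → b ∉ E w β x := by
    intro w β hw x b hx hb
    exact hb (hcl.closed_inn _ _ _ _ _ hC (hS.lNeC _ _ _ hx) hw (.inr (.inr (.inr (.inl hx)))))
  have heq : ∀ w β, (∀ j, w j < N) → ∀ x x', S.lEq C x x' → E w β x = E w β x' := by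
    intro w β hw x x' hx
    have hb := hS.lEq _ _ _ hx
    ext b
    refine not_congr ⟨fun hi => ?_, fun hi => ?_⟩
    · exact hcl.closed_inn _ _ _ _ _ hC hb.2 hw (.inr (.inr (.inr (.inr (.inl ⟨x, hb.1, .inr hx, hi⟩)))))
    · exact hcl.closed_inn _ _ _ _ _ hC hb.1 hw (.inr (.inr (.inr (.inr (.inl ⟨x', hb.2, .inl hx, hi⟩)))))
  have hneV : ∀ w β, (∀ j, w j < N) → ∀ x x', S.lNe C x x' ∨ S.lNe C x' x → ∀ b,
      (∀ b' ∈ E w β x, b' = b) → b ∉ E w β x' := by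
    intro w β hw x x' hx b hb hb'
    have hbd : x < N ∧ x' < N := hx.elim (hS.lNe _ _ _) fun h => (hS.lNe _ _ _ h).symm
    refine hb' (hcl.closed_inn _ _ _ _ _ hC hbd.2 hw (.inr (.inr (.inr (.inr (.inr (.inl
      ⟨x, hbd.1, hx.symm, fun b' hne => ?_⟩)))))))
    by_contra hi
    exact hne (hb b' hi)
  rcases hbr with hA | ⟨w, hw, hcov⟩
  · -- at most two elements: one branch for each connected component
    let conn : ℕ → ℕ → Prop := Relation.EqvGen fun x x' => S.lEq C x x' ∨ S.lNe C x x'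
    let conS : Setoid ℕ := ⟨conn, Relation.EqvGen.is_equivalence _⟩
    have hconnN : ∀ x x', conn x x' → (x < N ↔ x' < N) := by
      intro x x' hx
      induction hx with
      | rel x x' h =>
        have : x < N ∧ x' < N := h.elim (hS.lEq _ _ _) (hS.lNe _ _ _)
        exact iff_of_true this.1 this.2
      | refl => rfl
      | symm _ _ _ ih => exact ih.symm
      | trans _ _ _ _ _ ih1 ih2 => exact ih1.trans ih2
    classical
    -- The component of `y` is represented by `y` itself, since the branch at `y` is the one known
    -- to leave the value `a` possible there.
    let rep : ℕ → ℕ := fun x => if conn x y then y else (Quotient.mk conS x).out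
    have hrep : ∀ x, conn (rep x) x := by
      intro x
      by_cases hx : conn x y
      · simp only [rep, if_pos hx]; exact hx.symm
      · simp only [rep, if_neg hx]; exact Quotient.exact (s := conS) (Quotient.out_eq _)
    have hrep_eq : ∀ x x', conn x x' → rep x = rep x' := by
      intro x x' hx
      have h1 : conn x y ↔ conn x' y := ⟨hx.symm.trans _ _ _, hx.trans _ _ _⟩
      have h2 : Quotient.mk conS x = Quotient.mk conS x' := Quotient.sound hx
      simp only [rep, h1, h2]
    have hrepy : rep y = y := if_pos (Relation.EqvGen.refl y)
    -- There may be more components than branching variables, so each representative gets its own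
    -- branch, with all `m` variables equal to it. No equality or disequality between variables
    -- links two components, so values from different branches can be combined.
    have hβ : ∀ x, ∃ β, x < N → ¬ inn β a C y (fun _ : Fin m => x) := by
      intro x
      by_cases hx : x < N
      · obtain ⟨β, hb⟩ := h (fun _ => x) fun _ => hx
        exact ⟨β, fun _ => hb⟩
      · exact ⟨fun _ => a, fun h => absurd h hx⟩
    choose β hβ using hβ
    let F : ℕ → ℕ → Set A := fun r x => E (fun _ => r) (β r) x
    have hFne : ∀ r < N, ∀ x < N, (F r x).Nonempty := fun r hr =>
      hne _ _ (fun _ => hr) (hβ r hr)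
    have htwo : ∀ b c d : A, b ≠ c → b ≠ d → c = d := by
      intro b c d h1 h2
      by_contra h3
      have hc : ({b, c, d} : Set A).ncard = 3 := by
        rw [Set.ncard_eq_three]; exact ⟨b, c, d, h1, h2, h3, rfl⟩
      have := Set.ncard_le_card ({b, c, d} : Set A)
      omega
    -- The representative has only its guessed value left. Over at most two values, a single value
    -- left at one end of a disequality leaves at most one at the other end, so this spreads through
    -- the component.
    have hsub : ∀ r < N, ∀ x, conn r x → (F r x).Subsingleton := by
      intro r hr x hx
      have hstep : ∀ x x', (S.lEq C x x' ∨ S.lNe C x x') →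
          ((F r x).Subsingleton ↔ (F r x').Subsingleton) := by
        rintro x x' (h1 | h1)
        · rw [show F r x = F r x' from heq _ _ (fun _ => hr) _ _ h1]
        · have hb := hS.lNe _ _ _ h1
          constructor
          · intro hs b hb' c hc'
            obtain ⟨d, hd⟩ := hFne r hr x hb.1
            have := hneV _ _ (fun _ => hr) x x' (.inl h1) d fun b' hb' => hs hb' hd
            exact htwo d b c (fun h => this (h ▸ hb')) (fun h => this (h ▸ hc'))
          · intro hs b hb' c hc'
            obtain ⟨d, hd⟩ := hFne r hr x' hb.2
            have := hneV _ _ (fun _ => hr) x' x (.inr h1) d fun b' hb' => hs hb' hd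
            exact htwo d b c (fun h => this (h ▸ hb')) (fun h => this (h ▸ hc'))
      have hall : ∀ x x', conn x x' → ((F r x).Subsingleton ↔ (F r x').Subsingleton) := by
        intro x x' hx
        induction hx with
        | rel x x' h => exact hstep x x' h
        | refl => rfl
        | symm _ _ _ ih => exact ih.symm
        | trans _ _ _ _ _ ih1 ih2 => exact ih1.trans ih2
      rw [← hall r x hx]
      intro b hb c hc
      rw [hass _ _ (fun _ => hr) ⟨0, hm⟩ b hb, hass _ _ (fun _ => hr) ⟨0, hm⟩ c hc]
    have hrepN : ∀ x < N, rep x < N := fun x hx => (hconnN _ _ (hrep x)).2 hx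
    have hmem : ∀ x < N, pick a (F (rep x) x) ∈ F (rep x) x := fun x hx =>
      pick_mem (hFne _ (hrepN x hx) x hx)
    refine ⟨fun x => pick a (F (rep x) x), fun x hx => ?_, ⟨?_, ?_, ?_, ?_⟩, ?_⟩
    · exact hout _ _ (fun _ => hrepN x hx) x hx _ (hmem x hx)
    · intro x x' hx
      have hb := hS.lEq _ _ _ hx
      have hr : rep x = rep x' := hrep_eq _ _ (.rel _ _ (.inl hx))
      have : F (rep x) x = F (rep x) x' := heq _ _ (fun _ => hrepN x hb.1) _ _ hx
      simp only [← hr, this]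
    · intro x x' hx
      have hb := hS.lNe _ _ _ hx
      have hr : rep x = rep x' := hrep_eq _ _ (.rel _ _ (.inr hx))
      have h1 := hneV _ _ (fun _ => hrepN x hb.1) x x' (.inl hx) (pick a (F (rep x) x))
        fun b' hb' => hsub _ (hrepN x hb.1) x (hrep x) hb' (hmem x hb.1)
      intro heq'
      have h2 := hmem x' hb.2
      rw [← hr] at h2
      simp only [← hr] at heq'
      rw [← heq'] at h2
      exact h1 h2
    · intro x b hx
      have hb := hS.lEqC _ _ _ hx
      exact heqC _ _ (fun _ => hrepN x hb) x b hx _ (hmem x hb)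
    · intro x b hx
      have hb := hS.lNeC _ _ _ hx
      rintro rfl
      exact hneC _ _ (fun _ => hrepN x hb) x _ hx (hmem x hb)
    · refine pick_eq ?_
      rw [hrepy]
      exact hβ y hy
  -- With the first variable of every disequality guessed, a single branch serves the whole
  -- disjunct: that variable has only its guessed value left, and propagation removes this value
  -- from the other side.
  · obtain ⟨β, hβ⟩ := h w hw
    have hmem : ∀ x < N, pick a (E w β x) ∈ E w β x := fun x hx => pick_mem (hne w β hw hβ x hx)
    refine ⟨fun x => pick a (E w β x), fun x hx => hout w β hw x hx _ (hmem x hx),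
      ⟨?_, ?_, ?_, ?_⟩, pick_eq hβ⟩
    · intro x x' hx
      simp only [heq w β hw _ _ hx]
    · intro x x' hx heq'
      have hb := hS.lNe _ _ _ hx
      obtain ⟨j, rfl⟩ := hcov _ _ hx
      refine hneV w β hw _ x' (.inl hx) (β j) (hass w β hw j) ?_
      rw [← hass w β hw j _ (hmem _ hb.1)]
      change pick a (E w β (w j)) = pick a (E w β x') at heq'
      rw [heq']
      exact hmem _ hb.2
    · intro x b hx
      exact heqC w β hw x b hx _ (hmem x (hS.lEqC _ _ _ hx))
    · intro x b hx
      rintro rfl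
      exact hneC w β hw x _ hx (hmem x (hS.lNeC _ _ _ hx))

/-- The derived facts contain every exclusion that follows from one atom together with the
exclusions already known. This is the form in which completeness of propagation is used. -/
theorem out_of_forall_holds [Finite A] {N : ℕ} {un out : A → ℕ → Prop}
    {inn : (Fin m → A) → A → ℕ → ℕ → (Fin m → ℕ) → Prop} (hS : S.BoundedBy N)
    (hcl : S.Closed N un out inn) (hm : 0 < m) {p y : ℕ} {a : A} (hp : p < N) (hrel : S.rel p)
    (hy : y < N) (hbr : ∀ C, S.dj p C → S.Branching N m C)
    (h : ∀ t : ℕ → A, (∀ x < N, ¬ out (t x) x) → S.Holds p t → t y ≠ a) : out a y := by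
  refine hcl.closed_out a y hy (.inr (.inr ⟨p, hp, hrel, fun C hC hdj => ?_⟩))
  by_contra hw
  push Not at hw
  obtain ⟨t, h1, h2, h3⟩ := exists_litsHold_of_not_inn hS hcl hm hC hy (hbr C hdj) hw
  exact h t h1 ⟨C, hdj, h2⟩ h3

end Sys


/-- Iterates the replacement of one coordinate over a finite set of coordinates. -/
theorem ExTrivial.piecewise {A : Type} {c : A} {k : ℕ} {R : Set (Fin k → A)} (hR : ExTrivial c R)
    {t t' : Fin k → A} (ht : t ∈ R) (h : ∀ i, t' i = t i ∨ t' i = c) : t' ∈ R := by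
  classical
  have key : ∀ J : Finset (Fin k), (fun i => if i ∈ J then t' i else t i) ∈ R := by
    intro J
    induction J using Finset.induction_on with
    | empty => simpa using ht
    | insert j J hj ih =>
      rcases h j with h | h
      · convert ih using 2 with i
        by_cases hi : i = j
        · subst hi; simp [hj, h]
        · simp [hi]
      · convert hR _ ih j using 1
        funext i
        by_cases hi : i = j
        · subst hi; simp [h]
        · simp [hi]
  simpa using key Finset.univ

/-! ### Structures that represent a sentence. -/

namespace Sys

variable {A : Type} {S : Sys A} {m : ℕ}

/-- The literals at `C` are those of the disjunct `c` with the variables `args`. -/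
structure DescC (S : Sys A) {n k : ℕ} (C : ℕ) (args : Fin k → Fin n) (c : List (Literal A k)) :
    Prop where
  eq : ∀ y y', S.lEq C y y' ↔ ∃ i j, Literal.eqVar i j ∈ c ∧ (args i : ℕ) = y ∧ (args j : ℕ) = y'
  ne : ∀ y y', S.lNe C y y' ↔ ∃ i j, Literal.neVar i j ∈ c ∧ (args i : ℕ) = y ∧ (args j : ℕ) = y'
  eqC : ∀ y a, S.lEqC C y a ↔ ∃ i, Literal.eqConst i a ∈ c ∧ (args i : ℕ) = y
  neC : ∀ y a, S.lNeC C y a ↔ ∃ i, Literal.neConst i a ∈ c ∧ (args i : ℕ) = y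

/-- The disjuncts of `p` are those of the formula `D` with the variables `args`. -/
structure Desc (S : Sys A) {n k : ℕ} (p : ℕ) (args : Fin k → Fin n) (D : DNF A k) : Prop where
  of_dj : ∀ C, S.dj p C → ∃ c ∈ D, S.DescC C args c
  dj_of : ∀ c ∈ D, ∃ C, S.dj p C ∧ S.DescC C args c

/-- The structure `S` represents the sentence `φ`. -/
structure Represents (S : Sys A) (φ : Sentence A) (N : ℕ) : Prop where
  n_le : φ.n ≤ N
  bounded : S.BoundedBy N
  uni : ∀ y, S.uni y ↔ ∃ h : y < φ.n, φ.univ ⟨y, h⟩ = true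
  eqA : ∀ y y', S.eqA y y' ↔ ∃ i j, Atom.eq i j ∈ φ.atoms ∧ (i : ℕ) = y ∧ (j : ℕ) = y'
  of_rel : ∀ p, S.rel p → ∃ (k : ℕ) (args : Fin k → Fin φ.n) (D : DNF A k),
    Atom.rel k args D ∈ φ.atoms ∧ S.Desc p args D
  rel_of : ∀ (k : ℕ) (args : Fin k → Fin φ.n) (D : DNF A k), Atom.rel k args D ∈ φ.atoms →
    ∃ p, p < N ∧ S.rel p ∧ S.Desc p args D

theorem DescC.litsHold_iff {n k C : ℕ} {args : Fin k → Fin n} {c : List (Literal A k)}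
    (h : S.DescC C args c) (t : ℕ → A) :
    S.LitsHold C t ↔ ∀ l ∈ c, l.Holds fun i => t (args i) := by
  constructor
  · rintro h' (⟨i, j⟩ | ⟨i, j⟩ | ⟨i, a⟩ | ⟨i, a⟩) hl
    · exact h'.eq _ _ ((h.eq _ _).2 ⟨i, j, hl, rfl, rfl⟩)
    · exact h'.ne _ _ ((h.ne _ _).2 ⟨i, j, hl, rfl, rfl⟩)
    · exact h'.eqC _ _ ((h.eqC _ _).2 ⟨i, hl, rfl⟩)
    · exact h'.neC _ _ ((h.neC _ _).2 ⟨i, hl, rfl⟩)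
  · intro h'
    constructor
    · intro y y' hy
      obtain ⟨i, j, hl, rfl, rfl⟩ := (h.eq _ _).1 hy
      exact h' _ hl
    · intro y y' hy
      obtain ⟨i, j, hl, rfl, rfl⟩ := (h.ne _ _).1 hy
      exact h' _ hl
    · intro y a hy
      obtain ⟨i, hl, rfl⟩ := (h.eqC _ _).1 hy
      exact h' _ hl
    · intro y a hy
      obtain ⟨i, hl, rfl⟩ := (h.neC _ _).1 hy
      exact h' _ hl

theorem Desc.holds_iff {n k p : ℕ} {args : Fin k → Fin n} {D : DNF A k}
    (h : S.Desc p args D) (t : ℕ → A) : S.Holds p t ↔ (fun i => t (args i)) ∈ D.rel := by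
  constructor
  · rintro ⟨C, hC, hl⟩
    obtain ⟨c, hc, hd⟩ := h.of_dj C hC
    exact ⟨c, hc, (hd.litsHold_iff t).1 hl⟩
  · rintro ⟨c, hc, hl⟩
    obtain ⟨C, hC, hd⟩ := h.dj_of c hc
    exact ⟨C, hC, (hd.litsHold_iff t).2 hl⟩

/-- The branching variables are the first variables of the at most `r` disequalities. The list is
padded with position `0`, which is why `0 < N` is needed. -/
theorem DescC.branching {n k C N r : ℕ} {args : Fin k → Fin n} {c : List (Literal A k)}
    (h : S.DescC C args c) (hN : n ≤ N) (hN0 : 0 < N) (hr : r ≤ m)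
    (hc : 3 ≤ Nat.card A → c.countP Literal.isNeVar ≤ r) : S.Branching N m C := by
  by_cases hA : Nat.card A ≤ 2
  · exact .inl hA
  right
  let first : Literal A k → ℕ := fun
    | .neVar i _ => args i
    | _ => 0
  let L : List ℕ := (c.filter Literal.isNeVar).map first
  have hfirst : ∀ l, first l < N := by
    rintro (⟨i, j⟩ | ⟨i, j⟩ | ⟨i, a⟩ | ⟨i, a⟩)
    · exact hN0
    · exact (args i).2.trans_le hN
    · exact hN0
    · exact hN0
  have hL : L.length ≤ m := by
    simp only [L, List.length_map, ← List.countP_eq_length_filter]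
    exact (hc (by omega)).trans hr
  refine ⟨fun j => L.getD j 0, fun j => ?_, fun y y' hy => ?_⟩
  · change L.getD (j : ℕ) 0 < N
    rw [List.getD_eq_getElem?_getD]
    cases hj : L[(j : ℕ)]? with
    | none => exact hN0
    | some x =>
      obtain ⟨l, -, rfl⟩ := List.mem_map.1 (List.mem_of_getElem? hj)
      exact hfirst l
  · obtain ⟨i, j, hl, rfl, rfl⟩ := (h.ne _ _).1 hy
    have hmem : (args i : ℕ) ∈ L :=
      List.mem_map.2 ⟨.neVar i j, List.mem_filter.2 ⟨hl, rfl⟩, rfl⟩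
    obtain ⟨q, hq, hq'⟩ := List.mem_iff_getElem.1 hmem
    refine ⟨⟨q, hq.trans_le hL⟩, ?_⟩
    simp [hq, hq']

/-! ### Soundness -/

/-- A winning strategy, extended arbitrarily to positions that are not variables. Such positions get
a constant value, so the dependence condition holds for all positions. -/
theorem Represents.exists_sols [Nonempty A] {φ : Sentence A} {N : ℕ} (h : S.Represents φ N)
    (hφ : φ.IsTrue) : ∃ t : (ℕ → A) → ℕ → A, (∀ u, S.Sol u (t u)) ∧
      ∀ u u' y, (∀ x ≤ y, S.uni x → u x = u' x) → t u y = t u' y := by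
  obtain ⟨σ, h1, h2, h3⟩ := (quantTrue_iff_exists_strategy _ _).1 hφ
  obtain ⟨d⟩ := ‹Nonempty A›
  let t : (ℕ → A) → ℕ → A := fun u y => if hy : y < φ.n then σ (fun i => u i) ⟨y, hy⟩ else d
  have ht : ∀ u (i : Fin φ.n), t u i = σ (fun i => u i) i := fun u i => dif_pos i.2
  refine ⟨t, fun u => ⟨fun y hy => ?_, fun y y' hy => ?_, fun p hp => ?_⟩, fun u u' y hy => ?_⟩
  · obtain ⟨hy, hq⟩ := (h.uni y).1 hy
    exact (ht u ⟨y, hy⟩).trans (h1 _ _ hq)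
  · obtain ⟨i, j, ha, rfl, rfl⟩ := (h.eqA _ _).1 hy
    rw [ht, ht]
    exact h3 _ _ ha
  · obtain ⟨k, args, D, ha, hd⟩ := h.of_rel p hp
    rw [hd.holds_iff]
    simp only [ht]
    exact h3 _ _ ha
  · by_cases hn : y < φ.n
    · simp only [t, dif_pos hn]
      exact h2 _ _ _ fun j hj hq => hy _ hj ((h.uni _).2 ⟨j.2, hq⟩)
    · simp only [t, dif_neg hn]

/-! ### Completeness -/

/-- If the values left for agreeing `u` and `u'` always meet, a winning strategy can be read off.
The hypothesis with `u = u'` also says that some value is always left. -/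
theorem Represents.isTrue [Finite A] {φ : Sentence A} {N : ℕ} (h : S.Represents φ N) {c : A}
    (hm : 0 < m)
    (hc : ∀ (k : ℕ) (args : Fin k → Fin φ.n) (D : DNF A k), Atom.rel k args D ∈ φ.atoms →
      AlmostExTrivial c D.rel)
    (hbr : ∀ p C, S.rel p → S.dj p C → S.Branching N m C)
    (out : (ℕ → A) → A → ℕ → Prop)
    (inn : (ℕ → A) → (Fin m → A) → A → ℕ → ℕ → (Fin m → ℕ) → Prop)
    (hcl : ∀ u, S.Closed N (fun a y => y < N ∧ a = u y) (out u) (inn u))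
    (hout : ∀ u u' y, y < N → (∀ x ≤ y, S.uni x → u x = u' x) → ∃ a, ¬ out u a y ∧ ¬ out u' a y) :
    φ.IsTrue := by
  classical
  let D : (ℕ → A) → ℕ → Set A := fun u y => {a | ¬ out u a y}
  have hne : ∀ u, ∀ y < N, (D u y).Nonempty := by
    intro u y hy
    obtain ⟨a, ha, -⟩ := hout u u y hy fun _ _ _ => rfl
    exact ⟨a, ha⟩
  -- Being forced is required under all `u` at once; otherwise the choice between the forced value
  -- and `c` could itself depend on later universal variables.
  let Forced : ℕ → Prop := fun y => ∀ u, (D u y).Subsingleton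
  let t : (ℕ → A) → ℕ → A := fun u y => if Forced y then pick c (D u y) else c
  have hcongr : ∀ y y', (∀ u, D u y = D u y') → ∀ u, t u y = t u y' := by
    intro y y' hD u
    simp only [t, Forced, hD]
  have hforced : ∀ y < N, ∀ u a, (∀ u, ∃ a, ∀ b ∈ D u y, b = a) → (∀ b ∈ D u y, b = a) →
      t u y = a := by
    intro y hy u a hf ha
    have : Forced y := fun u b hb b' hb' => by
      obtain ⟨a, ha⟩ := hf u
      rw [ha b hb, ha b' hb']
    simp only [t, if_pos this]
    exact ha _ (pick_mem (hne u y hy))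
  have hext : ∃ ext : (Fin φ.n → A) → ℕ → A, ∀ u (i : Fin φ.n), ext u i = u i :=
    ⟨fun u y => if hy : y < φ.n then u ⟨y, hy⟩ else c, fun u i => dif_pos i.2⟩
  obtain ⟨ext, hext⟩ := hext
  have : Nonempty A := ⟨c⟩
  rw [Sentence.IsTrue, quantTrue_iff_exists_strategy]
  refine ⟨fun u i => t (ext u) i, fun u i hi => ?_, fun u u' i hi => ?_, fun u => ?_⟩
  · have hiN : (i : ℕ) < N := i.2.trans_le h.n_le
    have hD : ∀ u, ∀ b ∈ D u i, b = u i := by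
      intro u b hb
      by_contra hne
      exact hb ((hcl u).closed_out _ _ hiN
        (.inl ⟨(h.uni _).2 ⟨i.2, hi⟩, u i, fun h => hne h.symm, hiN, rfl⟩))
    rw [← hext u i]
    exact hforced _ hiN _ _ (fun u => ⟨_, hD u⟩) (hD _)
  -- For a forced variable both sets have at most one element and share one, so the two picks
  -- coincide.
  · simp only [t]
    split_ifs with hf
    · obtain ⟨a, ha, ha'⟩ := hout (ext u) (ext u') i (i.2.trans_le h.n_le) fun x hx hux => by
        obtain ⟨hxn, hq⟩ := (h.uni x).1 hux
        exact (hext u ⟨x, hxn⟩).trans ((hi ⟨x, hxn⟩ hx hq).trans (hext u' ⟨x, hxn⟩).symm)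
      rw [hf _ (pick_mem ⟨a, ha⟩) ha, hf _ (pick_mem ⟨a, ha'⟩) ha']
    · rfl
  · rintro (⟨i, j⟩ | ⟨k, args, F⟩) ha
    · have heq := (h.eqA i j).2 ⟨i, j, ha, rfl, rfl⟩
      refine hcongr _ _ (fun u => ?_) _
      ext b
      exact not_congr ⟨fun hb => (hcl u).closed_out _ _ (j.2.trans_le h.n_le)
          (.inr (.inl ⟨i, i.2.trans_le h.n_le, .inr heq, hb⟩)),
        fun hb => (hcl u).closed_out _ _ (i.2.trans_le h.n_le)
          (.inr (.inl ⟨j, j.2.trans_le h.n_le, .inl heq, hb⟩))⟩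
    · obtain ⟨p, hpN, hp, hd⟩ := h.rel_of k args F ha
      obtain ⟨P, Q, T, hT, hF⟩ := hc k args F ha
      have hinf : ∀ u, ∀ y < N, ∀ a, (∀ t : ℕ → A, (∀ x < N, t x ∈ D u x) →
          (fun i => t (args i)) ∈ F.rel → t y ≠ a) → out u a y := by
        intro u y hy a hy'
        exact out_of_forall_holds h.bounded (hcl u) hm hpN hp hy (fun C hC => hbr p C hp hC)
          fun t ht hpt => hy' t ht ((hd.holds_iff t).1 hpt)
      have hargs : ∀ i, (args i : ℕ) < N := fun i => (args i).2.trans_le h.n_le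
      change (fun i => t (ext u) (args i)) ∈ F.rel
      obtain ⟨t', ht', ht'F⟩ : ∃ t' : ℕ → A, (∀ x < N, t' x ∈ D (ext u) x) ∧
          (fun i => t' (args i)) ∈ F.rel := by
        -- If no tuple of the relation used only remaining values, everything would be excluded
        -- everywhere. The position `p` serves merely as some position below `N`.
        obtain ⟨b, hb⟩ := hne (ext u) p hpN
        by_contra hno
        push Not at hno
        exact hb (hinf _ _ hpN _ fun t ht hpt => absurd hpt (hno t ht))
      rw [hF]
      refine ⟨fun q hq => ?_, fun q hq => ?_, hT.piecewise ((hF _).1 ht'F).2.2 fun i => ?_⟩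
      · have hD : ∀ u, ∀ b ∈ D u (args q.1), b = q.2 := by
          intro u b hb
          by_contra hne
          refine hb (hinf _ _ (hargs _) _ fun t ht hpt => ?_)
          rw [((hF _).1 hpt).1 q hq]
          exact fun h => hne h.symm
        exact hforced _ (hargs _) _ _ (fun u => ⟨_, hD u⟩) (hD _)
      · refine hcongr _ _ (fun u => ?_) _
        ext b
        refine not_congr ⟨fun hb => hinf _ _ (hargs _) _ fun t ht hpt => ?_,
          fun hb => hinf _ _ (hargs _) _ fun t ht hpt => ?_⟩
        · rw [← ((hF _).1 hpt).2.1 q hq]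
          rintro rfl
          exact ht _ (hargs _) hb
        · rw [((hF _).1 hpt).2.1 q hq]
          rintro rfl
          exact ht _ (hargs _) hb
      -- At a forced variable the tuple agrees with `t'`, since one value is left; elsewhere it has
      -- the canon.
      · simp only [t]
        split_ifs with hf
        · exact .inl (hf _ (pick_mem (hne _ _ (hargs i))) (ht' _ (hargs i)))
        · exact .inr rfl

end Sys


/-! ### Saturated derivations and the records of a certificate. -/

/-- A set of facts has an exhaustive derivation without repetitions. -/
theorem exists_saturated_list {X : Type*} (F : Finset X) (J : (X → Prop) → X → Prop) :
    ∃ l : List X, l.Nodup ∧ (∀ f ∈ l, f ∈ F) ∧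
      (∀ l₁ f l₂, l = l₁ ++ f :: l₂ → J (· ∈ l₁) f) ∧ ∀ f ∈ F, J (· ∈ l) f → f ∈ l := by
  classical
  have key : ∀ (d : ℕ) (l : List X), F.card - l.length = d → l.Nodup → (∀ f ∈ l, f ∈ F) →
      (∀ l₁ f l₂, l = l₁ ++ f :: l₂ → J (· ∈ l₁) f) → ∃ l : List X, l.Nodup ∧ (∀ f ∈ l, f ∈ F) ∧
      (∀ l₁ f l₂, l = l₁ ++ f :: l₂ → J (· ∈ l₁) f) ∧ ∀ f ∈ F, J (· ∈ l) f → f ∈ l := by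
    intro d
    induction d using Nat.strong_induction_on with
    | _ d ih =>
      intro l hd h1 h2 h3
      by_cases hl : ∀ f ∈ F, J (· ∈ l) f → f ∈ l
      · exact ⟨l, h1, h2, h3, hl⟩
      push Not at hl
      obtain ⟨f, hf, hJ, hfl⟩ := hl
      have h1' : (l ++ [f]).Nodup := by
        rw [List.nodup_append]
        refine ⟨h1, List.nodup_singleton _, fun a ha b hb => ?_⟩
        rw [List.mem_singleton] at hb
        rintro rfl
        exact hfl (hb ▸ ha)
      have h2' : ∀ g ∈ l ++ [f], g ∈ F := by
        intro g hg
        rcases List.mem_append.1 hg with h | h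
        · exact h2 g h
        · rw [List.mem_singleton.1 h]; exact hf
      have hcard : (l ++ [f]).length ≤ F.card := by
        rw [← List.toFinset_card_of_nodup h1']
        exact Finset.card_le_card fun g hg => h2' g (List.mem_toFinset.1 hg)
      refine ih _ ?_ (l ++ [f]) rfl h1' h2' fun l₁ g l₂ h => ?_
      · simp only [List.length_append, List.length_singleton] at hcard ⊢
        omega
      · rcases List.eq_nil_or_concat l₂ with rfl | ⟨l₂, x, rfl⟩
        · obtain ⟨rfl, h⟩ := List.append_inj' h rfl
          obtain rfl : f = g := by simpa using h
          exact hJ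
        · rw [List.concat_eq_append, ← List.cons_append, ← List.append_assoc] at h
          exact h3 _ _ _ (List.append_inj' h rfl).1
  exact key _ [] rfl List.nodup_nil (by simp) (by simp)

/-- The kinds of facts, in each of two copies: a value of a universal variable; an impossible
value of a variable; an impossible value of a variable in a disjunct, under the assumption of the
values of `m` variables. -/
inductive Tag (A : Type) (m : ℕ) : Type
  | un (s : Bool) (a : A) : Tag A m
  | out (s : Bool) (a : A) : Tag A m
  | inn (s : Bool) (β : Fin m → A) (a : A) : Tag A m

instance {A : Type} {m : ℕ} [Finite A] : Finite (Tag A m) := by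
  refine Finite.of_injective (β := (Bool × A) ⊕ (Bool × A) ⊕ (Bool × (Fin m → A) × A)) (fun
    | .un s a => .inl (s, a)
    | .out s a => .inr (.inl (s, a))
    | .inn s β a => .inr (.inr (s, β, a))) ?_
  rintro (⟨s, a⟩ | ⟨s, a⟩ | ⟨s, β, a⟩) (⟨s', a'⟩ | ⟨s', a'⟩ | ⟨s', β', a'⟩) h <;> simp_all

/-- This and the next lemma decide in which half of a concatenation an occurrence lies, given that
the letter does not occur in the other half. -/
theorem eq_append_of_append_eq_left {X : Type*} {l₁ l₂ B C : List X} {x : X}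
    (h : l₁ ++ x :: l₂ = B ++ C) (hx : x ∉ B) : ∃ k, l₁ = B ++ k ∧ C = k ++ x :: l₂ := by
  rcases List.append_eq_append_iff.1 h with ⟨k, rfl, h'⟩ | ⟨k, rfl, h'⟩
  · cases k with
    | nil => exact ⟨[], by simp, by simpa using h'.symm⟩
    | cons y k =>
      obtain ⟨rfl, -⟩ := List.cons.inj h'
      simp at hx
  · exact ⟨k, rfl, h'⟩

theorem eq_append_of_append_eq_right {X : Type*} {l₁ l₂ B C : List X} {x : X}
    (h : l₁ ++ x :: l₂ = B ++ C) (hx : x ∉ C) : ∃ k, B = l₁ ++ x :: k := by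
  rcases List.append_eq_append_iff.1 h with ⟨k, rfl, h'⟩ | ⟨k, rfl, h'⟩
  · cases k with
    | nil => simp at h'; simp [← h'] at hx
    | cons y k =>
      obtain ⟨rfl, -⟩ := List.cons.inj h'
      exact ⟨k, rfl⟩
  · simp [h'] at hx

namespace Sys

variable {A : Type} {S : Sys A} {m : ℕ}

/-- There is a record before `p`. -/
def Before (Rec : ℕ → Tag A m → List ℕ → Prop) (M p : ℕ) (τ : Tag A m) (is : List ℕ) : Prop :=
  ∃ q, q < M ∧ q < p ∧ Rec q τ is

/-- The records form a derivation that shows that the sentence is false; `Rec p τ is` says that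
the record at `p` has the tag `τ` and the indices `is`. -/
def Refutes (S : Sys A) (M : ℕ) (Rec : ℕ → Tag A m → List ℕ → Prop) : Prop :=
  (∀ s a b, a ≠ b → ∀ p, p < M → ∀ q, q < M → ∀ y, y < M →
    ¬ (Rec p (.un s a) [y] ∧ Rec q (.un s b) [y])) ∧
  (∀ s a p, p < M → ∀ y, y < M → Rec p (.out s a) [y] →
    S.JustOut M (fun b x => Before Rec M p (.un s b) [x]) (fun b x => Before Rec M p (.out s b) [x])
      (fun β b C x w => Before Rec M p (.inn s β b) (C :: x :: List.ofFn w)) a y) ∧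
  (∀ s β a p, p < M → ∀ C, C < M → ∀ y, y < M → ∀ w : Fin m → ℕ, (∀ j, w j < M) →
    Rec p (.inn s β a) (C :: y :: List.ofFn w) →
    S.JustInn M (fun b x => Before Rec M p (.out s b) [x])
      (fun β b C x w => Before Rec M p (.inn s β b) (C :: x :: List.ofFn w)) β a C y w) ∧
  ∃ y, y < M ∧ (∀ x, x < M → x ≤ y → S.uni x →
      ∃ a, (∃ p, p < M ∧ Rec p (.un false a) [x]) ∧ ∃ p, p < M ∧ Rec p (.un true a) [x]) ∧
    ∀ a, ∃ s p, p < M ∧ Rec p (.out s a) [y]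

/-- The certificate is not assumed to come from actual assignments: its value records are
functional, hence extend to assignments `u false` and `u true`, and justification by strictly
earlier records rules out circular derivations. -/
theorem Refutes.not_isTrue [Nonempty A] {φ : Sentence A} {N M : ℕ} (h : S.Represents φ N)
    (hNM : N ≤ M) {Rec : ℕ → Tag A m → List ℕ → Prop}
    (hRec : ∀ p τ is, Rec p τ is → p < M ∧ ∀ i ∈ is, i < M) (hR : S.Refutes M Rec) :
    ¬ φ.IsTrue := by
  classical
  intro hφ
  obtain ⟨t, ht, htt⟩ := h.exists_sols hφ
  obtain ⟨hfun, hout, hinn, y, hy, huni, hall⟩ := hR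
  have hu : ∀ s x, ∃ b, ∀ a p, Rec p (.un s a) [x] → b = a := by
    intro s x
    by_cases hx : ∃ b p, Rec p (.un s b) [x]
    · obtain ⟨b, p, hb⟩ := hx
      refine ⟨b, fun a q ha => ?_⟩
      by_contra hne
      exact hfun s b a hne p (hRec _ _ _ hb).1 q (hRec _ _ _ ha).1 x ((hRec _ _ _ hb).2 x (by simp))
        ⟨hb, ha⟩
    · exact ⟨Classical.arbitrary A, fun a p ha => absurd ⟨a, p, ha⟩ hx⟩
  choose u hu using hu
  -- Induction on the position of the record: every recorded exclusion is true of the strategy's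
  -- solution for its copy.
  have key : ∀ p s, (∀ a y, Rec p (.out s a) [y] → t (u s) y ≠ a) ∧
      ∀ β a C y (w : Fin m → ℕ), Rec p (.inn s β a) (C :: y :: List.ofFn w) →
        S.LitsHold C (t (u s)) → (∀ j, t (u s) (w j) = β j) → t (u s) y ≠ a := by
    intro p
    induction p using Nat.strong_induction_on with
    | _ p ih =>
      intro s
      have ho : ∀ b x, Before Rec M p (.out s b) [x] → t (u s) x ≠ b := by
        rintro b x ⟨q, -, hq, hr⟩
        exact (ih q hq s).1 _ _ hr
      have hi : ∀ β b C x (w : Fin m → ℕ), Before Rec M p (.inn s β b) (C :: x :: List.ofFn w) →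
          S.LitsHold C (t (u s)) → (∀ j, t (u s) (w j) = β j) → t (u s) x ≠ b := by
        rintro β b C x w ⟨q, -, hq, hr⟩
        exact (ih q hq s).2 _ _ _ _ _ hr
      refine ⟨fun a y hr => ?_, fun β a C y w hr => ?_⟩
      · have hb := hRec _ _ _ hr
        refine (hout s a p hb.1 y (hb.2 y (by simp)) hr).sound (ht _)
          (fun p C hC => (h.bounded.dj p C hC).trans_le hNM) ?_ ho hi
        rintro b x ⟨q, -, -, hr⟩
        exact hu s x b q hr
      · have hb := hRec _ _ _ hr
        exact (hinn s β a p hb.1 C (hb.2 C (by simp)) y (hb.2 y (by simp)) w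
          (fun j => hb.2 _ (by simp [List.mem_ofFn])) hr).sound ho hi
  obtain ⟨s, p, -, hr⟩ := hall (t (u false) y)
  -- The value records up to `y` are common to both copies, so the strategy gives `y` one value; yet
  -- one of the copies excludes it.
  have heq : t (u false) y = t (u true) y := by
    refine htt _ _ y fun x hx hux => ?_
    obtain ⟨a, ⟨p, -, h1⟩, q, -, h2⟩ := huni x (hx.trans_lt hy) hx hux
    rw [hu _ _ _ _ h1, hu _ _ _ _ h2]
  cases s with
  | false => exact (key p false).1 _ _ hr rfl
  | true => exact (key p true).1 _ _ hr heq.symm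

/-! ### Derivations -/

/-- The derived facts, for a fixed assignment of the universal variables. -/
abbrev Fact (A : Type) (m : ℕ) : Type :=
  (A × ℕ) ⊕ ((Fin m → A) × A × ℕ × ℕ × (Fin m → ℕ))

/-- The record of a fact in the copy `s`. -/
def Fact.record (s : Bool) : Fact A m → Tag A m × List ℕ
  | .inl (a, y) => (.out s a, [y])
  | .inr (β, a, C, y, w) => (.inn s β a, C :: y :: List.ofFn w)

theorem Fact.record_injective (s : Bool) : Function.Injective (Fact.record (A := A) (m := m) s) := by
  rintro (⟨a, y⟩ | ⟨β, a, C, y, w⟩) (⟨a', y'⟩ | ⟨β', a', C', y', w'⟩) h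
  · simp_all [Fact.record]
  · simp [Fact.record] at h
  · simp [Fact.record] at h
  · simp only [Fact.record, Prod.mk.injEq, Tag.inn.injEq, List.cons.injEq, List.ofFn_inj] at h
    simp_all

variable (S) in
/-- The fact is justified by known facts. -/
def Justified (N : ℕ) (u : ℕ → A) (known : Fact A m → Prop) : Fact A m → Prop
  | .inl (a, y) => S.JustOut N (fun b x => x < N ∧ b = u x) (fun b x => known (.inl (b, x)))
      (fun β b C x w => known (.inr (β, b, C, x, w))) a y
  | .inr (β, a, C, y, w) => S.JustInn N (fun b x => known (.inl (b, x)))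
      (fun β b C x w => known (.inr (β, b, C, x, w))) β a C y w

open Classical in
/-- The facts about positions smaller than `N`. -/
noncomputable def boundedFacts (A : Type) [Fintype A] (m N : ℕ) : Finset (Fact A m) :=
  (Finset.univ ×ˢ Finset.range N).disjSum (Finset.univ ×ˢ Finset.univ ×ˢ Finset.range N ×ˢ
    Finset.range N ×ˢ Fintype.piFinset fun _ => Finset.range N)

theorem card_boundedFacts [Fintype A] (m N : ℕ) : (boundedFacts A m N).card =
    Fintype.card A * N + Fintype.card A ^ m * (Fintype.card A * (N * (N * N ^ m))) := by
  simp [boundedFacts]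

/-- The records of the values of `u`. -/
def unRecords (s : Bool) (N : ℕ) (u : ℕ → A) : List (Tag A m × List ℕ) :=
  (List.range N).map fun y => (.un s (u y), [y])

/-- The certificate for two assignments of the universal variables with derivations. -/
def certificate (N : ℕ) (u u' : ℕ → A) (l l' : List (Fact A m)) : List (Tag A m × List ℕ) :=
  (unRecords false N u ++ unRecords true N u') ++
    (l.map (Fact.record false) ++ l'.map (Fact.record true))

theorem mem_unRecords {s : Bool} {N : ℕ} {u : ℕ → A} {r : Tag A m × List ℕ} :
    r ∈ unRecords s N u ↔ ∃ y < N, r = (.un s (u y), [y]) := by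
  simp [unRecords, eq_comm]

/-- All value records come first, so they precede every record that may cite them; the two
derivations follow in order. Only the relative order of records matters, so their positions enter
through an arbitrary function `pos` that grows with the prefix. -/
theorem refutes_certificate {N M : ℕ} (hS : S.BoundedBy N) (hNM : N ≤ M) {u u' : ℕ → A}
    {l l' : List (Fact A m)}
    (hl : ∀ l₁ f l₂, l = l₁ ++ f :: l₂ → S.Justified N u (· ∈ l₁) f)
    (hl' : ∀ l₁ f l₂, l' = l₁ ++ f :: l₂ → S.Justified N u' (· ∈ l₁) f)
    {y : ℕ} (hy : y < N) (huu : ∀ x ≤ y, S.uni x → u x = u' x)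
    (hall : ∀ a, .inl (a, y) ∈ l ∨ .inl (a, y) ∈ l')
    {Rec : ℕ → Tag A m → List ℕ → Prop} (hRec : ∀ p τ is, Rec p τ is → p < M)
    (pos : List (Tag A m × List ℕ) → ℕ) (hpos : ∀ l₁ r l₂, pos l₁ < pos (l₁ ++ r :: l₂))
    (h : ∀ p τ is, Rec p τ is ↔ ∃ l₁ l₂, certificate N u u' l l' = l₁ ++ (τ, is) :: l₂ ∧
      p = pos l₁) : S.Refutes M Rec := by
  have hmem : ∀ τ is, (∃ p, p < M ∧ Rec p τ is) ↔ (τ, is) ∈ certificate N u u' l l' := by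
    intro τ is
    rw [List.mem_iff_append]
    constructor
    · rintro ⟨p, -, hp⟩
      obtain ⟨l₁, l₂, h1, -⟩ := (h _ _ _).1 hp
      exact ⟨l₁, l₂, h1⟩
    · rintro ⟨l₁, l₂, h1⟩
      have := (h _ _ _).2 ⟨l₁, l₂, h1, rfl⟩
      exact ⟨_, hRec _ _ _ this, this⟩
  have hbefore : ∀ l₁ l₂ r, certificate N u u' l l' = l₁ ++ l₂ → r ∈ l₁ →
      Before Rec M (pos l₁) r.1 r.2 := by
    intro l₁ l₂ r h1 hr
    obtain ⟨k₁, k₂, rfl⟩ := List.mem_iff_append.1 hr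
    have := (h _ r.1 r.2).2 ⟨k₁, k₂ ++ l₂, by simpa using h1, rfl⟩
    exact ⟨_, hRec _ _ _ this, hpos _ _ _, this⟩
  let U : Bool → ℕ → A := fun s => bif s then u' else u
  let L : Bool → List (Fact A m) := fun s => bif s then l' else l
  have hunmem : ∀ s a x, (Tag.un s a, [x]) ∈ certificate N u u' l l' ↔ x < N ∧ a = U s x := by
    intro s a x
    have hno : ∀ (s' : Bool) (k : List (Fact A m)),
        (Tag.un s a, [x]) ∉ k.map (Fact.record s') := by
      intro s' k hk
      obtain ⟨(⟨a, y⟩ | ⟨β, a, C, y, w⟩), -, hf⟩ := List.mem_map.1 hk <;> simp [Fact.record] at hf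
    cases s <;> simp only [certificate, List.mem_append, mem_unRecords, hno, or_false, U] <;>
      simp [eq_comm]
  -- The tag tells the copy, so a record of copy `s` can only lie in the block of that copy, and
  -- everything preceding it in its derivation precedes it in the certificate.
  have hsplit : ∀ s f l₁ l₂, certificate N u u' l l' = l₁ ++ Fact.record s f :: l₂ →
      ∃ k₀ k₁ k₂, L s = k₁ ++ f :: k₂ ∧ l₁ = unRecords false N u ++ unRecords true N u' ++
        (k₀ ++ k₁.map (Fact.record s)) := by
    intro s f l₁ l₂ h1
    have hun : Fact.record s f ∉ unRecords false N u ++ unRecords true N u' := by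
      rw [List.mem_append, mem_unRecords, mem_unRecords]
      rcases f with ⟨a, y⟩ | ⟨β, a, C, y, w⟩ <;> simp [Fact.record]
    obtain ⟨k, rfl, hk⟩ := eq_append_of_append_eq_left h1.symm hun
    have hother : ∀ k : List (Fact A m), Fact.record s f ∉ k.map (Fact.record !s) := by
      intro k hk
      obtain ⟨g, -, hg⟩ := List.mem_map.1 hk
      rcases f with ⟨a, y⟩ | ⟨β, a, C, y, w⟩ <;> rcases g with ⟨a, y⟩ | ⟨β, a, C, y, w⟩ <;>
        simp [Fact.record] at hg
    have hmap : ∀ (k₁ k₂ : List (Tag A m × List ℕ)), (L s).map (Fact.record s) =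
        k₁ ++ Fact.record s f :: k₂ → ∃ j₁ j₂, L s = j₁ ++ f :: j₂ ∧ k₁ = j₁.map (Fact.record s) := by
      intro k₁ k₂ hk
      obtain ⟨j₁, j', hj, hj₁, hj'⟩ := List.map_eq_append_iff.1 hk
      obtain ⟨g, j₂, rfl, hg, -⟩ := List.map_eq_cons_iff.1 hj'
      exact ⟨j₁, j₂, by rw [hj, Fact.record_injective s hg], hj₁.symm⟩
    cases s with
    | false =>
      obtain ⟨k', hk'⟩ := eq_append_of_append_eq_right hk.symm (hother _)
      obtain ⟨j₁, j₂, hj, rfl⟩ := hmap _ _ hk'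
      exact ⟨[], j₁, j₂, hj, rfl⟩
    | true =>
      obtain ⟨k', rfl, hk'⟩ := eq_append_of_append_eq_left hk.symm (hother _)
      obtain ⟨j₁, j₂, hj, rfl⟩ := hmap _ _ hk'
      exact ⟨_, j₁, j₂, hj, rfl⟩
  have hL : ∀ s l₁ f l₂, L s = l₁ ++ f :: l₂ → S.Justified N (U s) (· ∈ l₁) f := by
    rintro (_ | _)
    · exact hl
    · exact hl'
  have hknown : ∀ s p f, Rec p (Fact.record s f).1 (Fact.record s f).2 →
      ∃ k : List (Fact A m), S.Justified N (U s) (· ∈ k) f ∧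
        (∀ b x, x < N ∧ b = U s x → Before Rec M p (.un s b) [x]) ∧
        ∀ g ∈ k, Before Rec M p (Fact.record s g).1 (Fact.record s g).2 := by
    intro s p f hr
    obtain ⟨l₁, l₂, h1, rfl⟩ := (h _ _ _).1 hr
    obtain ⟨k₀, k₁, k₂, hk, rfl⟩ := hsplit s f l₁ l₂ h1
    refine ⟨k₁, hL s _ _ _ hk, ?_, fun g hg => hbefore _ _ _ h1 ?_⟩
    · rintro b x ⟨hx, rfl⟩
      refine hbefore _ _ (_, _) h1 ?_
      refine List.mem_append_left _ ?_
      rw [List.mem_append, mem_unRecords, mem_unRecords]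
      cases s
      · exact .inl ⟨x, hx, rfl⟩
      · exact .inr ⟨x, hx, rfl⟩
    · exact List.mem_append_right _ (List.mem_append_right _ (List.mem_map_of_mem hg))
  refine ⟨?_, ?_, ?_, y, hy.trans_le hNM, ?_, ?_⟩
  · rintro s a b hab p hp q hq x - ⟨h1, h2⟩
    have h1 := (hunmem s a x).1 ((hmem _ _).1 ⟨p, hp, h1⟩)
    have h2 := (hunmem s b x).1 ((hmem _ _).1 ⟨q, hq, h2⟩)
    exact hab (h1.2.trans h2.2.symm)
  · intro s a p _ x _ hr
    obtain ⟨k, hk, h1, h2⟩ := hknown s p (.inl (a, x)) hr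
    have hk : S.JustOut N (fun b x => x < N ∧ b = U s x) (fun b x => .inl (b, x) ∈ k)
      (fun β b C x w => .inr (β, b, C, x, w) ∈ k) a x := hk
    exact hk.mono hNM hS.dj h1 (fun b x hb => h2 (.inl (b, x)) hb)
      fun β b C x w hb => h2 (.inr (β, b, C, x, w)) hb
  · intro s β a p _ C _ x _ w _ hr
    obtain ⟨k, hk, h1, h2⟩ := hknown s p (.inr (β, a, C, x, w)) hr
    have hk : S.JustInn N (fun b x => .inl (b, x) ∈ k)
      (fun β b C x w => .inr (β, b, C, x, w) ∈ k) β a C x w := hk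
    exact hk.mono hNM (fun b x hb => h2 (.inl (b, x)) hb)
      fun β b C x w hb => h2 (.inr (β, b, C, x, w)) hb
  · intro x _ hx hux
    refine ⟨u x, (hmem _ _).2 ((hunmem _ _ _).2 ⟨hx.trans_lt hy, rfl⟩),
      (hmem _ _).2 ((hunmem _ _ _).2 ⟨hx.trans_lt hy, huu x hx hux⟩)⟩
  · intro a
    rcases hall a with ha | ha
    · exact ⟨false, (hmem _ _).2 (List.mem_append_right _ (List.mem_append_left _
        (List.mem_map_of_mem (f := Fact.record false) ha)))⟩
    · exact ⟨true, (hmem _ _).2 (List.mem_append_right _ (List.mem_append_right _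
        (List.mem_map_of_mem (f := Fact.record true) ha)))⟩

/-- A false sentence has a refutation. -/
theorem Represents.exists_certificate [Fintype A] {φ : Sentence A} {N : ℕ}
    (h : S.Represents φ N) {c : A} (hm : 0 < m)
    (hc : ∀ (k : ℕ) (args : Fin k → Fin φ.n) (D : DNF A k), Atom.rel k args D ∈ φ.atoms →
      AlmostExTrivial c D.rel)
    (hbr : ∀ p C, S.rel p → S.dj p C → S.Branching N m C) (hφ : ¬ φ.IsTrue) :
    ∃ (u u' : ℕ → A) (l l' : List (Fact A m)), l.Nodup ∧ l'.Nodup ∧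
      (∀ f ∈ l, f ∈ boundedFacts A m N) ∧ (∀ f ∈ l', f ∈ boundedFacts A m N) ∧
      (∀ l₁ f l₂, l = l₁ ++ f :: l₂ → S.Justified N u (· ∈ l₁) f) ∧
      (∀ l₁ f l₂, l' = l₁ ++ f :: l₂ → S.Justified N u' (· ∈ l₁) f) ∧
      ∃ y < N, (∀ x ≤ y, S.uni x → u x = u' x) ∧ ∀ a, .inl (a, y) ∈ l ∨ .inl (a, y) ∈ l' := by
  choose l h1 h2 h3 h4 using fun u => exists_saturated_list (boundedFacts A m N) (S.Justified N u)
  -- Saturated lists are closed sets of facts. Were no pair of them a refutation, their exclusions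
  -- would satisfy the hypothesis of `Represents.isTrue`.
  by_contra hno
  refine hφ (h.isTrue hm hc hbr (fun u a y => .inl (a, y) ∈ l u)
    (fun u β a C y w => .inr (β, a, C, y, w) ∈ l u) (fun u => ⟨?_, ?_⟩) ?_)
  · intro a y hy hj
    exact h4 u (.inl (a, y)) (by simp [boundedFacts, hy]) hj
  · intro β a C y w hC hy hw hj
    exact h4 u (.inr (β, a, C, y, w)) (by simp [boundedFacts, hy, hC, hw]) hj
  · intro u u' y hy huu
    by_contra hy'
    push Not at hy'
    refine hno ⟨u, u', l u, l u', h1 _, h1 _, h2 _, h2 _, h3 _, h3 _, y, hy, huu, fun a => ?_⟩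
    by_contra ha
    push Not at ha
    exact ha.2 (hy' a ha.1)

end Sys


/-! ### Positions in words -/

section Words

variable {L : Type}

/-- The letter at the position `p` satisfies `t`. -/
def At (t : L → Bool) (z : List L) (p : ℕ) : Prop := ∃ a, z[p]? = some a ∧ t a = true

theorem At.lt_length {t : L → Bool} {z : List L} {p : ℕ} (h : At t z p) : p < z.length := by
  obtain ⟨a, ha, -⟩ := h
  exact (List.getElem?_eq_some_iff.1 ha).1

theorem at_append_right {t : L → Bool} {Z T : List L} {i : ℕ} :
    At t (Z ++ T) (Z.length + i) ↔ At t T i := by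
  simp [At, List.getElem?_append_right]

theorem not_at_append_left {t : L → Bool} {Z T : List L} (h : ∀ a ∈ Z, t a = false) {i : ℕ}
    (hi : i < Z.length) : ¬ At t (Z ++ T) i := by
  rintro ⟨a, ha, hta⟩
  rw [List.getElem?_append_left hi] at ha
  rw [h a (List.mem_of_getElem? ha)] at hta
  exact absurd hta (by simp)

/-- In a concatenation of blocks with distinguished first letters, the positions of such letters
before the first barrier are the starts of the blocks. The prefix `pre` makes the induction work:
after the first head, the body of its block becomes the new prefix. -/
theorem at_heads {t bar : L → Bool} {X : Type*} {enc : X → List L} {h : X → L}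
    {body : X → List L} (henc : ∀ a, enc a = h a :: body a)
    (hh : ∀ a, t (h a) = true ∧ bar (h a) = false)
    (hb : ∀ a, ∀ y ∈ body a, t y = false ∧ bar y = false) {R : List L}
    (hR : ∀ i, At t R i → ∃ x ≤ i, At bar R x) (l : List X) (pre : List L)
    (hpre : ∀ y ∈ pre, t y = false ∧ bar y = false) (i : ℕ) :
    (At t (pre ++ (l.flatMap enc ++ R)) i ∧ ∀ x ≤ i, ¬ At bar (pre ++ (l.flatMap enc ++ R)) x) ↔
      ∃ l₁ a l₂, l = l₁ ++ a :: l₂ ∧ i = (pre ++ l₁.flatMap enc).length := by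
  induction l generalizing pre i with
  | nil =>
    refine iff_of_false (fun ⟨h1, h2⟩ => ?_) (by simp)
    rcases lt_or_ge i pre.length with hi | hi
    · exact not_at_append_left (fun a ha => (hpre a ha).1) hi h1
    · obtain ⟨i, rfl⟩ := Nat.exists_eq_add_of_le hi
      rw [at_append_right] at h1
      obtain ⟨x, hx, hs⟩ := hR i h1
      exact h2 (pre.length + x) (by omega) (at_append_right.2 hs)
  | cons a l ih =>
    rcases lt_trichotomy i pre.length with hi | rfl | hi
    · refine iff_of_false (fun ⟨h1, _⟩ => not_at_append_left (fun a ha => (hpre a ha).1) hi h1) ?_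
      rintro ⟨l₁, a, l₂, -, rfl⟩
      simp at hi
    · refine iff_of_true ⟨?_, fun x hx => ?_⟩ ⟨[], a, l, rfl, by simp⟩
      · rw [← Nat.add_zero pre.length, at_append_right, List.flatMap_cons, henc]
        exact ⟨h a, by simp, (hh a).1⟩
      · rcases hx.lt_or_eq with hx | rfl
        · exact not_at_append_left (fun a ha => (hpre a ha).2) hx
        · rw [← Nat.add_zero pre.length, at_append_right, List.flatMap_cons, henc]
          rintro ⟨b, hb, hs⟩
          obtain rfl : h a = b := by simpa using hb
          rw [(hh a).2] at hs
          exact absurd hs (by simp)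
    · obtain ⟨i, rfl⟩ : ∃ j, i = (pre ++ [h a]).length + j := ⟨i - pre.length - 1, by simp; omega⟩
      have heq : pre ++ ((a :: l).flatMap enc ++ R) =
          (pre ++ [h a]) ++ (body a ++ (l.flatMap enc ++ R)) := by
        simp [henc]
      have hbar : (∀ x ≤ (pre ++ [h a]).length + i,
          ¬ At bar ((pre ++ [h a]) ++ (body a ++ (l.flatMap enc ++ R))) x) ↔
          ∀ x ≤ i, ¬ At bar (body a ++ (l.flatMap enc ++ R)) x := by
        constructor
        · intro hx x hxi hs
          exact hx _ (Nat.add_le_add_left hxi _) (at_append_right.2 hs)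
        · intro hx x hxi
          rcases lt_or_ge x (pre ++ [h a]).length with hlt | hge
          · refine not_at_append_left (fun b hb => ?_) hlt
            rcases List.mem_append.1 hb with hb | hb
            · exact (hpre b hb).2
            · rw [List.mem_singleton.1 hb]; exact (hh a).2
          · obtain ⟨x, rfl⟩ := Nat.exists_eq_add_of_le hge
            rw [at_append_right]
            exact hx x (by omega)
      rw [heq, at_append_right, hbar, ih (body a) (hb a) i]
      constructor
      · rintro ⟨l₁, b, l₂, rfl, rfl⟩
        exact ⟨a :: l₁, b, l₂, rfl, by simp [henc]; omega⟩
      · rintro ⟨l₁, b, l₂, h1, h2⟩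
        cases l₁ with
        | nil => simp at h2; omega
        | cons a' l₁ =>
          obtain ⟨rfl, rfl⟩ := List.cons.inj h1
          refine ⟨l₁, b, l₂, rfl, ?_⟩
          simp [henc] at h2 ⊢
          omega

/-- The word `T` follows the position `p`. -/
def Rest (z : List L) (p : ℕ) (T : List L) : Prop := ∀ i, z[p + 1 + i]? = T[i]?

theorem rest_of_eq {z Z T : List L} {a : L} (h : z = Z ++ a :: T) : Rest z Z.length T := by
  intro i
  rw [h, List.getElem?_append_right (by omega)]
  have : Z.length + 1 + i - Z.length = i + 1 := by omega
  rw [this, List.getElem?_cons_succ]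

theorem Rest.append {z Z T : List L} {p : ℕ} (h : Rest z p (Z ++ T)) :
    Rest z (p + Z.length) T := by
  intro i
  have := h (Z.length + i)
  rw [List.getElem?_append_right (by omega)] at this
  rw [show p + Z.length + 1 + i = p + 1 + (Z.length + i) by omega, this]
  simp

theorem Rest.cons {z T : List L} {a : L} {p : ℕ} (h : Rest z p (a :: T)) : Rest z (p + 1) T :=
  Rest.append (Z := [a]) h

theorem Rest.at_iff {z T : List L} {p : ℕ} (h : Rest z p T) {t : L → Bool} {i : ℕ} :
    At t z (p + 1 + i) ↔ At t T i := by
  simp [At, h i]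

/-- The position `q` follows `p`, and no letter after `p` up to `q` satisfies `bar`. -/
def Owned (bar : L → Bool) (z : List L) (p q : ℕ) : Prop :=
  p < q ∧ ∀ x, p < x → x ≤ q → ¬ At bar z x

theorem Rest.owned_iff {t bar : L → Bool} {X : Type*} {enc : X → List L} {h : X → L}
    {body : X → List L} (henc : ∀ a, enc a = h a :: body a)
    (hh : ∀ a, t (h a) = true ∧ bar (h a) = false)
    (hb : ∀ a, ∀ y ∈ body a, t y = false ∧ bar y = false) {R : List L}
    (hR : ∀ i, At t R i → ∃ x ≤ i, At bar R x) {l : List X} {pre : List L}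
    (hpre : ∀ y ∈ pre, t y = false ∧ bar y = false) {z : List L} {p : ℕ}
    (hz : Rest z p (pre ++ (l.flatMap enc ++ R))) (q : ℕ) :
    (Owned bar z p q ∧ At t z q) ↔
      ∃ l₁ a l₂, l = l₁ ++ a :: l₂ ∧ q = p + 1 + (pre ++ l₁.flatMap enc).length := by
  have key := at_heads henc hh hb hR l pre hpre
  constructor
  · rintro ⟨⟨hpq, hs⟩, ht⟩
    obtain ⟨i, rfl⟩ := Nat.exists_eq_add_of_le (Nat.succ_le_of_lt hpq)
    obtain ⟨l₁, a, l₂, h1, h2⟩ := (key i).1 ⟨hz.at_iff.1 ht, fun x hx h' =>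
      hs (p + 1 + x) (by omega) (by omega) (hz.at_iff.2 h')⟩
    exact ⟨l₁, a, l₂, h1, by rw [h2]⟩
  · rintro ⟨l₁, a, l₂, h1, rfl⟩
    obtain ⟨h2, h3⟩ := (key _).2 ⟨l₁, a, l₂, h1, rfl⟩
    refine ⟨⟨by omega, fun x hx hx' h' => ?_⟩, hz.at_iff.2 h2⟩
    obtain ⟨x, rfl⟩ := Nat.exists_eq_add_of_le (Nat.succ_le_of_lt hx)
    exact h3 x (by omega) (hz.at_iff.1 h')

theorem Rest.split {X : Type*} {enc : X → List L} {h : X → L} {body : X → List L}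
    (henc : ∀ a, enc a = h a :: body a) {R pre z : List L} {l₁ l₂ : List X} {a : X} {p : ℕ}
    (hz : Rest z p (pre ++ ((l₁ ++ a :: l₂).flatMap enc ++ R))) :
    z[p + 1 + (pre ++ l₁.flatMap enc).length]? = some (h a) ∧
      Rest z (p + 1 + (pre ++ l₁.flatMap enc).length) (body a ++ (l₂.flatMap enc ++ R)) := by
  have heq : pre ++ ((l₁ ++ a :: l₂).flatMap enc ++ R) =
      (pre ++ l₁.flatMap enc) ++ h a :: (body a ++ (l₂.flatMap enc ++ R)) := by
    simp [henc]
  rw [heq] at hz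
  constructor
  · rw [hz, List.getElem?_append_right le_rfl]
    simp
  · have := hz.append.cons
    rwa [show p + (pre ++ l₁.flatMap enc).length + 1 = p + 1 + (pre ++ l₁.flatMap enc).length by
      omega] at this

end Words

/-! ### Unary indices -/

/-- The letters of the certificates. -/
inductive Letter (A : Type) (m : ℕ) : Type
  | head (τ : Tag A m)
  | tick
  | endIndex

instance {A : Type} {m : ℕ} [Finite A] : Finite (Letter A m) := by
  refine Finite.of_injective (β := Tag A m ⊕ Bool) (fun
    | .head τ => .inl τ
    | .tick => .inr true
    | .endIndex => .inr false) ?_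
  rintro (τ | _ | _) (τ' | _ | _) h <;> simp_all

instance {A : Type} {m : ℕ} : Nonempty (Letter A m) := ⟨.tick⟩

section Indices

variable {A : Type} {m : ℕ}

/-- The letter is a tick. -/
def isTick : Sym A ⊕ Letter A m → Bool
  | .inl .tick => true
  | .inr .tick => true
  | _ => false

/-- The letter ends an index. -/
def isEnd : Sym A ⊕ Letter A m → Bool
  | .inl .endIndex => true
  | .inr .endIndex => true
  | _ => false

theorem isEnd_of_isTick {a : Sym A ⊕ Letter A m} (h : isTick a = true) : isEnd a = false := by
  rcases a with (_ | _) | (_ | _) <;> simp_all [isTick, isEnd]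

/-- The positions after `s` up to `e` hold the index `v`. -/
def Run (z : List (Sym A ⊕ Letter A m)) (s e v : ℕ) : Prop :=
  e = s + 1 + v ∧ At isEnd z e ∧ ∀ x, s < x → x < e → At isTick z x

/-- The positions after `s` up to `e` hold the indices `is`. -/
def FieldsTo (z : List (Sym A ⊕ Letter A m)) : ℕ → List ℕ → ℕ → Prop
  | s, [], e => e = s
  | s, v :: is, e => ∃ e', Run z s e' v ∧ FieldsTo z e' is e

/-- The positions after `p` up to `s` hold `j` indices. -/
def Skips (z : List (Sym A ⊕ Letter A m)) (p s j : ℕ) : Prop :=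
  p ≤ s ∧ (s = p ∨ At isEnd z s) ∧ (∀ x, p < x → x ≤ s → At isTick z x ∨ At isEnd z x) ∧
    posCount z.length (fun x => p < x ∧ x ≤ s ∧ At isEnd z x) = j

/-- The `j`-th index after `p` is `v`. -/
def ArgAt (z : List (Sym A ⊕ Letter A m)) (p j v : ℕ) : Prop :=
  ∃ s e, Skips z p s j ∧ Run z s e v

/-- The word of an index with the given letters. -/
def indexWord (a b : Sym A ⊕ Letter A m) (v : ℕ) : List (Sym A ⊕ Letter A m) :=
  List.replicate v a ++ [b]

variable {z R : List (Sym A ⊕ Letter A m)} {a b : Sym A ⊕ Letter A m} {p : ℕ}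

theorem Run.lt {s e v : ℕ} (h : Run z s e v) : v < z.length ∧ e < z.length := by
  have := h.2.1.lt_length
  have := h.1
  omega

theorem FieldsTo.lt {s e : ℕ} {is : List ℕ} (h : FieldsTo z s is e) : ∀ i ∈ is, i < z.length := by
  induction is generalizing s with
  | nil => simp
  | cons v is ih =>
    obtain ⟨e', h1, h2⟩ := h
    intro i hi
    rcases List.mem_cons.1 hi with rfl | hi
    · exact h1.lt.1
    · exact ih h2 i hi

theorem FieldsTo.lt_length {s e : ℕ} {is : List ℕ} (h : FieldsTo z s is e) (hs : s < z.length) :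
    e < z.length := by
  induction is generalizing s with
  | nil => obtain rfl : e = s := h; exact hs
  | cons v is ih =>
    obtain ⟨e', h1, h2⟩ := h
    exact ih h2 h1.lt.2

theorem Rest.run_iff (ha : isTick a = true) (hb : isEnd b = true) {v' : ℕ}
    (hz : Rest z p (indexWord a b v' ++ R)) {e v : ℕ} :
    Run z p e v ↔ v = v' ∧ e = p + 1 + v' := by
  have htick : ∀ i < v', z[p + 1 + i]? = some a := by
    intro i hi
    rw [hz i, indexWord, List.append_assoc, List.getElem?_append_left (by simpa using hi)]
    simp [hi]
  have hend : z[p + 1 + v']? = some b := by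
    rw [hz v', indexWord, List.append_assoc, List.getElem?_append_right (by simp)]
    simp
  constructor
  · rintro ⟨rfl, ⟨c, hc, hc'⟩, h⟩
    rcases lt_trichotomy v v' with hv | rfl | hv
    · rw [htick v hv] at hc
      obtain rfl := Option.some.inj hc
      rw [isEnd_of_isTick ha] at hc'
      exact absurd hc' (by simp)
    · exact ⟨rfl, rfl⟩
    · obtain ⟨c, hc, hc'⟩ := h (p + 1 + v') (by omega) (by omega)
      rw [hend] at hc
      obtain rfl := Option.some.inj hc
      rw [isEnd_of_isTick hc'] at hb
      exact absurd hb (by simp)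
  · rintro ⟨rfl, rfl⟩
    refine ⟨rfl, ⟨b, hend, hb⟩, fun x hx hx' => ?_⟩
    obtain ⟨i, rfl⟩ := Nat.exists_eq_add_of_le (Nat.succ_le_of_lt hx)
    exact ⟨a, htick i (by omega), ha⟩

theorem length_indexWord (v : ℕ) : (indexWord a b v).length = v + 1 := by simp [indexWord]

theorem Rest.fieldsTo_iff (ha : isTick a = true) (hb : isEnd b = true) {is is' : List ℕ}
    (hz : Rest z p (is'.flatMap (indexWord a b) ++ R)) (hlen : is.length = is'.length) {e : ℕ} :
    FieldsTo z p is e ↔ is = is' ∧ e = p + (is'.flatMap (indexWord a b)).length := by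
  induction is' generalizing p is with
  | nil =>
    obtain rfl := List.length_eq_zero_iff.1 hlen
    simp [FieldsTo]
  | cons v' is' ih =>
    cases is with
    | nil => simp at hlen
    | cons v is =>
      rw [List.flatMap_cons, List.append_assoc] at hz
      have hz' : Rest z (p + 1 + v') (is'.flatMap (indexWord a b) ++ R) := by
        have := hz.append
        rwa [length_indexWord, show p + (v' + 1) = p + 1 + v' by omega] at this
      simp only [FieldsTo, hz.run_iff ha hb]
      constructor
      · rintro ⟨_, ⟨rfl, rfl⟩, h⟩
        obtain ⟨rfl, rfl⟩ := (ih hz' (by simpa using hlen)).1 h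
        exact ⟨rfl, by simp only [List.flatMap_cons, List.length_append, length_indexWord]; omega⟩
      · rintro ⟨h, rfl⟩
        obtain ⟨rfl, rfl⟩ := List.cons.inj h
        refine ⟨_, ⟨rfl, rfl⟩, (ih hz' rfl).2 ⟨rfl, ?_⟩⟩
        simp only [List.flatMap_cons, List.length_append, length_indexWord]; omega

/-- The first end letter after `p` is at `e`, so either nothing is skipped or the count of end
letters drops by one when starting from `e`. This relates the counting definition of `Skips` to
recursion on the list of indices. -/
theorem Run.skips_iff {e v s j : ℕ} (h : Run z p e v) :
    Skips z p s j ↔ (s = p ∧ j = 0) ∨ ∃ j', j = j' + 1 ∧ Skips z e s j' := by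
  have hpe : p < e := by have := h.1; omega
  have hnot : ∀ x, p < x → x < e → ¬ At isEnd z x := by
    rintro x hx hx' ⟨c, hc, hc'⟩
    obtain ⟨d, hd, hd'⟩ := h.2.2 x hx hx'
    rw [hc] at hd
    obtain rfl := Option.some.inj hd
    rw [isEnd_of_isTick hd'] at hc'
    exact absurd hc' (by simp)
  have hcount : e ≤ s → posCount z.length (fun x => p < x ∧ x ≤ s ∧ At isEnd z x) =
      posCount z.length (fun x => e < x ∧ x ≤ s ∧ At isEnd z x) + 1 := by
    intro hes
    classical
    unfold posCount
    rw [← Finset.card_insert_of_notMem (a := e) (by simp)]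
    congr 1
    ext x
    simp only [Finset.mem_filter, Finset.mem_range, Finset.mem_insert]
    constructor
    · rintro ⟨h0, h1, h2, h3⟩
      rcases lt_trichotomy x e with hx | rfl | hx
      · exact absurd h3 (hnot x h1 hx)
      · exact .inl rfl
      · exact .inr ⟨h0, hx, h2, h3⟩
    · rintro (rfl | ⟨h0, h1, h2, h3⟩)
      · exact ⟨h.2.1.lt_length, hpe, hes, h.2.1⟩
      · exact ⟨h0, hpe.trans h1, h2, h3⟩
  constructor
  · rintro ⟨h1, h2, h3, rfl⟩
    rcases h1.eq_or_lt with rfl | h1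
    · refine .inl ⟨rfl, posCount_eq_zero.2 ?_⟩
      rintro x - ⟨h4, h5, -⟩
      omega
    · right
      have h2 : At isEnd z s := h2.resolve_left (by omega)
      have hes : e ≤ s := by
        by_contra hes
        exact hnot s h1 (by omega) h2
      exact ⟨_, hcount hes, hes, .inr h2, fun x hx => h3 x (hpe.trans hx), rfl⟩
  · rintro (⟨rfl, rfl⟩ | ⟨j', rfl, h1, h2, h3, rfl⟩)
    · refine ⟨le_rfl, .inl rfl, fun x hx hx' => by omega, posCount_eq_zero.2 ?_⟩
      rintro x - ⟨h4, h5, -⟩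
      omega
    · refine ⟨hpe.le.trans h1, .inr (h2.elim (fun h' => h' ▸ h.2.1) id), fun x hx hx' => ?_,
        hcount h1⟩
      rcases lt_trichotomy x e with hxe | rfl | hxe
      · exact .inl (h.2.2 x hx hxe)
      · exact .inr h.2.1
      · exact h3 x hxe hx'

/-- The condition on `R` prevents the letters after the list from being read as a further index; in
an atom the letter `body` serves this purpose. -/
theorem Rest.argAt_iff (ha : isTick a = true) (hb : isEnd b = true) {is : List ℕ}
    (hz : Rest z p (is.flatMap (indexWord a b) ++ R))
    (hR : ¬ At isTick R 0 ∧ ¬ At isEnd R 0) {j v : ℕ} :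
    ArgAt z p j v ↔ is[j]? = some v := by
  induction is generalizing p j with
  | nil =>
    refine iff_of_false ?_ (by simp)
    have hno : ∀ x, x = p + 1 → ¬ At isTick z x ∧ ¬ At isEnd z x := by
      rintro x rfl
      have := hz.at_iff (t := isTick) (i := 0)
      have := hz.at_iff (t := isEnd) (i := 0)
      simp_all
    rintro ⟨s, e, ⟨h1, -, h3, -⟩, h4, h5, h6⟩
    have hs : s = p := by
      by_contra hs
      have := hno (p + 1) rfl
      have := h3 (p + 1) (by omega) (by omega)
      tauto
    subst hs
    have := hno (s + 1) rfl
    rcases Nat.eq_zero_or_pos v with rfl | hv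
    · rw [h4] at h5
      exact this.2 h5
    · exact this.1 (h6 (s + 1) (by omega) (by omega))
  | cons v' is ih =>
    rw [List.flatMap_cons, List.append_assoc] at hz
    have hz' : Rest z (p + 1 + v') (is.flatMap (indexWord a b) ++ R) := by
      have := hz.append
      rwa [length_indexWord, show p + (v' + 1) = p + 1 + v' by omega] at this
    have hrun : Run z p (p + 1 + v') v' := (hz.run_iff ha hb).2 ⟨rfl, rfl⟩
    cases j with
    | zero =>
      simp only [ArgAt, hrun.skips_iff]
      constructor
      · rintro ⟨s, e, ⟨rfl, -⟩ | ⟨j', h, -⟩, h'⟩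
        · rw [((hz.run_iff ha hb).1 h').1]
          rfl
        · omega
      · intro h
        obtain rfl : v' = v := by simpa using h
        exact ⟨p, _, .inl ⟨rfl, trivial⟩, hrun⟩
    | succ j =>
      rw [List.getElem?_cons_succ, ← ih hz']
      simp only [ArgAt, hrun.skips_iff]
      constructor
      · rintro ⟨s, e, ⟨rfl, h⟩ | ⟨j', h, h1⟩, h'⟩
        · omega
        · obtain rfl : j = j' := by omega
          exact ⟨s, e, h1, h'⟩
      · rintro ⟨s, e, h1, h'⟩
        exact ⟨s, e, .inr ⟨j, rfl, h1⟩, h'⟩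

end Indices


section WordStructure

variable {A : Type} {m : ℕ}

/-! ### The structure of a sentence in its word -/

/-- The nesting level of the part of a word that starts with the letter. -/
def rank : Sym A ⊕ Letter A m → ℕ
  | .inl .eqVar => 1
  | .inl .neVar => 1
  | .inl .eqConst => 1
  | .inl .neConst => 1
  | .inl .disjunct => 2
  | .inl .eqAtom => 3
  | .inl .relAtom => 3
  | .inl _ => 0
  | .inr _ => 4

/-- `q` is in the part of the word of level less than `n` that follows `p`. -/
def Under (n : ℕ) (z : List (Sym A ⊕ Letter A m)) (p q : ℕ) : Prop :=
  Owned (fun a => decide (n ≤ rank a)) z p q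

/-- `C` is a disjunct of the relational atom `p`. -/
def DisjunctAt (z : List (Sym A ⊕ Letter A m)) (p C : ℕ) : Prop :=
  z[p]? = some (.inl .relAtom) ∧ Under 3 z p C ∧ z[C]? = some (.inl .disjunct)

/-- The structure of the sentence encoded by a word. -/
def wordSys (z : List (Sym A ⊕ Letter A m)) : Sys A where
  uni y := z[y]? = some (.inl .forallQ)
  eqA y y' := ∃ q e, z[q]? = some (.inl .eqAtom) ∧ FieldsTo z q [y, y'] e
  rel p := z[p]? = some (.inl .relAtom)
  dj p C := DisjunctAt z p C
  lEq C y y' := ∃ p, DisjunctAt z p C ∧ ∃ q, Under 2 z C q ∧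
    z[q]? = some (.inl .eqVar) ∧ ∃ j j' e, FieldsTo z q [j, j'] e ∧ ArgAt z p j y ∧ ArgAt z p j' y'
  lNe C y y' := ∃ p, DisjunctAt z p C ∧ ∃ q, Under 2 z C q ∧
    z[q]? = some (.inl .neVar) ∧ ∃ j j' e, FieldsTo z q [j, j'] e ∧ ArgAt z p j y ∧ ArgAt z p j' y'
  lEqC C y a := ∃ p, DisjunctAt z p C ∧ ∃ q, Under 2 z C q ∧
    z[q]? = some (.inl .eqConst) ∧ ∃ j e, FieldsTo z q [j] e ∧ ArgAt z p j y ∧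
      z[e + 1]? = some (.inl (.const a))
  lNeC C y a := ∃ p, DisjunctAt z p C ∧ ∃ q, Under 2 z C q ∧
    z[q]? = some (.inl .neConst) ∧ ∃ j e, FieldsTo z q [j] e ∧ ArgAt z p j y ∧
      z[e + 1]? = some (.inl (.const a))

/-- The word is empty or starts with a letter of level at least `n`. -/
def Closes (n : ℕ) (R : List (Sym A ⊕ Letter A m)) : Prop := ∀ y, R[0]? = some y → n ≤ rank y

/-! ### Finding the parts of a word by their levels. -/

section

variable {X : Type*} {enc : X → List (Sym A ⊕ Letter A m)} {h : X → Sym A ⊕ Letter A m}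
  {body : X → List (Sym A ⊕ Letter A m)} {R pre z : List (Sym A ⊕ Letter A m)} {n p q : ℕ}
  {l : List X}

theorem Closes.flatMap_append (henc : ∀ a, enc a = h a :: body a) (hh : ∀ a, rank (h a) = n)
    (hR : Closes n R) : Closes n (l.flatMap enc ++ R) := by
  cases l with
  | nil => simpa using hR
  | cons a l =>
    intro y hy
    obtain rfl : h a = y := by simpa [henc] using hy
    exact (hh a).ge

/-- A part of level `n` ends where a letter of higher level appears. Inside it, the letters of level
`n` are exactly the heads, since bodies and prefix have lower level. -/
theorem Rest.under_iff (henc : ∀ a, enc a = h a :: body a) (hh : ∀ a, rank (h a) = n)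
    (hb : ∀ a, ∀ y ∈ body a, rank y < n) (hpre : ∀ y ∈ pre, rank y < n) (hR : Closes (n + 1) R)
    (hz : Rest z p (pre ++ (l.flatMap enc ++ R))) :
    (Under (n + 1) z p q ∧ At (fun a => decide (rank a = n)) z q) ↔
      ∃ l₁ a l₂, l = l₁ ++ a :: l₂ ∧ q = p + 1 + (pre ++ l₁.flatMap enc).length := by
  refine hz.owned_iff henc (fun a => ?_) (fun a y hy => ?_) (fun i hi => ⟨0, Nat.zero_le i, ?_⟩)
    (fun y hy => ?_) q
  · simp [hh a]
  · have := hb a y hy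
    simp only [decide_eq_false_iff_not]
    omega
  · have := hi.lt_length
    refine ⟨R[0], List.getElem?_eq_getElem _, ?_⟩
    simpa using hR _ (List.getElem?_eq_getElem (by omega))
  · have := hpre y hy
    simp only [decide_eq_false_iff_not]
    omega

theorem Rest.exists_of_under (henc : ∀ a, enc a = h a :: body a) (hh : ∀ a, rank (h a) = n)
    (hb : ∀ a, ∀ y ∈ body a, rank y < n) (hpre : ∀ y ∈ pre, rank y < n) (hR : Closes (n + 1) R)
    (hz : Rest z p (pre ++ (l.flatMap enc ++ R))) (hq : Under (n + 1) z p q)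
    {x : Sym A ⊕ Letter A m} (hx : z[q]? = some x) (hxn : rank x = n) :
    ∃ a ∈ l, h a = x ∧ ∃ R', Closes n R' ∧ Rest z q (body a ++ R') := by
  obtain ⟨l₁, a, l₂, rfl, rfl⟩ :=
    (hz.under_iff henc hh hb hpre hR).1 ⟨hq, x, hx, by simpa using hxn⟩
  obtain ⟨h1, h2⟩ := hz.split henc
  rw [hx] at h1
  exact ⟨a, by simp, (Option.some.inj h1).symm, _,
    Closes.flatMap_append henc hh fun y hy => (Nat.le_succ n).trans (hR y hy), h2⟩

theorem Rest.exists_under (henc : ∀ a, enc a = h a :: body a) (hh : ∀ a, rank (h a) = n)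
    (hb : ∀ a, ∀ y ∈ body a, rank y < n) (hpre : ∀ y ∈ pre, rank y < n) (hR : Closes (n + 1) R)
    (hz : Rest z p (pre ++ (l.flatMap enc ++ R))) {a : X} (ha : a ∈ l) :
    ∃ q, Under (n + 1) z p q ∧ z[q]? = some (h a) ∧ ∃ R', Closes n R' ∧ Rest z q (body a ++ R') := by
  obtain ⟨l₁, l₂, rfl⟩ := List.mem_iff_append.1 ha
  obtain ⟨h1, h2⟩ := hz.split henc
  exact ⟨_, ((hz.under_iff henc hh hb hpre hR).2 ⟨l₁, a, l₂, rfl, rfl⟩).1, h1, _,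
    Closes.flatMap_append henc hh fun y hy => (Nat.le_succ n).trans (hR y hy), h2⟩

end

/-- The word of an index in a sentence. -/
def symIndex (A : Type) (m v : ℕ) : List (Sym A ⊕ Letter A m) :=
  indexWord (.inl .tick) (.inl .endIndex) v

theorem map_encIndex (v : ℕ) : (encIndex v).map Sum.inl = symIndex A m v := by
  simp [encIndex, symIndex, indexWord]

/-- The first letter of the word of a literal. -/
def Literal.head (m : ℕ) {k : ℕ} : Literal A k → Sym A ⊕ Letter A m
  | .eqVar _ _ => .inl .eqVar
  | .neVar _ _ => .inl .neVar
  | .eqConst _ _ => .inl .eqConst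
  | .neConst _ _ => .inl .neConst

/-- The word of a literal, without its first letter. -/
def Literal.body (m : ℕ) {k : ℕ} : Literal A k → List (Sym A ⊕ Letter A m)
  | .eqVar i j => [(i : ℕ), (j : ℕ)].flatMap (symIndex A m)
  | .neVar i j => [(i : ℕ), (j : ℕ)].flatMap (symIndex A m)
  | .eqConst i a => [(i : ℕ)].flatMap (symIndex A m) ++ [.inl (.const a)]
  | .neConst i a => [(i : ℕ)].flatMap (symIndex A m) ++ [.inl (.const a)]

theorem Literal.map_enc {k : ℕ} (l : Literal A k) :
    l.enc.map Sum.inl = l.head m :: l.body m := by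
  cases l <;> simp [Literal.enc, Literal.head, Literal.body, map_encIndex]

/-- The word of a disjunct, without its first letter. -/
def disjunctBody (m : ℕ) {k : ℕ} (c : List (Literal A k)) : List (Sym A ⊕ Letter A m) :=
  c.flatMap fun l => l.enc.map Sum.inl

/-- The first letter of the word of an atom. -/
def Atom.head (m : ℕ) {n : ℕ} : Atom A n → Sym A ⊕ Letter A m
  | .eq _ _ => .inl .eqAtom
  | .rel _ _ _ => .inl .relAtom

/-- The word of the arguments of an atom. -/
def argsWord (A : Type) (m : ℕ) {n k : ℕ} (args : Fin k → Fin n) : List (Sym A ⊕ Letter A m) :=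
  (List.ofFn fun i => (args i : ℕ)).flatMap (symIndex A m) ++ [.inl .body]

/-- The word of an atom, without its first letter. -/
def Atom.body (m : ℕ) {n : ℕ} : Atom A n → List (Sym A ⊕ Letter A m)
  | .eq i j => [(i : ℕ), (j : ℕ)].flatMap (symIndex A m)
  | .rel _ args D => argsWord A m args ++
      D.flatMap fun c => .inl .disjunct :: disjunctBody m c

theorem Atom.map_enc {n : ℕ} (a : Atom A n) : a.enc.map Sum.inl = a.head m :: a.body m := by
  cases a with
  | eq i j => simp [Atom.enc, Atom.head, Atom.body, map_encIndex]
  | rel k args D =>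
    have : (List.ofFn args).flatMap (fun i : Fin n => symIndex A m i) =
        (List.ofFn fun i => (args i : ℕ)).flatMap (symIndex A m) := by
      rw [show (List.ofFn fun i => (args i : ℕ)) = (List.ofFn args).map Fin.val by
        simp [List.map_ofFn, Function.comp_def], List.flatMap_map]
    simp [Atom.enc, Atom.head, Atom.body, argsWord, DNF.enc, disjunctBody, List.map_flatMap,
      map_encIndex, this]

theorem rank_of_mem_symIndex {v : ℕ} {y : Sym A ⊕ Letter A m} (hy : y ∈ symIndex A m v) :
    rank y = 0 := by
  rcases List.mem_append.1 hy with hy | hy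
  · rw [List.eq_of_mem_replicate hy]; rfl
  · rw [List.mem_singleton.1 hy]; rfl

theorem rank_of_mem_flatMap_symIndex {l : List ℕ} {y : Sym A ⊕ Letter A m}
    (hy : y ∈ l.flatMap (symIndex A m)) : rank y = 0 := by
  obtain ⟨v, -, hy⟩ := List.mem_flatMap.1 hy
  exact rank_of_mem_symIndex hy

theorem Literal.rank_head {k : ℕ} (l : Literal A k) : rank (l.head m) = 1 := by
  cases l <;> rfl

theorem Literal.rank_body {k : ℕ} (l : Literal A k) : ∀ y ∈ l.body m, rank y < 1 := by
  intro y hy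
  rw [Nat.lt_one_iff]
  cases l with
  | eqVar i j => exact rank_of_mem_flatMap_symIndex hy
  | neVar i j => exact rank_of_mem_flatMap_symIndex hy
  | eqConst i a =>
    rcases List.mem_append.1 hy with hy | hy
    · exact rank_of_mem_flatMap_symIndex hy
    · rw [List.mem_singleton.1 hy]; rfl
  | neConst i a =>
    rcases List.mem_append.1 hy with hy | hy
    · exact rank_of_mem_flatMap_symIndex hy
    · rw [List.mem_singleton.1 hy]; rfl

theorem rank_disjunctBody {k : ℕ} (c : List (Literal A k)) :
    ∀ y ∈ disjunctBody m c, rank y < 2 := by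
  intro y hy
  obtain ⟨l, -, hy⟩ := List.mem_flatMap.1 hy
  rw [Literal.map_enc] at hy
  rcases List.mem_cons.1 hy with rfl | hy
  · rw [l.rank_head]; omega
  · exact (l.rank_body y hy).trans (by omega)

theorem rank_argsWord {n k : ℕ} (args : Fin k → Fin n) :
    ∀ y ∈ argsWord A m args, rank y < 2 := by
  intro y hy
  have : rank y = 0 := by
    rcases List.mem_append.1 hy with hy | hy
    · exact rank_of_mem_flatMap_symIndex hy
    · rw [List.mem_singleton.1 hy]; rfl
  omega

theorem Atom.rank_head {n : ℕ} (a : Atom A n) : rank (a.head m) = 3 := by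
  cases a <;> rfl

theorem Atom.rank_body {n : ℕ} (a : Atom A n) : ∀ y ∈ a.body m, rank y < 3 := by
  intro y hy
  cases a with
  | eq i j =>
    rw [rank_of_mem_flatMap_symIndex hy]; omega
  | rel k args D =>
    rcases List.mem_append.1 hy with hy | hy
    · exact (rank_argsWord _ y hy).trans (by omega)
    · obtain ⟨c, -, hy⟩ := List.mem_flatMap.1 hy
      rcases List.mem_cons.1 hy with rfl | hy
      · simp [rank]
      · exact (rank_disjunctBody c y hy).trans (by omega)

/-! ### Reading the atoms, disjuncts and literals of a sentence from its word. -/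

section

variable {z R : List (Sym A ⊕ Letter A m)} {p C n k : ℕ}

/-- A second relational atom between `p` and `C` would itself be a barrier. -/
theorem under_unique {p' : ℕ} (hp : z[p]? = some (.inl .relAtom))
    (hp' : z[p']? = some (.inl .relAtom)) (h : Under 3 z p C) (h' : Under 3 z p' C) : p = p' := by
  by_contra hne
  rcases lt_or_gt_of_ne hne with hlt | hlt
  · exact h.2 p' hlt h'.1.le ⟨_, hp', rfl⟩
  · exact h'.2 p hlt h.1.le ⟨_, hp, rfl⟩

theorem Rest.argAt_args {args : Fin k → Fin n} (hz : Rest z p (argsWord A m args ++ R)) {j v : ℕ} :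
    ArgAt z p j v ↔ ∃ i : Fin k, (i : ℕ) = j ∧ (args i : ℕ) = v := by
  rw [argsWord, List.append_assoc] at hz
  rw [Rest.argAt_iff (a := .inl .tick) (b := .inl .endIndex) rfl rfl hz]
  · simp only [List.getElem?_ofFn]
    constructor
    · intro h
      split_ifs at h with hj
      exact ⟨⟨j, hj⟩, rfl, Option.some.inj h⟩
    · rintro ⟨i, rfl, rfl⟩
      simp
  · constructor <;> rintro ⟨a, ha, ha'⟩ <;> obtain rfl : Sum.inl Sym.body = a := by simpa using ha
    · exact absurd ha' (by simp [isTick])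
    · exact absurd ha' (by simp [isEnd])

theorem Rest.fieldsTo_sym {is is' : List ℕ} (hz : Rest z p (is'.flatMap (symIndex A m) ++ R))
    (hlen : is.length = is'.length) {e : ℕ} :
    FieldsTo z p is e ↔ is = is' ∧ e = p + (is'.flatMap (symIndex A m)).length :=
  Rest.fieldsTo_iff (a := .inl .tick) (b := .inl .endIndex) rfl rfl hz hlen

/-- Literals mention coordinates of the relation. The owning atom, found by uniqueness, translates
them into variables through its list of arguments. -/
theorem Rest.descC {args : Fin k → Fin n} (hp : z[p]? = some (.inl .relAtom))
    (hz : Rest z p (argsWord A m args ++ R)) (hC : Under 3 z p C)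
    (hCx : z[C]? = some (.inl .disjunct)) {c : List (Literal A k)}
    {R' : List (Sym A ⊕ Letter A m)} (hR' : Closes 2 R')
    (hc : Rest z C (disjunctBody m c ++ R')) : (wordSys z).DescC C args c := by
  have hc : Rest z C ([] ++ ((c.flatMap fun l => l.enc.map Sum.inl) ++ R')) := hc
  have hpre : ∀ y ∈ ([] : List (Sym A ⊕ Letter A m)), rank y < 1 := by simp
  have hof : ∀ {q : ℕ} {x : Sym A ⊕ Letter A m}, Under 2 z C q → z[q]? = some x → rank x = 1 →
      ∃ l ∈ c, l.head m = x ∧ ∃ R', Closes 1 R' ∧ Rest z q (l.body m ++ R') := fun hq hx hxn =>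
    hc.exists_of_under Literal.map_enc Literal.rank_head Literal.rank_body hpre hR' hq hx hxn
  have hto : ∀ {l : Literal A k}, l ∈ c → ∃ q, Under 2 z C q ∧ z[q]? = some (l.head m) ∧
      ∃ R', Closes 1 R' ∧ Rest z q (l.body m ++ R') := fun hl =>
    hc.exists_under Literal.map_enc Literal.rank_head Literal.rank_body hpre hR' hl
  refine ⟨fun y y' => ⟨?_, ?_⟩, fun y y' => ⟨?_, ?_⟩, fun y a => ⟨?_, ?_⟩, fun y a => ⟨?_, ?_⟩⟩
  · rintro ⟨p', ⟨hp', hC', -⟩, q, hq, hx, j, j', e, hf, h1, h2⟩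
    obtain rfl := under_unique hp hp' hC hC'
    obtain ⟨l, hl, hlx, R'', -, hR''⟩ := hof hq hx rfl
    cases l <;> simp only [Literal.head, Sum.inl.injEq, reduceCtorEq] at hlx
    rw [Literal.body] at hR''
    obtain ⟨h, -⟩ := (hR''.fieldsTo_sym (by rfl)).1 hf
    obtain ⟨rfl, h'⟩ := List.cons.inj h
    obtain ⟨rfl, -⟩ := List.cons.inj h'
    obtain ⟨i, hi, rfl⟩ := hz.argAt_args.1 h1
    obtain ⟨i', hi', rfl⟩ := hz.argAt_args.1 h2
    obtain rfl := Fin.ext hi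
    obtain rfl := Fin.ext hi'
    exact ⟨_, _, hl, rfl, rfl⟩
  · rintro ⟨i, j, hl, rfl, rfl⟩
    obtain ⟨q, hq, hx, R'', -, hR''⟩ := hto hl
    exact ⟨p, ⟨hp, hC, hCx⟩, q, hq, hx, i, j, _, (hR''.fieldsTo_sym rfl).2 ⟨rfl, rfl⟩,
      hz.argAt_args.2 ⟨i, rfl, rfl⟩, hz.argAt_args.2 ⟨j, rfl, rfl⟩⟩
  · rintro ⟨p', ⟨hp', hC', -⟩, q, hq, hx, j, j', e, hf, h1, h2⟩
    obtain rfl := under_unique hp hp' hC hC'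
    obtain ⟨l, hl, hlx, R'', -, hR''⟩ := hof hq hx rfl
    cases l <;> simp only [Literal.head, Sum.inl.injEq, reduceCtorEq] at hlx
    rw [Literal.body] at hR''
    obtain ⟨h, -⟩ := (hR''.fieldsTo_sym (by rfl)).1 hf
    obtain ⟨rfl, h'⟩ := List.cons.inj h
    obtain ⟨rfl, -⟩ := List.cons.inj h'
    obtain ⟨i, hi, rfl⟩ := hz.argAt_args.1 h1
    obtain ⟨i', hi', rfl⟩ := hz.argAt_args.1 h2
    obtain rfl := Fin.ext hi
    obtain rfl := Fin.ext hi'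
    exact ⟨_, _, hl, rfl, rfl⟩
  · rintro ⟨i, j, hl, rfl, rfl⟩
    obtain ⟨q, hq, hx, R'', -, hR''⟩ := hto hl
    exact ⟨p, ⟨hp, hC, hCx⟩, q, hq, hx, i, j, _, (hR''.fieldsTo_sym rfl).2 ⟨rfl, rfl⟩,
      hz.argAt_args.2 ⟨i, rfl, rfl⟩, hz.argAt_args.2 ⟨j, rfl, rfl⟩⟩
  · rintro ⟨p', ⟨hp', hC', -⟩, q, hq, hx, j, e, hf, h1, h2⟩
    obtain rfl := under_unique hp hp' hC hC'
    obtain ⟨l, hl, hlx, R'', -, hR''⟩ := hof hq hx rfl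
    cases l <;> simp only [Literal.head, Sum.inl.injEq, reduceCtorEq] at hlx
    rw [Literal.body, List.append_assoc] at hR''
    obtain ⟨h, rfl⟩ := (hR''.fieldsTo_sym (by rfl)).1 hf
    obtain ⟨rfl, -⟩ := List.cons.inj h
    obtain ⟨i, hi, rfl⟩ := hz.argAt_args.1 h1
    obtain rfl := Fin.ext hi
    have := hR''.append 0
    rw [Nat.add_zero, h2] at this
    obtain rfl : _ = _ := by simpa using this
    exact ⟨_, hl, rfl⟩
  · rintro ⟨i, hl, rfl⟩
    obtain ⟨q, hq, hx, R'', -, hR''⟩ := hto hl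
    rw [Literal.body, List.append_assoc] at hR''
    refine ⟨p, ⟨hp, hC, hCx⟩, q, hq, hx, i, _, (hR''.fieldsTo_sym rfl).2 ⟨rfl, rfl⟩,
      hz.argAt_args.2 ⟨i, rfl, rfl⟩, ?_⟩
    have := hR''.append 0
    simpa using this
  · rintro ⟨p', ⟨hp', hC', -⟩, q, hq, hx, j, e, hf, h1, h2⟩
    obtain rfl := under_unique hp hp' hC hC'
    obtain ⟨l, hl, hlx, R'', -, hR''⟩ := hof hq hx rfl
    cases l <;> simp only [Literal.head, Sum.inl.injEq, reduceCtorEq] at hlx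
    rw [Literal.body, List.append_assoc] at hR''
    obtain ⟨h, rfl⟩ := (hR''.fieldsTo_sym (by rfl)).1 hf
    obtain ⟨rfl, -⟩ := List.cons.inj h
    obtain ⟨i, hi, rfl⟩ := hz.argAt_args.1 h1
    obtain rfl := Fin.ext hi
    have := hR''.append 0
    rw [Nat.add_zero, h2] at this
    obtain rfl : _ = _ := by simpa using this
    exact ⟨_, hl, rfl⟩
  · rintro ⟨i, hl, rfl⟩
    obtain ⟨q, hq, hx, R'', -, hR''⟩ := hto hl
    rw [Literal.body, List.append_assoc] at hR''
    refine ⟨p, ⟨hp, hC, hCx⟩, q, hq, hx, i, _, (hR''.fieldsTo_sym rfl).2 ⟨rfl, rfl⟩,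
      hz.argAt_args.2 ⟨i, rfl, rfl⟩, ?_⟩
    have := hR''.append 0
    simpa using this

theorem Rest.desc {args : Fin k → Fin n} {D : DNF A k} (hp : z[p]? = some (.inl .relAtom))
    (hR : Closes 3 R) (hz : Rest z p ((Atom.rel k args D).body m ++ R)) :
    (wordSys z).Desc p args D := by
  rw [Atom.body, List.append_assoc] at hz
  have hrank : ∀ c : List (Literal A k), rank (.inl .disjunct : Sym A ⊕ Letter A m) = 2 :=
    fun _ => rfl
  constructor
  · rintro C ⟨-, hC, hx⟩
    obtain ⟨c, hc, -, R', hR', hC'⟩ :=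
      hz.exists_of_under (fun _ => rfl) hrank rank_disjunctBody (rank_argsWord args) hR hC hx rfl
    exact ⟨c, hc, Rest.descC hp hz hC hx hR' hC'⟩
  · intro c hc
    obtain ⟨C, hC, hx, R', hR', hC'⟩ :=
      hz.exists_under (fun _ => rfl) hrank rank_disjunctBody (rank_argsWord args) hR hc
    exact ⟨C, ⟨hp, hC, hx⟩, Rest.descC hp hz hC hx hR' hC'⟩

end

theorem Atom.forallQ_notMem {n : ℕ} (a : Atom A n) :
    (.inl .forallQ : Sym A ⊕ Letter A m) ∉ a.enc.map Sum.inl := by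
  have hindex : ∀ i, Sym.forallQ ∉ encIndex (A := A) i := by simp [encIndex]
  have hlit : ∀ {k : ℕ} (l : Literal A k), Sym.forallQ ∉ l.enc := by
    intro k l
    cases l <;> simp [Literal.enc, hindex]
  cases a <;> simp [Atom.enc, DNF.enc, hindex, hlit]

/-- The word of a sentence with a certificate. -/
def inputWord (φ : Sentence A) (w : List (Letter A m)) : List (Sym A ⊕ Letter A m) :=
  φ.enc.map Sum.inl ++ w.map Sum.inr

/-- The word of the quantifiers. -/
def quantWord (m : ℕ) (φ : Sentence A) : List (Sym A ⊕ Letter A m) :=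
  List.ofFn fun i => .inl (if φ.univ i = true then Sym.forallQ else Sym.existsQ)

theorem inputWord_eq (φ : Sentence A) (w : List (Letter A m)) : inputWord φ w = quantWord m φ ++
    ((φ.atoms.flatMap fun a => a.enc.map Sum.inl) ++ w.map Sum.inr) := by
  simp [inputWord, quantWord, Sentence.enc, List.map_flatMap, List.map_ofFn, Function.comp_def]

theorem closes_map_inr (w : List (Letter A m)) : Closes 4 (w.map Sum.inr) := by
  intro y hy
  obtain ⟨d, -, rfl⟩ := List.mem_map.1 (List.mem_of_getElem? hy)
  exact le_rfl

theorem inputWord_atom_iff (φ : Sentence A) (w : List (Letter A m)) (q : ℕ) :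
    At (fun a => decide (rank a = 3)) (inputWord φ w) q ↔ ∃ l₁ a l₂, φ.atoms = l₁ ++ a :: l₂ ∧
      q = (quantWord m φ ++ l₁.flatMap fun a => a.enc.map Sum.inl).length := by
  rw [inputWord_eq, ← at_heads (bar := fun _ => false) Atom.map_enc]
  · refine (and_iff_left ?_).symm
    rintro x - ⟨a, -, ha⟩
    exact absurd ha (by simp)
  · simp [Atom.rank_head]
  · intro a y hy
    have := a.rank_body y hy
    simp only [decide_eq_false_iff_not, and_true]
    omega
  · rintro i ⟨a, ha, ha'⟩
    obtain ⟨d, -, rfl⟩ := List.mem_map.1 (List.mem_of_getElem? ha)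
    simp [rank] at ha'
  · intro y hy
    obtain ⟨i, rfl⟩ := List.mem_ofFn.1 hy
    cases φ.univ i <;> simp [rank]

theorem inputWord_split {φ : Sentence A} {w : List (Letter A m)} {l₁ l₂ : List (Atom A φ.n)}
    {a : Atom A φ.n} (h : φ.atoms = l₁ ++ a :: l₂) {q : ℕ}
    (hq : q = (quantWord m φ ++ l₁.flatMap fun a : Atom A φ.n => a.enc.map Sum.inl).length) :
    (inputWord φ w)[q]? = some (a.head m) ∧
      ∃ R, Closes 3 R ∧ Rest (inputWord φ w) q (a.body m ++ R) := by
  have heq : inputWord φ w = (quantWord m φ ++ l₁.flatMap fun a => a.enc.map Sum.inl) ++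
      a.head m :: (a.body m ++ ((l₂.flatMap fun a => a.enc.map Sum.inl) ++ w.map Sum.inr)) := by
    rw [inputWord_eq, h]
    simp [Atom.map_enc]
  subst hq
  refine ⟨?_, _, Closes.flatMap_append (l := l₂) Atom.map_enc Atom.rank_head fun y hy =>
    (Nat.le_succ 3).trans (closes_map_inr w y hy), rest_of_eq heq⟩
  rw [heq, List.getElem?_append_right le_rfl]
  simp

theorem exists_atom_of_at {φ : Sentence A} {w : List (Letter A m)} {q : ℕ}
    {x : Sym A ⊕ Letter A m} (hx : (inputWord φ w)[q]? = some x) (hr : rank x = 3) :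
    ∃ a ∈ φ.atoms, a.head m = x ∧ ∃ R, Closes 3 R ∧ Rest (inputWord φ w) q (a.body m ++ R) := by
  obtain ⟨l₁, a, l₂, h1, h2⟩ := (inputWord_atom_iff φ w q).1 ⟨x, hx, by simpa using hr⟩
  obtain ⟨h3, h4⟩ := inputWord_split (w := w) h1 h2
  rw [hx] at h3
  exact ⟨a, by simp [h1], (Option.some.inj h3).symm, h4⟩

theorem exists_at_of_atom {φ : Sentence A} (w : List (Letter A m)) {a : Atom A φ.n}
    (ha : a ∈ φ.atoms) : ∃ q, (inputWord φ w)[q]? = some (a.head m) ∧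
      ∃ R, Closes 3 R ∧ Rest (inputWord φ w) q (a.body m ++ R) := by
  obtain ⟨l₁, l₂, h⟩ := List.mem_iff_append.1 ha
  exact ⟨_, inputWord_split h rfl⟩

theorem lt_of_inputWord_inl {φ : Sentence A} {w : List (Letter A m)} {q : ℕ} {x : Sym A}
    (hx : (inputWord φ w)[q]? = some (.inl x)) : q < φ.enc.length := by
  by_contra hq
  rw [inputWord, List.getElem?_append_right (by simpa using hq)] at hx
  obtain ⟨d, -, hd⟩ := List.mem_map.1 (List.mem_of_getElem? hx)
  exact absurd hd (by simp)

/-- Quantifiers stand at the beginning of the word, so variable `y` is represented by position `y`,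
and atoms and disjuncts by the positions of their first letters. No letter of the certificate can be
confused with these. -/
theorem represents_inputWord (φ : Sentence A) (w : List (Letter A m)) :
    (wordSys (inputWord φ w)).Represents φ φ.enc.length := by
  have hn : φ.n ≤ φ.enc.length := by simp [Sentence.enc]
  have hrel : ∀ p, (inputWord φ w)[p]? = some (.inl .relAtom) →
      ∃ (k : ℕ) (args : Fin k → Fin φ.n) (D : DNF A k),
        Atom.rel k args D ∈ φ.atoms ∧ (wordSys (inputWord φ w)).Desc p args D := by
    intro p hp
    obtain ⟨a, ha, hx, R, hR, hz⟩ := exists_atom_of_at hp rfl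
    cases a with
    | eq i j => simp [Atom.head] at hx
    | rel k args D => exact ⟨k, args, D, ha, Rest.desc hp hR hz⟩
  have hdesc : ∀ {p C : ℕ}, (inputWord φ w)[p]? = some (.inl .relAtom) →
      Under 3 (inputWord φ w) p C → (inputWord φ w)[C]? = some (.inl .disjunct) →
      ∃ (k : ℕ) (args : Fin k → Fin φ.n) (c : List (Literal A k)),
        (wordSys (inputWord φ w)).DescC C args c := by
    intro p C hp hC hx
    obtain ⟨k, args, D, -, hD⟩ := hrel p hp
    obtain ⟨c, -, hc⟩ := hD.of_dj C ⟨hp, hC, hx⟩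
    exact ⟨k, args, c, hc⟩
  have hlt : ∀ {k : ℕ} (args : Fin k → Fin φ.n) (i : Fin k), (args i : ℕ) < φ.enc.length :=
    fun args i => (args i).2.trans_le hn
  refine ⟨hn, ⟨fun p C h => lt_of_inputWord_inl h.2.2, ?_, ?_, ?_, ?_⟩, fun y => ⟨fun h => ?_, ?_⟩,
    fun y y' => ⟨?_, ?_⟩, hrel, fun k args D ha => ?_⟩
  · rintro C y y' h
    obtain ⟨p, ⟨hp, hC, hx⟩, -⟩ := id h
    obtain ⟨k, args, c, hc⟩ := hdesc hp hC hx
    obtain ⟨i, j, -, rfl, rfl⟩ := (hc.eq _ _).1 h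
    exact ⟨hlt args i, hlt args j⟩
  · rintro C y y' h
    obtain ⟨p, ⟨hp, hC, hx⟩, -⟩ := id h
    obtain ⟨k, args, c, hc⟩ := hdesc hp hC hx
    obtain ⟨i, j, -, rfl, rfl⟩ := (hc.ne _ _).1 h
    exact ⟨hlt args i, hlt args j⟩
  · rintro C y a h
    obtain ⟨p, ⟨hp, hC, hx⟩, -⟩ := id h
    obtain ⟨k, args, c, hc⟩ := hdesc hp hC hx
    obtain ⟨i, -, rfl⟩ := (hc.eqC _ _).1 h
    exact hlt args i
  · rintro C y a h
    obtain ⟨p, ⟨hp, hC, hx⟩, -⟩ := id h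
    obtain ⟨k, args, c, hc⟩ := hdesc hp hC hx
    obtain ⟨i, -, rfl⟩ := (hc.neC _ _).1 h
    exact hlt args i
  · change (inputWord φ w)[y]? = some (.inl .forallQ) at h
    have hy : y < φ.n := by
      by_contra hy
      rw [inputWord_eq, List.getElem?_append_right (by simpa [quantWord] using hy)] at h
      rcases List.mem_append.1 (List.mem_of_getElem? h) with h | h
      · obtain ⟨a, -, ha⟩ := List.mem_flatMap.1 h
        exact absurd ha (Atom.forallQ_notMem a)
      · obtain ⟨d, -, hd⟩ := List.mem_map.1 h
        exact absurd hd (by simp)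
    refine ⟨hy, ?_⟩
    rw [inputWord_eq, List.getElem?_append_left (by simpa [quantWord] using hy), quantWord,
      List.getElem?_ofFn, dif_pos hy] at h
    by_contra hq
    simp [hq] at h
  · rintro ⟨hy, hq⟩
    change (inputWord φ w)[y]? = some (.inl .forallQ)
    rw [inputWord_eq, List.getElem?_append_left (by simpa [quantWord] using hy), quantWord,
      List.getElem?_ofFn, dif_pos hy, hq]
    rfl
  · rintro ⟨q, e, hx, hf⟩
    obtain ⟨a, ha, hax, R, hR, hz⟩ := exists_atom_of_at hx rfl
    cases a with
    | rel k args D => simp [Atom.head] at hax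
    | eq i j =>
      rw [Atom.body] at hz
      obtain ⟨h, -⟩ := (hz.fieldsTo_sym (by rfl)).1 hf
      obtain ⟨rfl, h'⟩ := List.cons.inj h
      obtain ⟨rfl, -⟩ := List.cons.inj h'
      exact ⟨i, j, ha, rfl, rfl⟩
  · rintro ⟨i, j, ha, rfl, rfl⟩
    obtain ⟨q, hx, R, -, hz⟩ := exists_at_of_atom w ha
    rw [Atom.body] at hz
    exact ⟨q, _, hx, (hz.fieldsTo_sym rfl).2 ⟨rfl, rfl⟩⟩
  · obtain ⟨p, hp, R, hR, hz⟩ := exists_at_of_atom w ha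
    exact ⟨p, lt_of_inputWord_inl hp, hp, Rest.desc hp hR hz⟩

end WordStructure


section Records

variable {A : Type} {m : ℕ}

/-! ### Records in words -/

/-- The number of indices in a record. -/
def Tag.arity : Tag A m → ℕ
  | .un _ _ => 1
  | .out _ _ => 1
  | .inn _ _ _ => m + 2

/-- The record at `p` has the tag `τ` and the indices `is`. -/
def RecordAt (z : List (Sym A ⊕ Letter A m)) (p : ℕ) (τ : Tag A m) (is : List ℕ) : Prop :=
  is.length = τ.arity ∧ z[p]? = some (.inr (.head τ)) ∧ ∃ e, FieldsTo z p is e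

/-- The word of an index in a certificate. -/
def letterIndex (A : Type) (m v : ℕ) : List (Letter A m) := List.replicate v .tick ++ [.endIndex]

/-- The word of a record. -/
def recordWord (r : Tag A m × List ℕ) : List (Letter A m) :=
  .head r.1 :: r.2.flatMap (letterIndex A m)

theorem map_recordWord (r : Tag A m × List ℕ) : (recordWord r).map Sum.inr =
    (.inr (.head r.1) : Sym A ⊕ Letter A m) ::
      r.2.flatMap (indexWord (.inr .tick) (.inr .endIndex)) := by
  simp only [recordWord, letterIndex, List.map_cons, List.map_flatMap, List.map_append,
    List.map_replicate, List.map_nil]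
  rfl

theorem length_recordWord_le (r : Tag A m × List ℕ) {N : ℕ} (h : ∀ i ∈ r.2, i < N) :
    (recordWord r).length ≤ 1 + r.2.length * N := by
  have : ∀ l : List ℕ, (∀ i ∈ l, i < N) →
      (l.flatMap (letterIndex A m)).length ≤ l.length * N := by
    intro l hl
    induction l with
    | nil => simp
    | cons i l ih =>
      have h1 := ih fun j hj => hl j (by simp [hj])
      have h2 := hl i (by simp)
      simp only [List.flatMap_cons, List.length_append, letterIndex, List.length_replicate,
        List.length_cons, List.length_nil] at h1 ⊢
      rw [Nat.add_mul]
      omega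
  have := this r.2 h
  simp only [recordWord, List.length_cons]
  omega

/-- The letter starts a record. -/
def isHead : Sym A ⊕ Letter A m → Bool
  | .inr (.head _) => true
  | _ => false

/-- Record heads occur nowhere else, and the tag fixes the number of indices, so a list of records
can be recovered from its word. -/
theorem recordAt_iff (x : List (Sym A)) {l : List (Tag A m × List ℕ)}
    (hl : ∀ r ∈ l, r.2.length = r.1.arity) (p : ℕ) (τ : Tag A m) (is : List ℕ) :
    RecordAt (x.map Sum.inl ++ (l.flatMap recordWord).map Sum.inr) p τ is ↔
      ∃ l₁ l₂, l = l₁ ++ (τ, is) :: l₂ ∧ p = x.length + (l₁.flatMap recordWord).length := by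
  have hmap : ∀ l : List (Tag A m × List ℕ), (l.flatMap recordWord).map Sum.inr =
      l.flatMap fun r => (recordWord r).map (Sum.inr : _ → Sym A ⊕ Letter A m) :=
    fun l => List.map_flatMap
  have hlen : ∀ l : List (Tag A m × List ℕ),
      (l.flatMap fun r => (recordWord r).map (Sum.inr : _ → Sym A ⊕ Letter A m)).length =
        (l.flatMap recordWord).length := fun l => by rw [← hmap, List.length_map]
  have key := at_heads (t := isHead) (bar := fun _ => false) map_recordWord (R := [])
    (fun a => by simp [isHead]) (fun r y hy => by
      obtain ⟨v, -, hy⟩ := List.mem_flatMap.1 hy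
      rcases List.mem_append.1 hy with hy | hy
      · rw [List.eq_of_mem_replicate hy]; simp [isHead]
      · rw [List.mem_singleton.1 hy]; simp [isHead])
    (fun i hi => absurd hi.lt_length (by simp)) l (x.map Sum.inl) (fun y hy => by
      obtain ⟨a, -, rfl⟩ := List.mem_map.1 hy
      simp [isHead]) p
  have hnobar : ∀ z : List (Sym A ⊕ Letter A m), ∀ x ≤ p, ¬ At (fun _ => false) z x := by
    rintro z x - ⟨a, -, ha⟩
    exact absurd ha (by simp)
  rw [List.append_nil, and_iff_left (hnobar _)] at key
  rw [hmap]
  constructor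
  · rintro ⟨h1, h2, e, h3⟩
    obtain ⟨l₁, r, l₂, rfl, rfl⟩ := key.1 ⟨_, h2, rfl⟩
    have hz := rest_of_eq (z := x.map Sum.inl ++ (l₁ ++ r :: l₂).flatMap fun r =>
        (recordWord r).map (Sum.inr : _ → Sym A ⊕ Letter A m))
      (Z := x.map Sum.inl ++ l₁.flatMap fun r => (recordWord r).map Sum.inr) (a := .inr (.head r.1))
      (T := r.2.flatMap (indexWord (.inr .tick) (.inr .endIndex)) ++
        l₂.flatMap fun r => (recordWord r).map Sum.inr) (by simp [map_recordWord])
    have hτ : r.1 = τ := by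
      rw [List.flatMap_append, ← List.append_assoc, List.getElem?_append_right le_rfl,
        List.flatMap_cons, map_recordWord] at h2
      simpa using h2
    have := ((hz.fieldsTo_iff rfl rfl) (by rw [h1, hl r (by simp), hτ])).1 h3
    refine ⟨l₁, l₂, ?_, by rw [List.length_append, hlen, List.length_map]⟩
    rw [← hτ, this.1]
  · rintro ⟨l₁, l₂, rfl, rfl⟩
    have hz := rest_of_eq (z := x.map Sum.inl ++ (l₁ ++ (τ, is) :: l₂).flatMap fun r =>
        (recordWord r).map (Sum.inr : _ → Sym A ⊕ Letter A m))
      (Z := x.map Sum.inl ++ l₁.flatMap fun r => (recordWord r).map Sum.inr) (a := .inr (.head τ))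
      (T := is.flatMap (indexWord (.inr .tick) (.inr .endIndex)) ++
        l₂.flatMap fun r => (recordWord r).map Sum.inr) (by simp [map_recordWord])
    have hp : x.length + (l₁.flatMap recordWord).length = (x.map Sum.inl ++ l₁.flatMap fun r =>
        (recordWord r).map (Sum.inr : _ → Sym A ⊕ Letter A m)).length := by
      rw [List.length_append, hlen, List.length_map]
    rw [hp]
    refine ⟨hl (τ, is) (by simp), ?_, _, (hz.fieldsTo_iff rfl rfl rfl).2 ⟨rfl, rfl⟩⟩
    rw [List.flatMap_append, ← List.append_assoc, List.getElem?_append_right le_rfl,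
      List.flatMap_cons, map_recordWord]
    simp

/-! ### Definability -/

theorem IsVar.init {k : ℕ} {f : (Fin k → ℕ) → ℕ} (hf : IsVar f) :
    IsVar fun e : Fin (k + 1) → ℕ => f (Fin.init e) := by
  obtain ⟨i, rfl⟩ := hf
  exact ⟨i.castSucc, rfl⟩

theorem IsVar.last {k : ℕ} : IsVar fun e : Fin (k + 1) → ℕ => e (Fin.last k) := ⟨_, rfl⟩

theorem IsVar.comp {k k' : ℕ} {f : (Fin k → ℕ) → ℕ} (hf : IsVar f)
    {g : (Fin k' → ℕ) → Fin k → ℕ} (hg : ∀ i, IsVar fun e => g e i) :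
    IsVar fun e => f (g e) := by
  obtain ⟨i, rfl⟩ := hf
  exact hg i

theorem IsVar.lt {k n : ℕ} {f : (Fin k → ℕ) → ℕ} (hf : IsVar f) {e : Fin k → ℕ}
    (he : ∀ i, e i < n) : f e < n := by
  obtain ⟨i, rfl⟩ := hf
  exact he i

namespace Definable

theorem allVec {L : Type} {k n : ℕ} {P : List L → (Fin k → ℕ) → (Fin n → ℕ) → Prop}
    (hP : ∀ (k' : ℕ) (f : (Fin k' → ℕ) → Fin k → ℕ) (w : (Fin k' → ℕ) → Fin n → ℕ),
      (∀ i, IsVar fun e => f e i) → (∀ j, IsVar fun e => w e j) →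
      Definable fun z e => P z (f e) (w e)) :
    Definable fun z e => ∀ w : Fin n → ℕ, (∀ j, w j < z.length) → P z e w :=
  (exVec (P := fun z e w => ¬ P z e w) fun k' f w hf hw => (hP k' f w hf hw).not).not.congr
    fun z e _ => by simp

theorem letter {L : Type} {k : ℕ} (a : L) {f : (Fin k → ℕ) → ℕ} (hf : IsVar f) :
    Definable fun (z : List L) e => z[f e]? = some a := by
  classical
  exact (sym (fun b => decide (b = a)) hf).congr fun z e _ => by simp

variable {k : ℕ} {f g h : (Fin k → ℕ) → ℕ}

theorem under (n : ℕ) (hf : IsVar f) (hg : IsVar g) :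
    Definable fun (z : List (Sym A ⊕ Letter A m)) e => Under n z (f e) (g e) := by
  refine congr (P := fun z e => f e < g e ∧ ∀ x, x < z.length → f e < x → x ≤ g e →
      ¬ At (fun a => decide (n ≤ rank a)) z x)
    ((lt hf hg).and (all ((lt hf.init .last).imp ((le .last hg.init).imp (sym _ .last).not))))
    fun z e he => and_congr_right fun _ => forall_congr' fun x => ⟨fun h h1 h2 => ?_, fun h _ => h⟩
  exact h (h2.trans_lt (hg.lt he)) h1 h2

/-- The arithmetic condition `e = s + 1 + v` is expressed by comparing two counts: the positions
strictly between `s` and `e`, and those below `v`. This is where counting is needed beyond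
first-order logic. -/
theorem run (hf : IsVar f) (hg : IsVar g) (hh : IsVar h) :
    Definable fun (z : List (Sym A ⊕ Letter A m)) e => Run z (f e) (g e) (h e) := by
  refine congr (P := fun z e => f e < g e ∧ At isEnd z (g e) ∧
      (∀ x, x < z.length → f e < x → x < g e → At isTick z x) ∧
      posCount z.length (fun x => f e < x ∧ x < g e) = posCount z.length (fun x => x < h e))
    ((lt hf hg).and ((sym _ hg).and ((all ((lt hf.init .last).imp
      ((lt .last hg.init).imp (sym _ .last)))).and
      (countEq ((lt hf.init .last).and (lt .last hg.init)) (lt .last hh.init))))) fun z e he => ?_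
  have hge := hg.lt he
  have hcount : posCount z.length (fun x => f e < x ∧ x < g e) = g e - f e - 1 := by
    classical
    have : (Finset.range z.length).filter (fun x => f e < x ∧ x < g e) =
        Finset.Ioo (f e) (g e) := by
      ext x
      simp only [Finset.mem_filter, Finset.mem_range, Finset.mem_Ioo]
      omega
    calc _ = ((Finset.range z.length).filter (fun x => f e < x ∧ x < g e)).card := by
          unfold posCount; congr
      _ = _ := by rw [this, Nat.card_Ioo]
  rw [hcount, posCount_lt (hh.lt he).le]
  constructor
  · rintro ⟨h1, h2, h3, h4⟩
    exact ⟨by omega, h2, fun x hx hx' => h3 x (by omega) hx hx'⟩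
  · rintro ⟨h1, h2, h3⟩
    exact ⟨by omega, h2, fun x _ => h3 x, by omega⟩

theorem fieldsTo {fs : List ((Fin k → ℕ) → ℕ)} (hfs : ∀ f ∈ fs, IsVar f) (hf : IsVar f)
    (hg : IsVar g) : Definable fun (z : List (Sym A ⊕ Letter A m)) e =>
      FieldsTo z (f e) (fs.map fun h => h e) (g e) := by
  induction hn : fs.length generalizing k fs f g with
  | zero =>
    obtain rfl := List.length_eq_zero_iff.1 hn
    exact Definable.eq hg hf
  | succ n ih =>
    obtain ⟨h, fs, rfl⟩ := List.exists_cons_of_length_eq_add_one hn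
    refine congr (P := fun z e => ∃ x, x < z.length ∧ (Run z (f e) x (h e) ∧
        FieldsTo z x (fs.map fun h => h e) (g e)))
      (ex ((run hf.init .last (hfs h (by simp)).init).and ?_)) fun z e _ => ?_
    · have := ih (fs := fs.map fun h e => h (Fin.init e)) (f := fun e => e (Fin.last k))
        (g := fun e => g (Fin.init e)) (by
          intro h' hh'
          obtain ⟨h, hh, rfl⟩ := List.mem_map.1 hh'
          exact (hfs h (by simp [hh])).init) .last hg.init (by simpa using hn)
      simpa only [List.map_map, Function.comp_def] using this
    · exact exists_congr fun x => ⟨fun h => h.2, fun h => ⟨h.1.lt.2, h⟩⟩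

theorem skips (hf : IsVar f) (hg : IsVar g) (hh : IsVar h) :
    Definable fun (z : List (Sym A ⊕ Letter A m)) e => Skips z (f e) (g e) (h e) := by
  refine congr (P := fun z e => f e ≤ g e ∧ (g e = f e ∨ At isEnd z (g e)) ∧
      (∀ x, x < z.length → f e < x → x ≤ g e → At isTick z x ∨ At isEnd z x) ∧
      posCount z.length (fun x => f e < x ∧ x ≤ g e ∧ At isEnd z x) =
        posCount z.length (fun x => x < h e))
    ((le hf hg).and (((Definable.eq hg hf).or (sym _ hg)).and ((all ((lt hf.init .last).imp
      ((le .last hg.init).imp ((sym _ .last).or (sym _ .last))))).and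
      (countEq ((lt hf.init .last).and ((le .last hg.init).and (sym _ .last)))
        (lt .last hh.init))))) fun z e he => ?_
  rw [posCount_lt (hh.lt he).le]
  refine and_congr_right fun _ => and_congr_right fun _ => and_congr_left fun _ =>
    forall_congr' fun x => ⟨fun h h1 h2 => ?_, fun h _ => h⟩
  exact h (h2.trans_lt (hg.lt he)) h1 h2

theorem argAt (hf : IsVar f) (hg : IsVar g) (hh : IsVar h) :
    Definable fun (z : List (Sym A ⊕ Letter A m)) e => ArgAt z (f e) (g e) (h e) := by
  refine congr (P := fun z e => ∃ s, s < z.length ∧ ∃ x, x < z.length ∧ (Skips z (f e) s (g e) ∧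
      Run z s x (h e)))
    (ex (ex ((skips hf.init.init IsVar.last.init hg.init.init).and
      (run IsVar.last.init .last hh.init.init)))) fun z e _ => exists_congr fun s => ?_
  constructor
  · rintro ⟨-, x, -, h⟩
    exact ⟨x, h⟩
  · rintro ⟨x, h⟩
    have h1 := h.2.lt
    have h2 := h.2.1
    exact ⟨by omega, x, h1.2, h⟩

theorem eqA (hf : IsVar f) (hg : IsVar g) : Definable fun (z : List (Sym A ⊕ Letter A m)) e =>
    (wordSys z).eqA (f e) (g e) := by
  refine congr (P := fun z e => ∃ q, q < z.length ∧ ∃ x, x < z.length ∧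
      (z[q]? = some (.inl .eqAtom) ∧ FieldsTo z q [f e, g e] x))
    (ex (ex ((letter _ IsVar.last.init).and (fieldsTo
      (fs := [fun e => f (Fin.init (Fin.init e)), fun e => g (Fin.init (Fin.init e))])
      (by simp [hf.init.init, hg.init.init]) IsVar.last.init .last)))) fun z e _ => ?_
  constructor
  · rintro ⟨q, -, x, -, h⟩
    exact ⟨q, x, h⟩
  · rintro ⟨q, x, h1, h2⟩
    obtain ⟨x', -, x'', h3, rfl⟩ := id h2
    exact ⟨q, (List.getElem?_eq_some_iff.1 h1).1, x, h3.lt.2, h1, h2⟩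

theorem disjunctAt (hf : IsVar f) (hg : IsVar g) :
    Definable fun (z : List (Sym A ⊕ Letter A m)) e => DisjunctAt z (f e) (g e) :=
  (letter _ hf).and ((under 3 hf hg).and (letter _ hg))

theorem lit_var (a : Sym A ⊕ Letter A m) (hf : IsVar f) (hg : IsVar g) (hh : IsVar h) :
    Definable fun (z : List (Sym A ⊕ Letter A m)) e => ∃ p, DisjunctAt z p (f e) ∧
      ∃ q, Under 2 z (f e) q ∧ z[q]? = some a ∧
        ∃ j j' x, FieldsTo z q [j, j'] x ∧ ArgAt z p j (g e) ∧ ArgAt z p j' (h e) := by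
  refine congr (P := fun z e => ∃ p, p < z.length ∧ (DisjunctAt z p (f e) ∧
      ∃ q, q < z.length ∧ (Under 2 z (f e) q ∧ z[q]? = some a ∧ ∃ j, j < z.length ∧
        ∃ j', j' < z.length ∧ ∃ x, x < z.length ∧
          (FieldsTo z q [j, j'] x ∧ ArgAt z p j (g e) ∧ ArgAt z p j' (h e)))))
    (ex ((disjunctAt .last hf.init).and (ex ((under 2 hf.init.init .last).and
      ((letter a .last).and (ex (ex (ex ((fieldsTo (fs := [fun e => Fin.init (Fin.init e)
        (Fin.last _), fun e => Fin.init e (Fin.last _)])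
        (by simp [IsVar.last.init, IsVar.last.init.init]) IsVar.last.init.init.init .last).and
        ((argAt IsVar.last.init.init.init.init IsVar.last.init.init hg.init.init.init.init.init).and
          (argAt IsVar.last.init.init.init.init IsVar.last.init
            hh.init.init.init.init.init)))))))))))
    fun z e _ => ?_
  constructor
  · rintro ⟨p, -, h1, q, -, h2, h3, j, -, j', -, x, -, h4⟩
    exact ⟨p, h1, q, h2, h3, j, j', x, h4⟩
  · rintro ⟨p, h1, q, h2, h3, j, j', x, h4, h5⟩
    obtain ⟨x', -, x'', h6, rfl⟩ := id h4
    exact ⟨p, (List.getElem?_eq_some_iff.1 h1.1).1, h1, q, (List.getElem?_eq_some_iff.1 h3).1, h2,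
      h3, j, h4.lt _ (by simp), j', h4.lt _ (by simp), x, h6.lt.2, h4, h5⟩

/-- The position `x + 1` is not a variable; it is introduced as the least position above `x`. -/
theorem lit_const (a b : Sym A ⊕ Letter A m) (hf : IsVar f) (hg : IsVar g) :
    Definable fun (z : List (Sym A ⊕ Letter A m)) e => ∃ p, DisjunctAt z p (f e) ∧
      ∃ q, Under 2 z (f e) q ∧ z[q]? = some a ∧
        ∃ j x, FieldsTo z q [j] x ∧ ArgAt z p j (g e) ∧ z[x + 1]? = some b := by
  refine congr (P := fun z e => ∃ p, p < z.length ∧ (DisjunctAt z p (f e) ∧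
      ∃ q, q < z.length ∧ (Under 2 z (f e) q ∧ z[q]? = some a ∧ ∃ j, j < z.length ∧
        ∃ x, x < z.length ∧ ∃ y, y < z.length ∧
          (FieldsTo z q [j] x ∧ ArgAt z p j (g e) ∧ (x < y ∧
            (∀ i, i < z.length → i < y → i ≤ x) ∧ z[y]? = some b)))))
    (ex ((disjunctAt .last hf.init).and (ex ((under 2 hf.init.init .last).and
      ((letter a .last).and (ex (ex (ex ((fieldsTo (fs := [fun e => Fin.init (Fin.init e)
        (Fin.last _)]) (by simp [IsVar.last.init.init]) IsVar.last.init.init.init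
        IsVar.last.init).and
        ((argAt IsVar.last.init.init.init.init IsVar.last.init.init hg.init.init.init.init.init).and
          ((lt IsVar.last.init .last).and ((all ((lt .last IsVar.last.init).imp
            (le .last IsVar.last.init.init))).and (letter b .last))))))))))))) fun z e _ => ?_
  constructor
  · rintro ⟨p, -, h1, q, -, h2, h3, j, -, x, -, y, hy, h4, h5, h6, h7, h8⟩
    refine ⟨p, h1, q, h2, h3, j, x, h4, h5, ?_⟩
    obtain rfl : y = x + 1 := by
      by_contra hne
      have := h7 (x + 1) (by omega) (by omega)
      omega
    exact h8
  · rintro ⟨p, h1, q, h2, h3, j, x, h4, h5, h6⟩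
    have hx := (List.getElem?_eq_some_iff.1 h6).1
    exact ⟨p, (List.getElem?_eq_some_iff.1 h1.1).1, h1, q, (List.getElem?_eq_some_iff.1 h3).1, h2,
      h3, j, h4.lt _ (by simp), x, by omega, x + 1, hx, h4, h5, by omega, fun i _ hi => by omega, h6⟩

theorem recordAt (τ : Tag A m) {fs : List ((Fin k → ℕ) → ℕ)} (hfs : ∀ f ∈ fs, IsVar f)
    (hf : IsVar f) : Definable fun (z : List (Sym A ⊕ Letter A m)) e =>
      RecordAt z (f e) τ (fs.map fun h => h e) := by
  refine congr (P := fun z e => fs.length = τ.arity ∧ (z[f e]? = some (.inr (.head τ)) ∧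
      ∃ x, x < z.length ∧ FieldsTo z (f e) (fs.map fun h => h e) x))
    ((const _).and ((letter _ hf).and (ex ?_))) fun z e _ => ?_
  · have := fieldsTo (A := A) (m := m) (fs := fs.map fun h (e : Fin (k + 1) → ℕ) => h (Fin.init e))
      (f := fun e => f (Fin.init e)) (g := fun e => e (Fin.last k)) (by
        intro h' hh'
        obtain ⟨h, hh, rfl⟩ := List.mem_map.1 hh'
        exact (hfs h hh).init) hf.init .last
    simpa only [List.map_map, Function.comp_def] using this
  · unfold RecordAt
    rw [List.length_map]
    refine and_congr_right fun _ => and_congr_right fun h => exists_congr fun x =>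
      ⟨fun h => h.2, fun h' => ⟨h'.lt_length (List.getElem?_eq_some_iff.1 h).1, h'⟩⟩

theorem before (τ : Tag A m) {fs : List ((Fin k → ℕ) → ℕ)} (hfs : ∀ f ∈ fs, IsVar f)
    (hf : IsVar f) : Definable fun (z : List (Sym A ⊕ Letter A m)) e =>
      Sys.Before (RecordAt z) z.length (f e) τ (fs.map fun h => h e) := by
  refine ex ((lt .last hf.init).and ?_)
  have := recordAt (A := A) (m := m) τ
    (fs := fs.map fun h (e : Fin (k + 1) → ℕ) => h (Fin.init e))
    (f := fun e => e (Fin.last k)) (by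
      intro h' hh'
      obtain ⟨h, hh, rfl⟩ := List.mem_map.1 hh'
      exact (hfs h hh).init) .last
  simpa only [List.map_map, Function.comp_def] using this

theorem before_one (τ : Tag A m) (hf : IsVar f) (hg : IsVar g) :
    Definable fun (z : List (Sym A ⊕ Letter A m)) e =>
      Sys.Before (RecordAt z) z.length (f e) τ [g e] :=
  before τ (fs := [g]) (by simpa using hg) hf

variable {w : (Fin k → ℕ) → Fin m → ℕ}

theorem before_inn (τ : Tag A m) (hf : IsVar f) (hg : IsVar g) (hh : IsVar h)
    (hw : ∀ j, IsVar fun e => w e j) : Definable fun (z : List (Sym A ⊕ Letter A m)) e =>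
      Sys.Before (RecordAt z) z.length (f e) τ (g e :: h e :: List.ofFn (w e)) := by
  have := before τ (fs := g :: h :: List.ofFn fun j e => w e j) (f := f) (by
    simp only [List.mem_cons, List.mem_ofFn]
    rintro _ (rfl | rfl | ⟨j, rfl⟩)
    exacts [hg, hh, hw j]) hf
  simpa only [List.map_cons, List.map_ofFn, Function.comp_def] using this

theorem recordAt_one (τ : Tag A m) (hf : IsVar f) (hg : IsVar g) :
    Definable fun (z : List (Sym A ⊕ Letter A m)) e => RecordAt z (f e) τ [g e] :=
  recordAt τ (fs := [g]) (by simpa using hg) hf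

theorem recordAt_inn (τ : Tag A m) (hf : IsVar f) (hg : IsVar g) (hh : IsVar h)
    (hw : ∀ j, IsVar fun e => w e j) : Definable fun (z : List (Sym A ⊕ Letter A m)) e =>
      RecordAt z (f e) τ (g e :: h e :: List.ofFn (w e)) := by
  have := recordAt τ (fs := g :: h :: List.ofFn fun j e => w e j) (f := f) (by
    simp only [List.mem_cons, List.mem_ofFn]
    rintro _ (rfl | rfl | ⟨j, rfl⟩)
    exacts [hg, hh, hw j]) hf
  simpa only [List.map_cons, List.map_ofFn, Function.comp_def] using this

theorem justOut [Finite A] (s : Bool) (a : A) (hf : IsVar f) (hg : IsVar g) :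
    Definable fun (z : List (Sym A ⊕ Letter A m)) e => (wordSys z).JustOut z.length
      (fun b x => Sys.Before (RecordAt z) z.length (f e) (.un s b) [x])
      (fun b x => Sys.Before (RecordAt z) z.length (f e) (.out s b) [x])
      (fun β b C x (w : Fin m → ℕ) =>
        Sys.Before (RecordAt z) z.length (f e) (.inn s β b) (C :: x :: List.ofFn w)) a (g e) := by
  refine ((letter _ hg).and (exFin fun b => (const _).and (before_one _ hf hg))).or
    ((ex (((eqA hg.init .last).or (eqA .last hg.init)).and (before_one _ hf.init .last))).or
    (ex ((letter _ .last).and (all ((disjunctAt IsVar.last.init .last).imp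
      (exVec fun k' f' w hf' hw => allFin fun β => ?_))))))
  exact before_inn _ (hf.init.init.comp hf') (IsVar.last.comp hf') (hg.init.init.comp hf') hw

theorem justInn [Finite A] (s : Bool) (β : Fin m → A) (a : A) (hf : IsVar f) (hg : IsVar g)
    (hh : IsVar h) (hw : ∀ j, IsVar fun e => w e j) :
    Definable fun (z : List (Sym A ⊕ Letter A m)) e => (wordSys z).JustInn z.length
      (fun b x => Sys.Before (RecordAt z) z.length (f e) (.out s b) [x])
      (fun β b C x (w : Fin m → ℕ) =>
        Sys.Before (RecordAt z) z.length (f e) (.inn s β b) (C :: x :: List.ofFn w))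
      β a (g e) (h e) (w e) := by
  have hw' : ∀ j, IsVar fun e : Fin (k + 1) → ℕ => w (Fin.init e) j := fun j => (hw j).init
  exact (before_one _ hf hh).or <| (exFin fun j => (Definable.eq (hw j) hh).and (const _)).or <|
    (exFin fun b => (const _).and (lit_const _ _ hg hh)).or <| (lit_const _ _ hg hh).or <|
    (ex (((lit_var _ hg.init hh.init .last).or (lit_var _ hg.init .last hh.init)).and
      (before_inn _ hf.init hg.init .last hw'))).or <|
    (ex (((lit_var _ hg.init hh.init .last).or (lit_var _ hg.init .last hh.init)).and
      (allFin fun a' => (const _).imp (before_inn _ hf.init hg.init .last hw')))).or <|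
    ex (allFin fun a' => before_inn _ hf.init hg.init .last hw')

theorem refutes [Finite A] : Definable (k := 0) fun (z : List (Sym A ⊕ Letter A m)) _ =>
    (wordSys z).Refutes z.length (RecordAt z) := by
  refine and ?_ (and ?_ (and ?_ ?_))
  · exact allFin fun s => allFin fun a => allFin fun b => (const _).imp <| all <| all <| all <|
      ((recordAt_one _ IsVar.last.init.init .last).and (recordAt_one _ IsVar.last.init .last)).not
  · exact allFin fun s => allFin fun a => all <| all <|
      (recordAt_one _ IsVar.last.init .last).imp (justOut s a IsVar.last.init .last)
  · exact allFin fun s => allFin fun β => allFin fun a => all <| all <| all <| allVec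
      fun k' f w hf hw => (recordAt_inn _ (IsVar.last.init.init.comp hf) (IsVar.last.init.comp hf)
        (IsVar.last.comp hf) hw).imp (justInn s β a (IsVar.last.init.init.comp hf)
          (IsVar.last.init.comp hf) (IsVar.last.comp hf) hw)
  · exact ex <| (all <| (le .last IsVar.last.init).imp <| (letter _ .last).imp <| exFin fun a =>
      (ex (recordAt_one _ .last IsVar.last.init)).and
        (ex (recordAt_one _ .last IsVar.last.init))).and <| allFin fun a => exFin fun s =>
      ex (recordAt_one _ .last IsVar.last.init)

end Definable

end Records


section Verification

variable {A : Type} {m : ℕ}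

/-! ### The structure of a sentence does not depend on the certificate -/

/-- Whatever follows a closed part does not influence where its blocks start, so the same block is
found at the same position in both words. -/
theorem Rest.under_transfer {X : Type*} {enc : X → List (Sym A ⊕ Letter A m)}
    {h : X → Sym A ⊕ Letter A m} {body : X → List (Sym A ⊕ Letter A m)}
    {R R' pre z z' : List (Sym A ⊕ Letter A m)} {n p q : ℕ} {l : List X}
    (henc : ∀ a, enc a = h a :: body a) (hh : ∀ a, rank (h a) = n)
    (hb : ∀ a, ∀ y ∈ body a, rank y < n) (hpre : ∀ y ∈ pre, rank y < n)
    (hR : Closes (n + 1) R) (hR' : Closes (n + 1) R')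
    (hz : Rest z p (pre ++ (l.flatMap enc ++ R))) (hz' : Rest z' p (pre ++ (l.flatMap enc ++ R')))
    (hq : Under (n + 1) z p q) {x : Sym A ⊕ Letter A m} (hx : z[q]? = some x) (hxn : rank x = n) :
    ∃ a ∈ l, (Under (n + 1) z' p q ∧ z'[q]? = some x) ∧ ∃ R₁ R₁', Closes n R₁ ∧ Closes n R₁' ∧
      Rest z q (body a ++ R₁) ∧ Rest z' q (body a ++ R₁') := by
  obtain ⟨l₁, a, l₂, rfl, rfl⟩ :=
    (hz.under_iff henc hh hb hpre hR).1 ⟨hq, x, hx, by simpa using hxn⟩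
  obtain ⟨h1, h2⟩ := hz.split henc
  obtain ⟨h1', h2'⟩ := hz'.split henc
  rw [hx] at h1
  rw [← h1] at h1'
  exact ⟨a, by simp, ⟨((hz'.under_iff henc hh hb hpre hR').2 ⟨l₁, a, l₂, rfl, rfl⟩).1, h1'⟩, _, _,
    Closes.flatMap_append henc hh fun y hy => (Nat.le_succ n).trans (hR y hy),
    Closes.flatMap_append henc hh fun y hy => (Nat.le_succ n).trans (hR' y hy), h2, h2'⟩

theorem disjunctAt_transfer {φ : Sentence A} {w : List (Letter A m)} (w' : List (Letter A m))
    {p C : ℕ} (h : DisjunctAt (inputWord φ w) p C) : DisjunctAt (inputWord φ w') p C ∧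
      ∃ (k : ℕ) (args : Fin k → Fin φ.n) (c : List (Literal A k)),
        (wordSys (inputWord φ w)).DescC C args c ∧ (wordSys (inputWord φ w')).DescC C args c := by
  obtain ⟨hp, hC, hx⟩ := h
  obtain ⟨l₁, a, l₂, h1, h2⟩ := (inputWord_atom_iff φ w p).1 ⟨_, hp, rfl⟩
  obtain ⟨h3, R, hR, hz⟩ := inputWord_split (w := w) h1 h2
  obtain ⟨h3', R', hR', hz'⟩ := inputWord_split (w := w') h1 h2
  rw [hp] at h3
  have hp' := h3'.trans h3.symm
  cases a with
  | eq i j => simp [Atom.head] at h3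
  | rel k args D =>
    rw [Atom.body, List.append_assoc] at hz hz'
    obtain ⟨c, -, ⟨hC', hx'⟩, R₁, R₁', hR₁, hR₁', hc, hc'⟩ := Rest.under_transfer (n := 2) (fun _ => rfl)
      (fun _ => rfl) rank_disjunctBody (rank_argsWord args) hR hR' hz hz' hC hx rfl
    exact ⟨⟨hp', hC', hx'⟩, k, args, c, Rest.descC hp hz hC hx hR₁ hc,
      Rest.descC hp' hz' hC' hx' hR₁' hc'⟩

theorem wordSys_le (φ : Sentence A) (w w' : List (Letter A m)) :
    (∀ p, (wordSys (inputWord φ w)).rel p → (wordSys (inputWord φ w')).rel p) ∧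
    (∀ p C, (wordSys (inputWord φ w)).dj p C → (wordSys (inputWord φ w')).dj p C) ∧
    (∀ C y y', (wordSys (inputWord φ w)).lEq C y y' → (wordSys (inputWord φ w')).lEq C y y') ∧
    (∀ C y y', (wordSys (inputWord φ w)).lNe C y y' → (wordSys (inputWord φ w')).lNe C y y') ∧
    (∀ C y a, (wordSys (inputWord φ w)).lEqC C y a → (wordSys (inputWord φ w')).lEqC C y a) ∧
    (∀ C y a, (wordSys (inputWord φ w)).lNeC C y a → (wordSys (inputWord φ w')).lNeC C y a) := by
  refine ⟨fun p h => ?_, fun p C h => (disjunctAt_transfer w' h).1, fun C y y' h => ?_,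
    fun C y y' h => ?_, fun C y a h => ?_, fun C y a h => ?_⟩
  · have hp := lt_of_inputWord_inl h
    change (inputWord φ w)[p]? = _ at h
    change (inputWord φ w')[p]? = _
    rw [inputWord, List.getElem?_append_left (by simpa using hp)] at h ⊢
    exact h
  · obtain ⟨p, hp, -⟩ := id h
    obtain ⟨-, k, args, c, h1, h2⟩ := disjunctAt_transfer w' hp
    rwa [h2.eq, ← h1.eq]
  · obtain ⟨p, hp, -⟩ := id h
    obtain ⟨-, k, args, c, h1, h2⟩ := disjunctAt_transfer w' hp
    rwa [h2.ne, ← h1.ne]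
  · obtain ⟨p, hp, -⟩ := id h
    obtain ⟨-, k, args, c, h1, h2⟩ := disjunctAt_transfer w' hp
    rwa [h2.eqC, ← h1.eqC]
  · obtain ⟨p, hp, -⟩ := id h
    obtain ⟨-, k, args, c, h1, h2⟩ := disjunctAt_transfer w' hp
    rwa [h2.neC, ← h1.neC]

/-- Breaks a circularity: the certificate is built from derivations in the structure of the word
without certificate, but it is checked in the structure of the word that contains it. -/
theorem wordSys_inputWord (φ : Sentence A) (w w' : List (Letter A m)) :
    wordSys (inputWord φ w) = wordSys (inputWord φ w') := by
  obtain ⟨h1, h2, h3, h4, h5, h6⟩ := wordSys_le φ w w'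
  obtain ⟨h1', h2', h3', h4', h5', h6'⟩ := wordSys_le φ w' w
  have hw := represents_inputWord φ w
  have hw' := represents_inputWord φ w'
  rw [show wordSys (inputWord φ w) = ⟨_, _, _, _, _, _, _, _⟩ from rfl,
    show wordSys (inputWord φ w') = ⟨_, _, _, _, _, _, _, _⟩ from rfl, Sys.mk.injEq]
  refine ⟨funext fun y => propext ((hw.uni y).trans (hw'.uni y).symm),
    funext₂ fun y y' => propext ((hw.eqA y y').trans (hw'.eqA y y').symm),
    funext fun p => propext ⟨h1 p, h1' p⟩, funext₂ fun p C => propext ⟨h2 p C, h2' p C⟩,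
    funext₃ fun C y y' => propext ⟨h3 C y y', h3' C y y'⟩,
    funext₃ fun C y y' => propext ⟨h4 C y y', h4' C y y'⟩,
    funext₃ fun C y y' => propext ⟨h5 C y y', h5' C y y'⟩,
    funext₃ fun C y y' => propext ⟨h6 C y y', h6' C y y'⟩⟩

/-! ### Membership in co-NP -/

theorem mem_certificate [Fintype A] {N : ℕ} {u u' : ℕ → A} {l l' : List (Sys.Fact A m)}
    (hl : ∀ f ∈ l, f ∈ Sys.boundedFacts A m N) (hl' : ∀ f ∈ l', f ∈ Sys.boundedFacts A m N)
    {r : Tag A m × List ℕ} (hr : r ∈ Sys.certificate N u u' l l') :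
    r.2.length = r.1.arity ∧ ∀ i ∈ r.2, i < N := by
  have hrec : ∀ (s : Bool) (f : Sys.Fact A m), f ∈ Sys.boundedFacts A m N →
      (Sys.Fact.record s f).2.length = (Sys.Fact.record s f).1.arity ∧
        ∀ i ∈ (Sys.Fact.record s f).2, i < N := by
    rintro s (⟨a, y⟩ | ⟨β, a, C, y, w⟩) hf
    · simpa [Sys.Fact.record, Tag.arity, Sys.boundedFacts] using hf
    · simpa [Sys.Fact.record, Tag.arity, Sys.boundedFacts, List.mem_ofFn] using hf
  simp only [Sys.certificate, List.mem_append, Sys.mem_unRecords, List.mem_map] at hr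
  rcases hr with (⟨y, hy, rfl⟩ | ⟨y, hy, rfl⟩) | ⟨f, hf, rfl⟩ | ⟨f, hf, rfl⟩
  · simpa [Tag.arity] using hy
  · simpa [Tag.arity] using hy
  · exact hrec _ _ (hl f hf)
  · exact hrec _ _ (hl' f hf)

theorem length_flatMap_recordWord_le {N : ℕ} (l : List (Tag A m × List ℕ))
    (hl : ∀ r ∈ l, r.2.length = r.1.arity ∧ ∀ i ∈ r.2, i < N) :
    (l.flatMap recordWord).length ≤ l.length * (1 + (m + 2) * N) := by
  induction l with
  | nil => simp
  | cons r l ih =>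
    have h1 := ih fun r hr => hl r (by simp [hr])
    have h2 := hl r (by simp)
    have h3 := length_recordWord_le r h2.2
    have h4 : r.2.length ≤ m + 2 := by
      rw [h2.1]
      cases r.1 <;> simp [Tag.arity]
    have h5 := Nat.mul_le_mul_right N h4
    rw [List.flatMap_cons, List.length_append, List.length_cons, Nat.add_mul]
    omega

/-- Certificates are for false sentences. The number of branching variables is `r + 1` rather than
`r`, because over two values one is needed even if `r = 0`. -/
theorem qcspInCoNP_of_isAlmostExTrivialLang [Finite A] (𝓑 : ConstraintLang A)
    (h𝓑 : IsAlmostExTrivialLang 𝓑) (r : ℕ) : QCSPInCoNP 𝓑 r := by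
  obtain ⟨c, hc⟩ := h𝓑
  have : Nonempty A := ⟨c⟩
  have := Fintype.ofFinite A
  have : Finite (Sym A) := by
    refine Finite.of_injective (β := Option A × Fin 12) (fun
      | .forallQ => (none, 0)
      | .existsQ => (none, 1)
      | .eqAtom => (none, 2)
      | .relAtom => (none, 3)
      | .disjunct => (none, 4)
      | .eqVar => (none, 5)
      | .neVar => (none, 6)
      | .eqConst => (none, 7)
      | .neConst => (none, 8)
      | .tick => (none, 9)
      | .endIndex => (none, 10)
      | .body => (none, 11)
      | .const a => (some a, 0)) ?_
    intro x y h
    cases x <;> cases y <;> simp_all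
  let n := Fintype.card A
  -- Two lists of value records and two derivations without repetitions, hence bounded by the number
  -- of facts, times the length of the longest record with its `r + 3` indices.
  let q : Polynomial ℕ := (2 * .X + 2 * (.C n * .X + .C (n ^ (r + 1)) *
    (.C n * (.X * (.X * .X ^ (r + 1)))))) * (1 + .C (r + 1 + 2) * .X)
  refine inNP_of_definable (Δ := Letter A (r + 1)) Definable.refutes q ?_ ?_
  · rintro _ ⟨φ, hφ, hfalse, rfl⟩
    set N := φ.enc.length with hN
    have hrep := represents_inputWord φ ([] : List (Letter A (r + 1)))
    obtain ⟨u, u', l, l', h1, h1', h2, h2', h3, h3', y, hy, huu, hall⟩ :=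
      hrep.exists_certificate (Nat.succ_pos r) (fun k args D ha => hc k _ (hφ k args D ha).2)
        (fun p C hp hC => by
          obtain ⟨k, args, D, ha, hD⟩ := hrep.of_rel p hp
          obtain ⟨d, hd, hd'⟩ := hD.of_dj C hC
          exact hd'.branching hrep.n_le (Nat.zero_lt_of_lt (hrep.bounded.dj p C hC))
            (Nat.le_succ r) fun hA => (hφ k args D ha).1 hA d hd) hfalse
    have hmem : ∀ s ∈ Sys.certificate N u u' l l', s.2.length = s.1.arity ∧ ∀ i ∈ s.2, i < N :=
      fun s hs => mem_certificate h2 h2' hs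
    refine ⟨(Sys.certificate N u u' l l').flatMap recordWord, ?_, ?_⟩
    · refine (length_flatMap_recordWord_le _ hmem).trans ?_
      have hcard : ∀ k : List (Sys.Fact A (r + 1)), k.Nodup →
          (∀ f ∈ k, f ∈ Sys.boundedFacts A (r + 1) N) →
          k.length ≤ n * N + n ^ (r + 1) * (n * (N * (N * N ^ (r + 1)))) := by
        classical
        intro k hk hk'
        rw [← Sys.card_boundedFacts, ← List.toFinset_card_of_nodup hk]
        exact Finset.card_le_card fun f hf => hk' f (List.mem_toFinset.1 hf)
      have hl := hcard l h1 h2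
      have hl' := hcard l' h1' h2'
      simp only [q, Polynomial.eval_mul, Polynomial.eval_add, Polynomial.eval_pow,
        Polynomial.eval_C, Polynomial.eval_X, Polynomial.eval_ofNat, Polynomial.eval_one]
      refine Nat.mul_le_mul_right _ ?_
      simp only [Sys.certificate, Sys.unRecords, List.length_append, List.length_map,
        List.length_range]
      omega
    · set d := (Sys.certificate N u u' l l').flatMap recordWord
      have hz := represents_inputWord φ d
      rw [wordSys_inputWord φ [] d] at h3 h3' huu
      refine Sys.refutes_certificate hz.bounded ?_ h3 h3' hy huu hall (fun p τ is hr =>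
        (List.getElem?_eq_some_iff.1 hr.2.1).1)
        (fun k => φ.enc.length + (k.flatMap recordWord).length) (fun k₁ s k₂ => ?_)
        (recordAt_iff φ.enc fun s hs => (hmem s hs).1)
      · simp
      · simp only [List.flatMap_append, List.flatMap_cons, List.length_append, recordWord,
          List.length_cons]
        omega
  · rintro _ ⟨φ, hφ, htrue, rfl⟩ w hw
    have hrep := represents_inputWord φ w
    refine Sys.Refutes.not_isTrue hrep ?_ (fun p τ is hr => ?_) hw htrue
    · simp
    · obtain ⟨-, h1, e, h2⟩ := hr
      exact ⟨(List.getElem?_eq_some_iff.1 h1).1, h2.lt⟩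

end Verification


/-! ### The clones of the relations `τ_k` -/

section tau

variable {A : Type} {α β : Set A}

/-- An element of both `α` and `β` never leaves either block, so it may replace any entry. -/
theorem rho'_of_eq_or {c : A} (hα : c ∈ α) (hβ : c ∈ β) {x y z x' y' z' : A}
    (h : rho' α β x y z) (hx : x' = x ∨ x' = c) (hy : y' = y ∨ y' = c) (hz : z' = z ∨ z' = c) :
    rho' α β x' y' z' := by
  rcases hx with rfl | rfl <;> rcases hy with rfl | rfl <;> rcases hz with rfl | rfl <;>
    simp only [rho', hα, hβ] at h ⊢ <;> tauto

theorem idempotent_pol_tauConst : Idempotent (Pol (tauConst α β)) := by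
  intro m f hf a
  exact hf.2 1 _ (.const a) (fun _ _ => a) fun _ => rfl

theorem almostExTrivial_of_mem_inv [Finite A] {c : A} (hα : c ∈ α) (hβ : c ∈ β) {k : ℕ}
    {R : Set (Fin k → A)} (hR : R ∈ Inv (Pol (tauConst α β)) k) : AlmostExTrivial c R := by
  classical
  -- Take all constants and equalities that hold throughout `R`, and the closure of `R` under
  -- replacing entries by `c`.
  refine ⟨{p | ∀ t ∈ R, t p.1 = p.2}, {q | ∀ t ∈ R, t q.1 = t q.2},
    {t | ∃ t₀ ∈ R, ∀ i, t i = t₀ i ∨ t i = c}, ?_, fun t => ⟨fun ht => ?_, ?_⟩⟩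
  · rintro t ⟨t₀, ht₀, h⟩ i
    refine ⟨t₀, ht₀, fun j => ?_⟩
    by_cases hj : j = i
    · subst hj; simp
    · simpa [hj] using h j
  · exact ⟨fun p hp => hp t ht, fun q hq => hq t ht, t, ht, fun i => .inl rfl⟩
  · rintro ⟨hP, hQ, t₀, ht₀, ht⟩
    obtain ⟨n, ⟨e⟩⟩ := Finite.exists_equiv_fin R
    set j₀ : Fin n := e ⟨t₀, ht₀⟩ with hj₀
    let row : Fin k → Fin n → A := fun i j => (e.symm j).1 i
    have hrow₀ : ∀ i, row i j₀ = t₀ i := fun i => by simp [row, hj₀]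
    -- The tuples of `R` are listed as the columns of a matrix and `f` is to send its rows to the
    -- entries of `t`. Constant rows are compatible with this by the implied constants, and repeated
    -- rows by the implied equalities.
    let f : (Fin n → A) → A := fun x => if ∀ j, x j = x j₀ then x j₀ else
      if h : ∃ i, row i = x then t h.choose else c
    have hconst : ∀ x a, (∀ j, x j = a) → f x = a := by
      intro x a hx
      have : ∀ j, x j = x j₀ := fun j => (hx j).trans (hx j₀).symm
      simp only [f, if_pos this, hx]
    have hval : ∀ x, f x = x j₀ ∨ f x = c := by
      intro x
      simp only [f]
      split_ifs with h1 h2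
      · exact .inl rfl
      · rcases ht h2.choose with h | h
        · left
          rw [h, ← hrow₀, h2.choose_spec]
        · exact .inr h
      · exact .inr rfl
    have hrow : ∀ i, f (row i) = t i := by
      intro i
      by_cases h1 : ∀ j, row i j = row i j₀
      · rw [hconst _ _ h1]
        refine (hP (i, row i j₀) fun s hs => ?_).symm
        simpa [row] using h1 (e ⟨s, hs⟩)
      · have h2 : ∃ i', row i' = row i := ⟨i, rfl⟩
        simp only [f, if_neg h1, dif_pos h2]
        refine hQ (_, i) fun s hs => ?_
        have := congrFun h2.choose_spec (e ⟨s, hs⟩)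
        simp only [row, Equiv.symm_apply_apply] at this
        exact this
    -- The single argument tuple `M j₀` suffices for `τ_k`: the disjunct that it satisfies still
    -- holds, because each entry of the result is the entry of `M j₀` or `c`.
    have hf : f ∈ Pol (tauConst α β) n := by
      refine ⟨Nat.zero_lt_of_lt j₀.2, ?_⟩
      rintro k S (⟨k, hk⟩ | a) M hM
      · obtain ⟨i, hi⟩ := hM j₀
        exact ⟨i, rho'_of_eq_or hα hβ hi (hval _) (hval _) (hval _)⟩
      · exact hconst _ _ hM
    have := hR n f hf (fun j => (e.symm j).1) fun j => (e.symm j).2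
    convert this using 1
    funext i
    exact (hrow i).symm

/-- A tuple of a generating set separates the two blocks of a partition. -/
theorem exists_separating {a b : A} (ha : a ∉ β) (hb : b ∉ α) (hαβ : α ∪ β = Set.univ) {m : ℕ}
    {Λ : Set (Fin m → A)} (hΛ : Generates (Pol (tauConst α β)) Λ) {I : Set (Fin m)}
    (hI : I.Nonempty) (hI' : Iᶜ.Nonempty) :
    ∃ t ∈ Λ, I = {i | t i ∈ α} ∨ I = {i | t i ∈ α}ᶜ := by
  classical
  obtain ⟨i₀, hi₀⟩ := hI
  obtain ⟨j₀, hj₀⟩ := hI'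
  obtain ⟨n, f, hf, M, hM, hfM⟩ := hΛ fun i => if i ∈ I then a else b
  -- One triple `(i, i', i')` for each `i ∈ I` and `i' ∉ I`. On the tuple with value `a` on `I` and
  -- `b` elsewhere every triple is `(a, b, b)`, which violates `ρ'`; as `f` preserves `τ_K`, one
  -- argument tuple must violate all triples at once.
  obtain ⟨K, ⟨e⟩⟩ := Finite.exists_equiv_fin (I × (Iᶜ : Set (Fin m)))
  have hK : 1 ≤ K := Nat.one_le_iff_ne_zero.2 fun h => by
    subst h
    exact (e (⟨i₀, hi₀⟩, ⟨j₀, hj₀⟩)).elim0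
  let pos : Fin (3 * K) → Fin m := fun x =>
    if (x : ℕ) % 3 = 0 then (e.symm ⟨x / 3, by omega⟩).1 else (e.symm ⟨x / 3, by omega⟩).2
  have hpos0 : ∀ (q : Fin K) h, pos ⟨3 * q, h⟩ = (e.symm q).1 := fun q h => by simp [pos]
  have hpos1 : ∀ (q : Fin K) h, pos ⟨3 * q + 1, h⟩ = (e.symm q).2 := fun q h => by
    have h1 : (3 * (q : ℕ) + 1) % 3 = 1 := by omega
    have h2 : (3 * (q : ℕ) + 1) / 3 = q := by omega
    simp [pos, h1, h2]
  have hpos2 : ∀ (q : Fin K) h, pos ⟨3 * q + 2, h⟩ = (e.symm q).2 := fun q h => by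
    have h1 : (3 * (q : ℕ) + 2) % 3 = 2 := by omega
    have h2 : (3 * (q : ℕ) + 2) / 3 = q := by omega
    simp [pos, h1, h2]
  obtain ⟨j, hj⟩ : ∃ j, (fun x => M j (pos x)) ∉ tau α β K := by
    by_contra hno
    push Not at hno
    obtain ⟨q, hq⟩ := hf.2 _ _ (.tau K hK) (fun j x => M j (pos x)) hno
    have hval := fun i => congrFun hfM i
    simp only [hpos0, hpos1, hpos2, hval] at hq
    have h1 : ((e.symm q).1 : Fin m) ∈ I := (e.symm q).1.2
    have h2 : ((e.symm q).2 : Fin m) ∉ I := (e.symm q).2.2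
    rw [if_pos h1, if_neg h2] at hq
    exact hq.elim (fun h => hb h.2.1) fun h => ha h.1
  have hsep : ∀ i ∈ I, ∀ i' ∉ I, (M j i ∈ α ↔ M j i' ∉ α) := by
    intro i hi i' hi'
    have hno : ¬ rho' α β (M j i) (M j i') (M j i') := by
      intro h
      refine hj ⟨e (⟨i, hi⟩, ⟨i', hi'⟩), ?_⟩
      simpa only [hpos0, hpos1, hpos2, Equiv.symm_apply_apply] using h
    have h1 : M j i ∈ α ∪ β := hαβ ▸ Set.mem_univ _
    have h2 : M j i' ∈ α ∪ β := hαβ ▸ Set.mem_univ _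
    simp only [rho', Set.mem_union] at hno h1 h2
    tauto
  refine ⟨M j, hM j, ?_⟩
  by_cases h0 : M j i₀ ∈ α
  · left
    ext i
    by_cases hi : i ∈ I
    · exact iff_of_true hi ((hsep i hi j₀ hj₀).2 ((hsep i₀ hi₀ j₀ hj₀).1 h0))
    · exact iff_of_false hi ((hsep i₀ hi₀ i hi).1 h0)
  · right
    have hj₀' : M j j₀ ∈ α := by
      by_contra h
      exact h0 ((hsep i₀ hi₀ j₀ hj₀).2 h)
    ext i
    by_cases hi : i ∈ I
    · exact iff_of_true hi fun h => (hsep i hi j₀ hj₀).1 h hj₀'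
    · refine iff_of_false hi fun h => h ?_
      by_contra h'
      exact h0 ((hsep i₀ hi₀ i hi).2 h')

/-- Each generator separates only one set of coordinates and its complement, and all subsets except
the empty and the full one must be separated. -/
theorem two_pow_le_of_generates {a b : A} (ha : a ∉ β) (hb : b ∉ α) (hαβ : α ∪ β = Set.univ)
    {m : ℕ} {Λ : Finset (Fin m → A)}
    (hΛ : Generates (Pol (tauConst α β)) (Λ : Set (Fin m → A))) : 2 ^ m ≤ 2 * Λ.card + 2 := by
  classical
  let X : (Fin m → A) → Finset (Fin m) := fun t => Finset.univ.filter fun i => t i ∈ α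
  have hsub : (Finset.univ : Finset (Finset (Fin m))) ⊆
      (Λ.image X ∪ Λ.image fun t => (X t)ᶜ) ∪ {∅, Finset.univ} := by
    intro I _
    by_cases h1 : I = ∅
    · simp [h1]
    by_cases h2 : I = Finset.univ
    · simp [h2]
    obtain ⟨t, ht, h⟩ := exists_separating ha hb hαβ hΛ (I := (I : Set (Fin m)))
      (by simpa [Finset.nonempty_iff_ne_empty] using h1) (by
        rw [← Finset.coe_compl, Finset.coe_nonempty, Finset.nonempty_iff_ne_empty]
        simpa using h2)
    refine Finset.mem_union_left _ (Finset.mem_union.2 (h.imp (fun h => ?_) fun h => ?_))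
    · refine Finset.mem_image.2 ⟨t, ht, Finset.coe_injective ?_⟩
      rw [h]; simp [X]
    · refine Finset.mem_image.2 ⟨t, ht, Finset.coe_injective ?_⟩
      rw [h]
      ext i
      simp [X]
  calc 2 ^ m = (Finset.univ : Finset (Finset (Fin m))).card := by simp
    _ ≤ _ := Finset.card_le_card hsub
    _ ≤ ((Λ.image X).card + (Λ.image fun t => (X t)ᶜ).card) + 2 :=
      (Finset.card_union_le _ _).trans (add_le_add (Finset.card_union_le _ _) Finset.card_le_two)
    _ ≤ 2 * Λ.card + 2 := by
      have h1 := Finset.card_image_le (s := Λ) (f := X)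
      have h2 := Finset.card_image_le (s := Λ) (f := fun t => (X t)ᶜ)
      omega

/-- For `m ≥ 2` the additive term in `2 ^ m ≤ 2 * g + 2` is at most half of `2 ^ m`, which gives the
constant `4`. The infimum is attained, because projections generate the power from all of its
tuples. -/
theorem egp_pol_tauConst [Finite A] {a b : A} (ha : a ∉ β) (hb : b ∉ α)
    (hαβ : α ∪ β = Set.univ) : EGP (Pol (tauConst α β)) := by
  classical
  have := Fintype.ofFinite A
  refine ⟨2, one_lt_two, Asymptotics.IsBigO.of_bound 4 ?_⟩
  filter_upwards [Filter.eventually_ge_atTop 2] with m hm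
  have hne : {n | ∃ Λ : Finset (Fin m → A), Λ.card = n ∧
      Generates (Pol (tauConst α β)) (Λ : Set (Fin m → A))}.Nonempty := by
    refine ⟨_, Finset.univ, rfl, fun t => ⟨1, fun x => x 0, ⟨one_pos, fun k R _ M hM => hM 0⟩,
      fun _ => t, by simp, rfl⟩⟩
  obtain ⟨Λ, hcard, hΛ⟩ := Nat.sInf_mem hne
  have h1 : 2 ^ m ≤ 2 * genNumber (Pol (tauConst α β)) m + 2 := by
    have := two_pow_le_of_generates ha hb hαβ hΛ
    rwa [hcard] at this
  have h2 : 2 ^ 2 ≤ 2 ^ m := Nat.pow_le_pow_right two_pos hm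
  have h3 : 2 ^ m ≤ 4 * genNumber (Pol (tauConst α β)) m := by omega
  rw [Real.norm_of_nonneg (by positivity), Real.norm_of_nonneg (by positivity)]
  exact_mod_cast h3

end tau

end QCSP

theorem mainTheorem10 :
    (∀ (A : Type) [Finite A] (𝓑 : QCSP.ConstraintLang A), QCSP.IsAlmostExTrivialLang 𝓑 →
      ∀ r : ℕ, QCSP.QCSPInCoNP 𝓑 r) ∧
    (∀ (A : Type) [Finite A] (α β : Set A), α ⊂ Set.univ → β ⊂ Set.univ → α ∪ β = Set.univ →
      (α ∩ β).Nonempty →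
      (∀ r : ℕ, QCSP.QCSPInCoNP (QCSP.Inv (QCSP.Pol (QCSP.tauConst α β))) r) ∧
      QCSP.Idempotent (QCSP.Pol (QCSP.tauConst α β)) ∧
      QCSP.EGP (QCSP.Pol (QCSP.tauConst α β))) := by
  refine ⟨fun A _ 𝓑 h r => QCSP.qcspInCoNP_of_isAlmostExTrivialLang 𝓑 h r,
    fun A _ α β hα hβ hαβ ⟨c, hcα, hcβ⟩ => ⟨fun r => ?_, QCSP.idempotent_pol_tauConst, ?_⟩⟩
  · exact QCSP.qcspInCoNP_of_isAlmostExTrivialLang _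
      ⟨c, fun k R hR => QCSP.almostExTrivial_of_mem_inv hcα hcβ hR⟩ r
  · obtain ⟨b, -, hb⟩ := Set.exists_of_ssubset hα
    obtain ⟨a, -, ha⟩ := Set.exists_of_ssubset hβ
    exact QCSP.egp_pol_tauConst ha hb hαβ
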